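/- **Mode theory.** Let $\mathcal M$ be the locally posetal 2-category with modes $\mathsf{dm},\mathsf{sm}$, with non-identity 1-cells $\triangle:\mathsf{dm}\to\mathsf{sm}$, $\square,\lozenge:\mathsf{sm}\to\mathsf{dm}$, $\triangle\square,\triangle\lozenge:\mathsf{sm}\to\mathsf{sm}$, with $\square\triangle=\lozenge\triangle=1_{\mathsf{dm}}$, and with 2-cells generated by $\square\le\lozenge$ and $\triangle\square\le 1_{\mathsf{sm}}\le\triangle\lozenge$. **dTT natural models.** A *dTT natural model* consists of: a strict 2-functor $\mathcal C:\mathcal M^{\mathrm{coop}}\to\mathrm{Cat}$, with values categories $\mathcal C_p$ of contexts, lock functors $\Gamma\mapsto\Gamma.🔒_\mu$ from $\mathcal C_q$ to $\mathcal C_p$ for $\mu:p\to q$, and keys $\Gamma.🔒_\nu\to\Gamma.🔒_\mu$ for $\mu\le\nu$; a terminal (empty) context in each $\mathcal C_p$; such that $🔒_\lozenge$ is fully faithful, $1.🔒_\lozenge$ is subterminal, and the objects of $\mathcal C_{\mathsf{sm}}$ that admit a map to $1.🔒_\lozenge$ are exactly those isomorphic to an object in the image of $🔒_\lozenge$; and,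 for every mode $p$, a map of presheaves $\mathrm{Tm}_p\to\mathrm{Ty}_p$ on $\mathcal C_p$ with, for every $\mu:p\to q$, chosen representations of its pullback along $🔒_\mu$, i.e. context extensions $(\Gamma,x:^\mu A)$ for $A\in\mathrm{Ty}_p(\Gamma.🔒_\mu)$. Write $🔑:\Gamma\to\Gamma.🔒_{\triangle\square}$ for the key of $\triangle\square\le1$. **Telescopes.** A telescope $\Theta$ in context $\Gamma$ is a finite list of types annotated by modalities, successively extending $\Gamma$ to a context $(\Gamma\mid\Theta)$. A partial substitution $t:\Theta$ in context $\Gamma$ is a section of $(\Gamma\mid\Theta)\to\Gamma$; morphisms $\Theta\to\Theta'$ are maps $(\Gamma\mid\Theta)\to(\Gamma\mid\Theta')$ over $\Gamma$. Over $\mathcal C_{\mathsf{sm}}$ these form a category with families (CwF) $\mathbf{Tel}$ internal to presheaves, whose contexts over $\Gamma$ are telescopes $\Theta$ in context $\Gamma$, whose types over $\Theta$ are telescopes in context $(\Gamma\mid\Theta)$, whose terms are partial substitutions, and whose comprehension and $\Sigma$-types are concatenation. $\mathbf{Tel}_1$ is its submodel with the same contexts, but only length-one telescopes as types. A length-one telescope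 is *non-modal* if its annotation is the identity modality, and *nontrivially modal* otherwise. $\mathbf{Tel}^2$ is the internal Sierpinski CwF: its contexts are morphisms $\theta_{01}:\Theta_1\to\Theta_0$, and its types over $\theta_{01}$ are pairs of telescopes $A_0$ over $\Theta_0$ and $A_1$ over $(\Theta_1\mid A_0[\theta_{01}])$. All operations are strictly stable under substitution in $\Gamma$. **Type display.** A *type display* is a strict internal CwF morphism $(🔒_{\triangle\square})^*\mathbf{Tel}_1\to\mathbf{Tel}^2$ whose $0$-part is substitution along $🔑$ and such that the $1$-part $A^{\mathsf d}$ of the image of a non-modal type $A$ is a single non-modal type, and that of a nontrivially modal type is the empty telescope. On contexts it sends $\Theta$ to a morphism $\mathsf{evens}:\Theta^{\mathsf D}\to\Theta[🔑]$; the telescope $\Theta^{\mathsf D}$ is its décalage. On dependent types and terms its $1$-part gives $A^{\mathsf d}$ in context $(\Gamma\mid\Theta^{\mathsf D}\mid A[\mathsf{evens}])$ and $t^{\mathsf d}:A^{\mathsf d}[t[\mathsf{evens}]]$. **Telescope display.** A *telescope display* consists of: an internal pseudo CwF morphism $(-)^{\mathsf d}:(🔒_{\triangle\square})^*\mathbf{Tel}\to\mathbf{Tel}^2$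 preserving substitution, the empty context and $\Sigma$-types (concatenation and pairing) strictly, comprehension up to the canonical comparison isomorphism, and having substitution along $🔑$ as its $0$-part; a strict internal CwF morphism $(-)^{\mathsf D}:(🔒_{\triangle\square})^*\mathbf{Tel}\to\mathbf{Tel}$ (décalage of telescopes and of dependent, or meta-abstracted, telescopes); and an isomorphism of pseudo CwF morphisms, the identity on underlying functors, between $(-)^{\mathsf D}$ and the $1$-part $\Phi\mapsto(\Phi[\mathsf{evens}]\mid\Phi^{\mathsf d})$ of $(-)^{\mathsf d}$. Its components on a dependent telescope are written $\mathsf{ev}$ and $\mathsf{od}$, and its inverse $\langle-,-\rangle$. **Complete display.** A *complete display* is a telescope display whose restriction to $\mathbf{Tel}_1$ is a type display and which satisfies the following computation rules for all telescopes $\Phi$ in context $(\Gamma.🔒_{\triangle\square}\mid\Theta)$, all types $A$ over $\Phi$ annotated by $\mu$, and all partial substitutions $[s,t]$ in $(\Phi,x:^\mu A)$. For non-modal $A$: $$(\Phi,x:A)^{\mathsf D}=(\Phi^{\mathsf D},\,x:A[\mathsf{evens}],\,x':A^{\mathsf d}),\qquad [s,t]^{\mathsf D}=[s^{\mathsf D},t[\mathsf{evens}],t^{\mathsf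 d}],$$ $$(\Phi,x:A)^{\mathsf d}=(\Phi^{\mathsf d},\,x':A^{\mathsf d}\langle\varphi,\varphi'\rangle\,x)\ \ (\varphi:\Phi[\mathsf{evens}],\ \varphi':\Phi^{\mathsf d}),\qquad [s,t]^{\mathsf d}=[s^{\mathsf d},t^{\mathsf d}],$$ $$[s,t,t']^{\mathsf{ev}}=[s^{\mathsf{ev}},t],\qquad [s,t,t']^{\mathsf{od}}=[s^{\mathsf{od}},t'],\qquad \langle[s,t],[s',t']\rangle=[\langle s,s'\rangle,t,t'].$$ For nontrivially modal $A$ the same rules hold with all the entries $x'$, $t'$ and $t^{\mathsf d}$ omitted. **Theorem.** Let $\mathcal C$ be a dTT natural model, with telescopes given by lists of types as above. For every type display on $\mathcal C$ there is exactly one complete display on $\mathcal C$ whose restriction to $\mathbf{Tel}_1$ is that type display. -/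

import Mathlib

open CategoryTheory Opposite

universe u v w

namespace DTT

/-! ### The mode theory -/

/-- The two modes: discrete and simplicial. -/
inductive Mode : Type
  | dm
  | sm

/-- The 1-cells of the mode 2-category: identities, `△ : dm → sm`, `□, ◇ : sm → dm`,
and the two composites `△□, △◇ : sm → sm`. -/
inductive Modality : Mode → Mode → Type
  | one (p : Mode) : Modality p p
  | tri : Modality .dm .sm
  | box : Modality .sm .dm
  | dia : Modality .sm .dm
  | triBox : Modality .sm .sm
  | triDia : Modality .sm .sm

namespace Modality

/-- Composition in diagrammatic order: `comp ρ ν` is `ν ∘ ρ`. -/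
def comp : {p q r : Mode} → Modality p q → Modality q r → Modality p r
  | _, _, _, one _, ν => ν
  | _, _, _, tri, one _ => tri
  | _, _, _, tri, box => one .dm
  | _, _, _, tri, dia => one .dm
  | _, _, _, tri, triBox => tri
  | _, _, _, tri, triDia => tri
  | _, _, _, box, one _ => box
  | _, _, _, box, tri => triBox
  | _, _, _, dia, one _ => dia
  | _, _, _, dia, tri => triDia
  | _, _, _, triBox, one _ => triBox
  | _, _, _, triBox, box => box
  | _, _, _, triBox, dia => box
  | _, _, _, triBox, triBox => triBox
  | _, _, _, triBox, triDia => triBox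
  | _, _, _, triDia, one _ => triDia
  | _, _, _, triDia, box => dia
  | _, _, _, triDia, dia => dia
  | _, _, _, triDia, triBox => triDia
  | _, _, _, triDia, triDia => triDia

/-- The 2-cells: the hom-posets are generated by `□ ≤ ◇` and `△□ ≤ 1 ≤ △◇`. -/
inductive Le : {p q : Mode} → Modality p q → Modality p q → Prop
  | refl {p q : Mode} (μ : Modality p q) : Le μ μ
  | box_dia : Le box dia
  | triBox_one : Le triBox (one .sm)
  | one_triDia : Le (one .sm) triDia
  | triBox_triDia : Le triBox triDia

end Modality

instance : Category Mode where
  Hom := Modality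
  id := Modality.one
  comp := Modality.comp
  id_comp := by rintro _ _ (_ | _ | _ | _ | _ | _) <;> rfl
  comp_id := by rintro _ _ (_ | _ | _ | _ | _ | _) <;> rfl
  assoc := by
    rintro _ _ _ _ (_ | _ | _ | _ | _ | _) (_ | _ | _ | _ | _ | _)
      (_ | _ | _ | _ | _ | _) <;> rfl

instance (p q : Mode) : PartialOrder (p ⟶ q) where
  le := Modality.Le
  le_refl := Modality.Le.refl
  le_trans := by rintro _ _ _ (_ | _ | _ | _ | _) (_ | _ | _ | _ | _) <;> constructor
  le_antisymm := by rintro _ _ (_ | _ | _ | _ | _) h <;> first | rfl | cases h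

/-- Composition is monotone, so `Mode` is a locally posetal 2-category. -/
theorem Modality.comp_le_comp {p q r : Mode} {ν ν' : p ⟶ q} {μ μ' : q ⟶ r}
    (hν : ν ≤ ν') (hμ : μ ≤ μ') : ν ≫ μ ≤ ν' ≫ μ' := by
  change Modality.Le _ _ at hν
  change Modality.Le _ _ at hμ
  change Modality.Le (Modality.comp _ _) (Modality.comp _ _)
  cases hν with
  | refl ν =>
    cases hμ with
    | refl μ => exact .refl _
    | _ => change Modality _ _ at ν; cases ν <;> constructor
  | _ =>
    cases hμ with
    | refl μ => change Modality _ _ at μ; cases μ <;> constructor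
    | _ => constructor

/-- The modality `△□`. -/
abbrev triBox : Mode.sm ⟶ Mode.sm := Modality.triBox

theorem triBox_le_id : triBox ≤ 𝟙 Mode.sm := Modality.Le.triBox_one

/-! ### dTT natural models -/

/-- A strict 2-functor `𝓜ᶜᵒᵒᵖ → Cat` on the mode 2-category `𝓜`, with a chosen empty context
at every mode: categories of contexts, lock functors, and keys between them. -/
structure ModalContextStructure where
  /-- The contexts at each mode. -/
  Ctx : Mode → Type u
  [cat : ∀ p, Category.{v} (Ctx p)]
  /-- The lock functors `Γ ↦ Γ.🔒_μ`. -/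
  lock : {p q : Mode} → (p ⟶ q) → Ctx q ⥤ Ctx p
  lock_id : ∀ p, lock (𝟙 p) = 𝟭 (Ctx p)
  lock_comp : ∀ {p q r : Mode} (ν : p ⟶ q) (μ : q ⟶ r), lock (ν ≫ μ) = lock μ ⋙ lock ν
  /-- The keys. -/
  key : {p q : Mode} → {μ ν : p ⟶ q} → μ ≤ ν → (lock ν ⟶ lock μ)
  key_refl : ∀ {p q : Mode} (μ : p ⟶ q), key (le_refl μ) = 𝟙 (lock μ)
  key_trans : ∀ {p q : Mode} {μ ν ρ : p ⟶ q} (h : μ ≤ ν) (k : ν ≤ ρ),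
    key (h.trans k) = key k ≫ key h
  key_comp : ∀ {p q r : Mode} {ν ν' : p ⟶ q} {μ μ' : q ⟶ r} (hν : ν ≤ ν') (hμ : μ ≤ μ'),
    key (Modality.comp_le_comp hν hμ) =
      eqToHom (lock_comp ν' μ') ≫ (key hμ ◫ key hν) ≫ eqToHom (lock_comp ν μ).symm
  /-- The empty contexts. -/
  emp : ∀ p, Ctx p
  isTerminalEmp : ∀ p, Limits.IsTerminal (emp p)

attribute [instance] ModalContextStructure.cat

/-- A dTT context structure: `1.🔒_◇` is subterminal, and the slice over it is the replete image
of the fully faithful functor `🔒_◇`. -/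
structure DTTContextStructure extends ModalContextStructure.{u, v} where
  lock_dia_full : (lock Modality.dia).Full
  lock_dia_faithful : (lock Modality.dia).Faithful
  subterminal : ∀ {Γ : Ctx .sm} (f g : Γ ⟶ (lock Modality.dia).obj (emp .dm)), f = g
  flat_iff : ∀ Γ : Ctx .sm, Nonempty (Γ ⟶ (lock Modality.dia).obj (emp .dm)) ↔
    (lock Modality.dia).essImage Γ

/-- A dTT natural model: at each mode `p` a morphism of presheaves `pr : Tm p ⟶ Ty p`, with a
chosen representation of `(🔒_μ)^* pr` for every modality `μ : p ⟶ q`, that is, a modal context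
extension `(Γ, x :^μ A)`. -/
structure DTTNaturalModel extends DTTContextStructure.{u, v} where
  /-- Types. -/
  Ty : ∀ p, (Ctx p)ᵒᵖ ⥤ Type w
  /-- Terms. -/
  Tm : ∀ p, (Ctx p)ᵒᵖ ⥤ Type w
  /-- The type of a term. -/
  pr : ∀ p, Tm p ⟶ Ty p
  /-- The context `(Γ, x :^μ A)`. -/
  extend : {p q : Mode} → (μ : p ⟶ q) → (Γ : Ctx q) →
    (Ty p).obj (op ((lock μ).obj Γ)) → Ctx q
  /-- The parent map. -/
  wk : {p q : Mode} → (μ : p ⟶ q) → (Γ : Ctx q) → (A : (Ty p).obj (op ((lock μ).obj Γ))) →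
    (extend μ Γ A ⟶ Γ)
  /-- The zero variable. -/
  var : {p q : Mode} → (μ : p ⟶ q) → (Γ : Ctx q) → (A : (Ty p).obj (op ((lock μ).obj Γ))) →
    (Tm p).obj (op ((lock μ).obj (extend μ Γ A)))
  pr_var : ∀ {p q : Mode} (μ : p ⟶ q) (Γ : Ctx q) (A : (Ty p).obj (op ((lock μ).obj Γ))),
    (pr p).app _ (var μ Γ A) = (Ty p).map ((lock μ).map (wk μ Γ A)).op A
  /-- Extension of a substitution by a term. -/
  pair : {p q : Mode} → (μ : p ⟶ q) → {Γ : Ctx q} → (A : (Ty p).obj (op ((lock μ).obj Γ))) →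
    {Δ : Ctx q} → (σ : Δ ⟶ Γ) → (t : (Tm p).obj (op ((lock μ).obj Δ))) →
    (pr p).app _ t = (Ty p).map ((lock μ).map σ).op A → (Δ ⟶ extend μ Γ A)
  pair_wk : ∀ {p q : Mode} (μ : p ⟶ q) {Γ : Ctx q} (A : (Ty p).obj (op ((lock μ).obj Γ)))
    {Δ : Ctx q} (σ : Δ ⟶ Γ) (t : (Tm p).obj (op ((lock μ).obj Δ)))
    (h : (pr p).app _ t = (Ty p).map ((lock μ).map σ).op A), pair μ A σ t h ≫ wk μ Γ A = σ
  var_pair : ∀ {p q : Mode} (μ : p ⟶ q) {Γ : Ctx q} (A : (Ty p).obj (op ((lock μ).obj Γ)))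
    {Δ : Ctx q} (σ : Δ ⟶ Γ) (t : (Tm p).obj (op ((lock μ).obj Δ)))
    (h : (pr p).app _ t = (Ty p).map ((lock μ).map σ).op A),
    (Tm p).map ((lock μ).map (pair μ A σ t h)).op (var μ Γ A) = t
  extend_hom_ext : ∀ {p q : Mode} (μ : p ⟶ q) {Γ : Ctx q}
    (A : (Ty p).obj (op ((lock μ).obj Γ))) {Δ : Ctx q} (τ τ' : Δ ⟶ extend μ Γ A),
    τ ≫ wk μ Γ A = τ' ≫ wk μ Γ A →
    (Tm p).map ((lock μ).map τ).op (var μ Γ A) = (Tm p).map ((lock μ).map τ').op (var μ Γ A) →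
    τ = τ'

namespace DTTNaturalModel

variable (M : DTTNaturalModel.{u, v, w}) {p q : Mode} (μ : p ⟶ q) {Γ Δ : M.Ctx q}

/-- The canonical map `(Δ, x :^μ A[σ]) ⟶ (Γ, x :^μ A)` over `σ`. -/
def lift (A : (M.Ty p).obj (op ((M.lock μ).obj Γ))) (σ : Δ ⟶ Γ) :
    M.extend μ Δ ((M.Ty p).map ((M.lock μ).map σ).op A) ⟶ M.extend μ Γ A :=
  M.pair μ A (M.wk μ Δ ((M.Ty p).map ((M.lock μ).map σ).op A) ≫ σ) (M.var μ Δ _) (by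
    rw [M.pr_var]
    simp)

theorem isPullback_lift (A : (M.Ty p).obj (op ((M.lock μ).obj Γ))) (σ : Δ ⟶ Γ) :
    IsPullback (M.lift μ A σ) (M.wk μ Δ _) (M.wk μ Γ A) σ := by
  have w : M.lift μ A σ ≫ M.wk μ Γ A = M.wk μ Δ _ ≫ σ := M.pair_wk _ _ _ _ _
  have hv : (M.Tm p).map ((M.lock μ).map (M.lift μ A σ)).op (M.var μ Γ A) = M.var μ Δ _ :=
    M.var_pair _ _ _ _ _
  have hp : ∀ s : Limits.PullbackCone (M.wk μ Γ A) σ,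
      (M.pr p).app _ ((M.Tm p).map ((M.lock μ).map s.fst).op (M.var μ Γ A)) =
        (M.Ty p).map ((M.lock μ).map s.snd).op ((M.Ty p).map ((M.lock μ).map σ).op A) := by
    intro s
    rw [NatTrans.naturality_apply, M.pr_var, ← Functor.map_comp_apply, ← Functor.map_comp_apply,
      ← op_comp, ← op_comp, ← Functor.map_comp, ← Functor.map_comp, s.condition]
  refine ⟨⟨w⟩, ⟨Limits.PullbackCone.IsLimit.mk _
    (fun s => M.pair μ _ s.snd _ (hp s)) ?_ ?_ ?_⟩⟩
  · intro s
    refine M.extend_hom_ext μ A _ _ ?_ ?_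
    · rw [Category.assoc, w, ← Category.assoc, M.pair_wk]
      exact s.condition.symm
    · rw [Functor.map_comp, op_comp, Functor.map_comp_apply, hv]
      exact M.var_pair _ _ _ _ _
  · intro s
    exact M.pair_wk _ _ _ _ _
  · intro s m h₁ h₂
    refine M.extend_hom_ext μ _ _ _ ?_ ?_
    · exact h₂.trans (M.pair_wk _ _ _ _ _).symm
    · rw [M.var_pair, ← hv, ← Functor.map_comp_apply, ← op_comp, ← Functor.map_comp, h₁]

/-- The lock functor of `△□`. -/
abbrev L : M.Ctx .sm ⥤ M.Ctx .sm := M.lock triBox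

/-- The key `Γ ⟶ Γ.🔒_△□` of the inequality `△□ ≤ 1`. -/
def keyTrans : 𝟭 (M.Ctx .sm) ⟶ M.L := eqToHom (M.lock_id .sm).symm ≫ M.key triBox_le_id

/-- The key at the context `Γ`. -/
def κ (Γ : M.Ctx .sm) : Γ ⟶ M.L.obj Γ := M.keyTrans.app Γ

end DTTNaturalModel

variable {M : DTTNaturalModel.{u, v, w}} {q : Mode}

/-! ### Telescopes as lists of types -/

/-- A type in context `Γ` annotated by a modality into the mode of `Γ`. -/
structure MTy (Γ : M.Ctx q) where
  /-- The mode of the type. -/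
  mode : Mode
  /-- The annotation. -/
  mod : mode ⟶ q
  /-- The type, in the locked context. -/
  ty : (M.Ty mode).obj (op ((M.lock mod).obj Γ))

namespace MTy

variable {Γ Δ : M.Ctx q}

/-- The extended context `(Γ, x :^μ A)`. -/
def ext (A : MTy Γ) : M.Ctx q := M.extend A.mod Γ A.ty

/-- The parent map. -/
def wk (A : MTy Γ) : A.ext ⟶ Γ := M.wk A.mod Γ A.ty

/-- Substitution. -/
def sub (A : MTy Γ) (σ : Δ ⟶ Γ) : MTy Δ :=
  ⟨A.mode, A.mod, (M.Ty A.mode).map ((M.lock A.mod).map σ).op A.ty⟩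

/-- The canonical map `(Δ, x :^μ A[σ]) ⟶ (Γ, x :^μ A)` over `σ`. -/
def lift (A : MTy Γ) (σ : Δ ⟶ Γ) : (A.sub σ).ext ⟶ A.ext := M.lift A.mod A.ty σ

theorem isPullback (A : MTy Γ) (σ : Δ ⟶ Γ) : IsPullback (A.lift σ) (A.sub σ).wk A.wk σ :=
  M.isPullback_lift A.mod A.ty σ

/-- A non-modal type, that is, one annotated by the identity modality. -/
def IsPlain (A : MTy Γ) : Prop :=
  ∃ B : (M.Ty q).obj (op ((M.lock (𝟙 q)).obj Γ)), A = ⟨q, 𝟙 q, B⟩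

end MTy

/-- A finite list of modal types from `Γ` to `Δ`: starting from `Γ`, successive extension by
the types of the list gives `Δ`. -/
inductive TelTo (Γ : M.Ctx q) : M.Ctx q → Type (max u w)
  | nil : TelTo Γ Γ
  | snoc {Δ : M.Ctx q} (Θ : TelTo Γ Δ) (A : MTy Δ) : TelTo Γ A.ext

namespace TelTo

variable {Γ Γ' Δ Ξ : M.Ctx q}

/-- The projection from the extended context. -/
def proj : {Δ : M.Ctx q} → TelTo Γ Δ → (Δ ⟶ Γ)
  | _, nil => 𝟙 Γ
  | _, snoc Θ A => A.wk ≫ Θ.proj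

/-- Concatenation of lists. -/
def append (Υ : TelTo Γ Δ) : {Ξ : M.Ctx q} → TelTo Δ Ξ → TelTo Γ Ξ
  | _, nil => Υ
  | _, snoc Φ A => snoc (append Υ Φ) A

theorem append_proj (Υ : TelTo Γ Δ) : {Ξ : M.Ctx q} → (Φ : TelTo Δ Ξ) →
    (Υ.append Φ).proj = Φ.proj ≫ Υ.proj
  | _, nil => (Category.id_comp _).symm
  | _, snoc Φ A => by simp [append, proj, append_proj Υ Φ]

theorem append_assoc (Θ : TelTo Γ Γ') (Υ : TelTo Γ' Δ) : {Ξ : M.Ctx q} → (Φ : TelTo Δ Ξ) →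
    (Θ.append Υ).append Φ = Θ.append (Υ.append Φ)
  | _, nil => rfl
  | _, snoc Φ A => by simp [append, append_assoc Θ Υ Φ]

/-- The result of substituting in a list along `σ : Γ' ⟶ Γ`: a list over `Γ'` and the map of
extended contexts over `σ`. -/
structure Sub (Γ' Δ : M.Ctx q) where
  /-- The extended context. -/
  ext : M.Ctx q
  /-- The list. -/
  path : TelTo Γ' ext
  /-- The map of extended contexts. -/
  lift : ext ⟶ Δ

/-- Substitution in a list of types, one type at a time. -/
def sub (σ : Γ' ⟶ Γ) : {Δ : M.Ctx q} → TelTo Γ Δ → Sub Γ' Δ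
  | _, nil => ⟨Γ', nil, σ⟩
  | _, snoc Θ A => ⟨_, (sub σ Θ).path.snoc (A.sub (sub σ Θ).lift), A.lift (sub σ Θ).lift⟩

theorem isPullback (σ : Γ' ⟶ Γ) : {Δ : M.Ctx q} → (Θ : TelTo Γ Δ) →
    IsPullback (Θ.sub σ).lift (Θ.sub σ).path.proj Θ.proj σ
  | _, nil => (IsPullback.of_vert_isIso ⟨by simp⟩ : IsPullback σ (𝟙 Γ') (𝟙 Γ) σ)
  | _, snoc Θ A => (A.isPullback _).paste_vert (isPullback σ Θ)

end TelTo

/-- Telescopes in context `Γ`: finite lists of modal types over `Γ`. -/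
structure Tel (Γ : M.Ctx q) where
  /-- The extended context `Γ ∣ Θ`. -/
  ext : M.Ctx q
  /-- The list of types. -/
  path : TelTo Γ ext

namespace Tel

variable {Γ Γ' Δ : M.Ctx q}

/-- The projection `(Γ ∣ Θ) ⟶ Γ`. -/
def proj (Θ : Tel Γ) : Θ.ext ⟶ Γ := Θ.path.proj

/-- The empty telescope. -/
def nil (Γ : M.Ctx q) : Tel Γ := ⟨Γ, .nil⟩

/-- A telescope of length one. -/
def single (A : MTy Γ) : Tel Γ := ⟨A.ext, TelTo.nil.snoc A⟩

/-- Concatenation `(Υ ∣ Φ)`. Extending a telescope by a type `A` is `Υ.append (single A)`. -/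
abbrev append (Υ : Tel Γ) (Φ : Tel Υ.ext) : Tel Γ := ⟨Φ.ext, Υ.path.append Φ.path⟩

theorem append_proj (Υ : Tel Γ) (Φ : Tel Υ.ext) :
    (Υ.append Φ).proj = Φ.proj ≫ Υ.proj := TelTo.append_proj _ _

theorem append_assoc (Θ : Tel Γ) (Υ : Tel Θ.ext) (Φ : Tel Υ.ext) :
    (Θ.append Υ).append Φ = Θ.append (Υ.append Φ) :=
  congrArg (Tel.mk _) (TelTo.append_assoc Θ.path Υ.path Φ.path)

/-- Substitution `Θ[σ]`. -/
def sub (Θ : Tel Γ) (σ : Γ' ⟶ Γ) : Tel Γ' := ⟨(Θ.path.sub σ).ext, (Θ.path.sub σ).path⟩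

/-- The canonical map `(Γ' ∣ Θ[σ]) ⟶ (Γ ∣ Θ)` over `σ`. -/
def lift (Θ : Tel Γ) (σ : Γ' ⟶ Γ) : (Θ.sub σ).ext ⟶ Θ.ext := (Θ.path.sub σ).lift

theorem isPullback (Θ : Tel Γ) (σ : Γ' ⟶ Γ) :
    IsPullback (Θ.lift σ) (Θ.sub σ).proj Θ.proj σ := Θ.path.isPullback σ

theorem lift_proj (Θ : Tel Γ) (σ : Γ' ⟶ Γ) :
    Θ.lift σ ≫ Θ.proj = (Θ.sub σ).proj ≫ σ := (Θ.isPullback σ).w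

theorem lift_proj_assoc (Θ : Tel Γ) (σ : Γ' ⟶ Γ) {X : M.Ctx q} (k : Γ ⟶ X) :
    Θ.lift σ ≫ Θ.proj ≫ k = (Θ.sub σ).proj ≫ σ ≫ k := by
  rw [← Category.assoc, lift_proj, Category.assoc]

/-- The map into `(Γ' ∣ Θ[σ])` with components `a` in `Γ'` and `b` in `(Γ ∣ Θ)`. -/
noncomputable def into (Θ : Tel Γ) (σ : Γ' ⟶ Γ) {X : M.Ctx q} (a : X ⟶ Γ') (b : X ⟶ Θ.ext)
    (h : b ≫ Θ.proj = a ≫ σ) : X ⟶ (Θ.sub σ).ext := (Θ.isPullback σ).lift b a h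

theorem into_proj (Θ : Tel Γ) (σ : Γ' ⟶ Γ) {X : M.Ctx q} (a : X ⟶ Γ') (b : X ⟶ Θ.ext)
    (h : b ≫ Θ.proj = a ≫ σ) : Θ.into σ a b h ≫ (Θ.sub σ).proj = a :=
  (Θ.isPullback σ).lift_snd _ _ _

theorem into_lift (Θ : Tel Γ) (σ : Γ' ⟶ Γ) {X : M.Ctx q} (a : X ⟶ Γ') (b : X ⟶ Θ.ext)
    (h : b ≫ Θ.proj = a ≫ σ) : Θ.into σ a b h ≫ Θ.lift σ = b :=
  (Θ.isPullback σ).lift_fst _ _ _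

theorem into_lift_assoc (Θ : Tel Γ) (σ : Γ' ⟶ Γ) {X Y : M.Ctx q} (a : X ⟶ Γ') (b : X ⟶ Θ.ext)
    (h : b ≫ Θ.proj = a ≫ σ) (k : Θ.ext ⟶ Y) : Θ.into σ a b h ≫ Θ.lift σ ≫ k = b ≫ k := by
  rw [← Category.assoc, into_lift]

theorem into_ext (Θ : Tel Γ) (σ : Γ' ⟶ Γ) {X : M.Ctx q} {f g : X ⟶ (Θ.sub σ).ext}
    (h₁ : f ≫ (Θ.sub σ).proj = g ≫ (Θ.sub σ).proj) (h₂ : f ≫ Θ.lift σ = g ≫ Θ.lift σ) :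
    f = g := (Θ.isPullback σ).hom_ext h₂ h₁

/-- The map of extended contexts induced by an equation `Θ' = Θ[σ]`. -/
def liftTo {Θ' : Tel Γ'} {Θ : Tel Γ} {σ : Γ' ⟶ Γ} (h : Θ' = Θ.sub σ) : Θ'.ext ⟶ Θ.ext :=
  eqToHom (congrArg Tel.ext h) ≫ Θ.lift σ

theorem liftTo_proj {Θ' : Tel Γ'} {Θ : Tel Γ} {σ : Γ' ⟶ Γ} (h : Θ' = Θ.sub σ) :
    liftTo h ≫ Θ.proj = Θ'.proj ≫ σ := by
  subst h
  simp [liftTo, lift_proj]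

/-- A morphism in the category of telescopes of `Γ`: a map `(Γ ∣ Θ) ⟶ (Γ ∣ Θ')` over `Γ`. -/
@[ext]
structure Hom (Θ Θ' : Tel Γ) where
  /-- The underlying map. -/
  hom : Θ.ext ⟶ Θ'.ext
  w : hom ≫ Θ'.proj = Θ.proj

/-- The category of telescopes of `Γ`. -/
instance : Category (Tel Γ) where
  Hom := Hom
  id Θ := ⟨𝟙 _, Category.id_comp _⟩
  comp f g := ⟨f.hom ≫ g.hom, by rw [Category.assoc, g.w, f.w]⟩
  id_comp _ := Hom.ext (Category.id_comp _)
  comp_id _ := Hom.ext (Category.comp_id _)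
  assoc _ _ _ := Hom.ext (Category.assoc _ _ _)

@[ext]
theorem hom_ext {Θ Θ' : Tel Γ} {f g : Θ ⟶ Θ'} (h : f.hom = g.hom) : f = g := Hom.ext h

@[simp]
theorem Hom.w' {Θ Θ' : Tel Γ} (f : Θ ⟶ Θ') : f.hom ≫ Θ'.proj = Θ.proj := f.w

@[simp]
theorem id_hom (Θ : Tel Γ) : Hom.hom (𝟙 Θ) = 𝟙 Θ.ext := rfl

@[simp]
theorem comp_hom {Θ₁ Θ₂ Θ₃ : Tel Γ} (f : Θ₁ ⟶ Θ₂) (g : Θ₂ ⟶ Θ₃) :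
    (f ≫ g).hom = f.hom ≫ g.hom := rfl

/-- Substitution along `σ`, as a functor between categories of telescopes. -/
noncomputable def reindex (σ : Γ' ⟶ Γ) : Tel Γ ⥤ Tel Γ' where
  obj Θ := Θ.sub σ
  map {Θ Θ'} f := ⟨Θ'.into σ (Θ.sub σ).proj (Θ.lift σ ≫ f.hom) (by simp [lift_proj]),
    into_proj ..⟩
  map_id Θ := by
    ext
    refine into_ext _ _ ?_ ?_ <;> simp [into_proj, into_lift]
  map_comp f g := by
    ext
    refine into_ext _ _ ?_ ?_ <;> simp [into_proj, into_lift, into_lift_assoc]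

theorem reindex_map_lift (σ : Γ' ⟶ Γ) {Θ Θ' : Tel Γ} (f : Θ ⟶ Θ') :
    ((reindex σ).map f).hom ≫ Θ'.lift σ = Θ.lift σ ≫ f.hom := into_lift ..

/-- The dependent projection `(Θ ∣ A) ⟶ Θ`. -/
abbrev wkHom (Θ : Tel Γ) (A : Tel Θ.ext) : Θ.append A ⟶ Θ := ⟨A.proj, (append_proj Θ A).symm⟩

/-- Partial substitutions `Γ ⊢ t : A`, that is, sections of `(Γ ∣ A) ⟶ Γ`. For a telescope given
as a list of types these are the lists of terms of successive types. -/
@[ext]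
structure Sec (A : Tel Γ) where
  /-- The underlying map. -/
  hom : Γ ⟶ A.ext
  w : hom ≫ A.proj = 𝟙 Γ

namespace Sec

/-- Substitution `t[σ]`. -/
noncomputable def sub {A : Tel Γ} (t : A.Sec) (σ : Γ' ⟶ Γ) : (A.sub σ).Sec :=
  ⟨A.into σ (𝟙 Γ') (σ ≫ t.hom) (by simp [t.w]), into_proj ..⟩

theorem sub_lift {A : Tel Γ} (t : A.Sec) (σ : Γ' ⟶ Γ) :
    (t.sub σ).hom ≫ A.lift σ = σ ≫ t.hom := into_lift ..

/-- The variable `Γ ∣ a : A ⊢ a : A`. -/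
noncomputable def var (A : Tel Γ) : (A.sub A.proj).Sec :=
  ⟨A.into A.proj (𝟙 _) (𝟙 _) rfl, into_proj ..⟩

/-- The pair `[s ∣ t] : (A ∣ B)` of `s : A` and `t : B[s]`. -/
def pair {A : Tel Γ} {B : Tel A.ext} (s : A.Sec) (t : (B.sub s.hom).Sec) :
    Sec (A.append B) :=
  ⟨t.hom ≫ B.lift s.hom, by
    rw [append_proj, Category.assoc, lift_proj_assoc, s.w, Category.comp_id, t.w]⟩

/-- A partial substitution in `A` over `Θ`, as a morphism `Θ ⟶ (Θ ∣ A)`. -/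
abbrev toHom (Θ : Tel Γ) {A : Tel Θ.ext} (t : A.Sec) : Θ ⟶ Θ.append A :=
  ⟨t.hom, by rw [append_proj, ← Category.assoc, t.w, Category.id_comp]⟩

end Sec

end Tel

/-! ### Décalage and display -/

open Tel

/-- An internal functor `(-)^D : (🔒_△□)^* Tel ⥤ Tel` between the internal categories of
telescopes in presheaves over `C_sm`, strictly preserving the empty telescope, with an internal
natural transformation to the substitution functor of the key. Equivalently, an internal functor
to the arrow category `Tel²` whose codomain part is substitution along the key. -/
structure DecFunctor (M : DTTNaturalModel.{u, v, w}) where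
  /-- Décalage of telescopes and of morphisms of telescopes. -/
  dec : ∀ Γ : M.Ctx .sm, Tel (M.L.obj Γ) ⥤ Tel Γ
  /-- The `evens` transformation `Θ^D ⟶ Θ[🔑]`. -/
  ev : ∀ Γ : M.Ctx .sm, dec Γ ⟶ reindex (M.κ Γ)
  dec_nil : ∀ Γ : M.Ctx .sm, (dec Γ).obj (nil (M.L.obj Γ)) = nil Γ
  /-- Stability under substitution in `Γ`, on objects. -/
  dec_sub : ∀ {Γ' Γ : M.Ctx .sm} (τ : Γ' ⟶ Γ) (Θ : Tel (M.L.obj Γ)),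
    (dec Γ').obj (Θ.sub (M.L.map τ)) = ((dec Γ).obj Θ).sub τ
  /-- Stability under substitution in `Γ`, on morphisms. -/
  dec_map_sub : ∀ {Γ' Γ : M.Ctx .sm} (τ : Γ' ⟶ Γ) {Θ Θ' : Tel (M.L.obj Γ)} (f : Θ ⟶ Θ'),
    ((dec Γ').map ((reindex (M.L.map τ)).map f)).hom ≫ liftTo (dec_sub τ Θ') =
      liftTo (dec_sub τ Θ) ≫ ((dec Γ).map f).hom
  /-- Stability of `evens` under substitution in `Γ`. -/
  ev_sub : ∀ {Γ' Γ : M.Ctx .sm} (τ : Γ' ⟶ Γ) (Θ : Tel (M.L.obj Γ)),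
    (((ev Γ').app (Θ.sub (M.L.map τ))).hom ≫ (Θ.sub (M.L.map τ)).lift (M.κ Γ')) ≫
        Θ.lift (M.L.map τ) =
      liftTo (dec_sub τ Θ) ≫ ((ev Γ).app Θ).hom ≫ Θ.lift (M.κ Γ)

namespace DecFunctor

variable {M : DTTNaturalModel.{u, v, w}} (F : DecFunctor M) {Γ Γ' : M.Ctx .sm}

/-- The telescope `Θ^D`. -/
abbrev D (Θ : Tel (M.L.obj Γ)) : Tel Γ := (F.dec Γ).obj Θ

/-- The composite `(Γ ∣ Θ^D) ⟶ (Γ ∣ Θ[🔑]) ⟶ (Γ.🔒_△□ ∣ Θ)`. -/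
noncomputable def evens (Θ : Tel (M.L.obj Γ)) : (F.D Θ).ext ⟶ Θ.ext :=
  ((F.ev Γ).app Θ).hom ≫ Θ.lift (M.κ Γ)

theorem map_evens {Θ' Θ : Tel (M.L.obj Γ)} (f : Θ' ⟶ Θ) :
    ((F.dec Γ).map f).hom ≫ F.evens Θ = F.evens Θ' ≫ f.hom := by
  have h : ((F.dec Γ).map f).hom ≫ ((F.ev Γ).app Θ).hom =
      ((F.ev Γ).app Θ').hom ≫ ((reindex (M.κ Γ)).map f).hom :=
    congrArg Hom.hom ((F.ev Γ).naturality f)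
  have e := (Category.assoc ((F.dec Γ).map f).hom ((F.ev Γ).app Θ).hom (Θ.lift (M.κ Γ))).symm
  refine e.trans ?_
  rw [h]
  refine (Category.assoc _ _ (Θ.lift (M.κ Γ))).trans ?_
  exact (congrArg (((F.ev Γ).app Θ').hom ≫ ·) (reindex_map_lift (M.κ Γ) f)).trans
    (Category.assoc _ _ _).symm

theorem evens_sub (τ : Γ' ⟶ Γ) (Θ : Tel (M.L.obj Γ)) :
    F.evens (Θ.sub (M.L.map τ)) ≫ Θ.lift (M.L.map τ) =
      liftTo (F.dec_sub τ Θ) ≫ F.evens Θ := F.ev_sub τ Θ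

/-- For `f : Θ' ⟶ Θ`, the map `(Γ ∣ Θ'^D ∣ A[f]) ⟶ (Γ ∣ Θ^D ∣ A)` over `f^D`, where `A` is
substituted along `evens`. -/
noncomputable def mapExt {Θ' Θ : Tel (M.L.obj Γ)} (f : Θ' ⟶ Θ) (A : Tel Θ.ext) :
    ((A.sub f.hom).sub (F.evens Θ')).ext ⟶ (A.sub (F.evens Θ)).ext :=
  A.into _ (((A.sub f.hom).sub (F.evens Θ')).proj ≫ ((F.dec Γ).map f).hom)
    ((A.sub f.hom).lift (F.evens Θ') ≫ A.lift f.hom) (by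
      rw [Category.assoc, lift_proj, lift_proj_assoc, Category.assoc, F.map_evens])

/-- For `τ : Γ' ⟶ Γ`, the map `(Γ' ∣ Θ^D[τ] ∣ A[τ]) ⟶ (Γ ∣ Θ^D ∣ A)` over `τ`, where `A` is
substituted along `evens`. -/
noncomputable def baseExt (τ : Γ' ⟶ Γ) (Θ : Tel (M.L.obj Γ)) (A : Tel Θ.ext) :
    ((A.sub (Θ.lift (M.L.map τ))).sub (F.evens (Θ.sub (M.L.map τ)))).ext ⟶
      (A.sub (F.evens Θ)).ext :=
  A.into _ (((A.sub (Θ.lift (M.L.map τ))).sub (F.evens (Θ.sub (M.L.map τ)))).proj ≫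
      liftTo (F.dec_sub τ Θ))
    ((A.sub (Θ.lift (M.L.map τ))).lift (F.evens (Θ.sub (M.L.map τ))) ≫
      A.lift (Θ.lift (M.L.map τ))) (by
      rw [Category.assoc, lift_proj, lift_proj_assoc, Category.assoc, F.evens_sub])

end DecFunctor

/-- A class of telescopes at the simplicial mode that is closed under substitution. -/
structure TelClass (M : DTTNaturalModel.{u, v, w}) where
  /-- Membership. -/
  mem : ∀ {Γ : M.Ctx .sm}, Tel Γ → Prop
  sub : ∀ {Γ Γ' : M.Ctx .sm} {Θ : Tel Γ} {σ : Γ' ⟶ Γ}, mem Θ → mem (Θ.sub σ)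

namespace TelClass

variable {M : DTTNaturalModel.{u, v, w}}

/-- All telescopes: the types of the internal telescope model `Tel`. -/
def all : TelClass M := ⟨fun _ => True, fun _ => trivial⟩

theorem mem_all {Γ : M.Ctx .sm} (Θ : Tel Γ) : (all (M := M)).mem Θ := trivial

/-- The telescopes of length one: the types of the submodel `Tel₁`. -/
def len1 : TelClass M :=
  ⟨fun Θ => ∃ A, Θ = single A, by rintro Γ Γ' Θ σ ⟨A, rfl⟩; exact ⟨A.sub σ, rfl⟩⟩

theorem len1_single {Γ : M.Ctx .sm} (A : MTy Γ) : (len1 (M := M)).mem (single A) := ⟨A, rfl⟩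

end TelClass

/-- The action on contexts, types and terms of an internal morphism of CwFs from `(🔒_△□)^* Tel_P`
to the Sierpinski model `Tel²`, over substitution along the key. Here `Tel_P` is the internal
telescope model with types restricted to the class `P`, a context of `Tel²` is a morphism of
telescopes `Θ₁ ⟶ Θ₀`, and a type over it is a pair of a telescope `A₀` over `Θ₀` and a
telescope `A₁` over `(Θ₁ ∣ A₀)`. The `0`-parts are given by substitution along the key. -/
structure DispAction {M : DTTNaturalModel.{u, v, w}} (P : TelClass M) extends DecFunctor M where
  /-- The telescope `A^d` over `(Γ ∣ Θ^D ∣ A[evens])`. -/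
  disp : ∀ {Γ : M.Ctx .sm} (Θ : Tel (M.L.obj Γ)) (A : Tel Θ.ext), P.mem A →
    Tel (A.sub (toDecFunctor.evens Θ)).ext
  /-- Stability under morphisms of telescopes. -/
  disp_map : ∀ {Γ : M.Ctx .sm} {Θ' Θ : Tel (M.L.obj Γ)} (f : Θ' ⟶ Θ) (A : Tel Θ.ext)
    (hA : P.mem A), disp Θ' (A.sub f.hom) (P.sub hA) =
      (disp Θ A hA).sub (toDecFunctor.mapExt f A)
  /-- Stability under substitution in `Γ`. -/
  disp_sub : ∀ {Γ' Γ : M.Ctx .sm} (τ : Γ' ⟶ Γ) (Θ : Tel (M.L.obj Γ)) (A : Tel Θ.ext)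
    (hA : P.mem A), disp (Θ.sub (M.L.map τ)) (A.sub (Θ.lift (M.L.map τ))) (P.sub hA) =
      (disp Θ A hA).sub (toDecFunctor.baseExt τ Θ A)
  /-- The partial substitution `t^d : A^d[t[evens]]` over `(Γ ∣ Θ^D)`, as a map to
  `(Γ ∣ Θ^D ∣ A[evens] ∣ A^d)` over the section `t[evens]`. -/
  dispTm : ∀ {Γ : M.Ctx .sm} (Θ : Tel (M.L.obj Γ)) (A : Tel Θ.ext) (hA : P.mem A), A.Sec →
    ((toDecFunctor.D Θ).ext ⟶ (disp Θ A hA).ext)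
  dispTm_proj : ∀ {Γ : M.Ctx .sm} (Θ : Tel (M.L.obj Γ)) (A : Tel Θ.ext) (hA : P.mem A)
    (t : A.Sec), dispTm Θ A hA t ≫ (disp Θ A hA).proj = (t.sub (toDecFunctor.evens Θ)).hom
  dispTm_map : ∀ {Γ : M.Ctx .sm} {Θ' Θ : Tel (M.L.obj Γ)} (f : Θ' ⟶ Θ) (A : Tel Θ.ext)
    (hA : P.mem A) (t : A.Sec),
    dispTm Θ' (A.sub f.hom) (P.sub hA) (t.sub f.hom) ≫ liftTo (disp_map f A hA) =
      ((dec Γ).map f).hom ≫ dispTm Θ A hA t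
  dispTm_sub : ∀ {Γ' Γ : M.Ctx .sm} (τ : Γ' ⟶ Γ) (Θ : Tel (M.L.obj Γ)) (A : Tel Θ.ext)
    (hA : P.mem A) (t : A.Sec),
    dispTm (Θ.sub (M.L.map τ)) (A.sub (Θ.lift (M.L.map τ))) (P.sub hA)
        (t.sub (Θ.lift (M.L.map τ))) ≫ liftTo (disp_sub τ Θ A hA) =
      liftTo (dec_sub τ Θ) ≫ dispTm Θ A hA t

namespace DispAction

variable {M : DTTNaturalModel.{u, v, w}} {P : TelClass M} (F : DispAction P) {Γ : M.Ctx .sm}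

/-- The comparison map of context extensions `(Θ ∣ A)^D ⟶ (Θ^D ∣ A[evens] ∣ A^d)`: its
components are the images of the projection and of the variable. -/
noncomputable def comparison (Θ : Tel (M.L.obj Γ)) (A : Tel Θ.ext) (hA : P.mem A) :
    (F.D (Θ.append A)).ext ⟶ (F.disp Θ A hA).ext :=
  F.dispTm (Θ.append A) (A.sub A.proj) (P.sub hA) (Sec.var A) ≫
    liftTo (F.disp_map (wkHom Θ A) A hA)

theorem comparison_evens (Θ : Tel (M.L.obj Γ)) (A : Tel Θ.ext) (hA : P.mem A) :
    F.comparison Θ A hA ≫ (F.disp Θ A hA).proj ≫ A.lift (F.evens Θ) =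
      F.evens (Θ.append A) := by
  have h₁ : F.comparison Θ A hA ≫ (F.disp Θ A hA).proj =
      ((Sec.var A).sub (F.evens (Θ.append A))).hom ≫ F.mapExt (wkHom Θ A) A := by
    rw [comparison, Category.assoc, liftTo_proj, ← Category.assoc]
    exact congrArg (· ≫ F.mapExt (wkHom Θ A) A) (F.dispTm_proj (Θ.append A) (A.sub A.proj) _ _)
  have h₂ : F.mapExt (wkHom Θ A) A ≫ A.lift (F.evens Θ) =
      (A.sub A.proj).lift (F.evens (Θ.append A)) ≫ A.lift A.proj := into_lift ..
  have h₃ : (Sec.var A).hom ≫ A.lift A.proj = 𝟙 A.ext := into_lift ..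
  rw [← Category.assoc, h₁, Category.assoc, h₂, ← Category.assoc, Sec.sub_lift, Category.assoc,
    h₃, Category.comp_id]

/-- Context extension is preserved strictly: the comparison maps are identities. -/
def IsStrict : Prop :=
  ∀ (Γ : M.Ctx .sm) (Θ : Tel (M.L.obj Γ)) (A : Tel Θ.ext) (hA : P.mem A),
    ∃ h : F.D (Θ.append A) = ((F.D Θ).append (A.sub (F.evens Θ))).append (F.disp Θ A hA),
      F.comparison Θ A hA = eqToHom (congrArg Tel.ext h)

/-- The conditions on a display operation for types. -/
structure IsTypeDisplay (F : DispAction (TelClass.len1 (M := M))) : Prop where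
  strict : F.IsStrict
  /-- The display of a non-modal type is a single non-modal type. -/
  plain : ∀ {Γ : M.Ctx .sm} (Θ : Tel (M.L.obj Γ)) (A : MTy Θ.ext), A.IsPlain →
    ∃ B : MTy ((single A).sub (F.evens Θ)).ext, B.IsPlain ∧
      F.disp Θ (single A) (TelClass.len1_single A) = single B
  /-- The display of a nontrivially modal type is empty. -/
  modal : ∀ {Γ : M.Ctx .sm} (Θ : Tel (M.L.obj Γ)) (A : MTy Θ.ext), ¬ A.IsPlain →
    F.disp Θ (single A) (TelClass.len1_single A) = nil _

/-- Restriction of an action on all telescopes to telescopes of length one. -/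
def restrict (F : DispAction (TelClass.all (M := M))) : DispAction (TelClass.len1 (M := M)) where
  toDecFunctor := F.toDecFunctor
  disp Θ A _ := F.disp Θ A (TelClass.mem_all A)
  disp_map f A _ := F.disp_map f A (TelClass.mem_all A)
  disp_sub τ Θ A _ := F.disp_sub τ Θ A (TelClass.mem_all A)
  dispTm Θ A _ t := F.dispTm Θ A (TelClass.mem_all A) t
  dispTm_proj Θ A _ t := F.dispTm_proj Θ A (TelClass.mem_all A) t
  dispTm_map f A _ t := F.dispTm_map f A (TelClass.mem_all A) t
  dispTm_sub τ Θ A _ t := F.dispTm_sub τ Θ A (TelClass.mem_all A) t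

end DispAction

/-- Type display: a strict internal morphism of CwFs `(🔒_△□)^* Tel₁ ⟶ Tel²` over substitution
along the key, taking non-modal types to single non-modal types and nontrivially modal types to
empty telescopes. -/
structure TypeDisplay (M : DTTNaturalModel.{u, v, w}) extends
    DispAction (TelClass.len1 (M := M)) where
  isTypeDisplay : toDispAction.IsTypeDisplay

/-- An internal pseudo morphism of CwFs `(🔒_△□)^* Tel ⟶ Tel²` over substitution along the key,
preserving substitution and the empty context strictly, and context extension up to the
comparison isomorphisms. -/
structure PseudoDisplay (M : DTTNaturalModel.{u, v, w}) extends
    DispAction (TelClass.all (M := M)) where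
  isIso_comparison : ∀ {Γ : M.Ctx .sm} (Θ : Tel (M.L.obj Γ)) (A : Tel Θ.ext),
    IsIso (toDispAction.comparison Θ A (TelClass.mem_all A))

namespace PseudoDisplay

variable {M : DTTNaturalModel.{u, v, w}} (F : PseudoDisplay M) {Γ : M.Ctx .sm}

/-- The telescope `Φ^d`. -/
abbrev d (Θ : Tel (M.L.obj Γ)) (Φ : Tel Θ.ext) : Tel (Φ.sub (F.evens Θ)).ext :=
  F.disp Θ Φ (TelClass.mem_all Φ)

/-- The inverse of the comparison map: the pairing `⟨υ, υ'⟩` that interleaves `υ : Υ[evens]` and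
`υ' : Υ^d`. -/
noncomputable def interleave (Θ : Tel (M.L.obj Γ)) (Υ : Tel Θ.ext) :
    (F.d Θ Υ).ext ⟶ (F.D (Θ.append Υ)).ext :=
  haveI := F.isIso_comparison Θ Υ
  inv (F.comparison Θ Υ (TelClass.mem_all Υ))

theorem interleave_evens (Θ : Tel (M.L.obj Γ)) (Υ : Tel Θ.ext) :
    F.interleave Θ Υ ≫ F.evens (Θ.append Υ) = (F.d Θ Υ).proj ≫ Υ.lift (F.evens Θ) := by
  have := F.isIso_comparison Θ Υ
  rw [interleave, IsIso.inv_comp_eq, F.comparison_evens]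

/-- The projection `(Γ ∣ Θ^D ∣ Υ ∣ Φ) ⟶ (Γ ∣ Θ^D ∣ Υ)`, with `Υ` and `Φ` substituted along
`evens`. -/
noncomputable def restrict₁ (Θ : Tel (M.L.obj Γ)) (Υ : Tel Θ.ext) (Φ : Tel Υ.ext) :
    ((Υ.append Φ).sub (F.evens Θ)).ext ⟶ (Υ.sub (F.evens Θ)).ext :=
  Υ.into _ ((Υ.append Φ).sub (F.evens Θ)).proj ((Υ.append Φ).lift (F.evens Θ) ≫ Φ.proj) (by
    rw [Category.assoc, ← append_proj, lift_proj])

/-- The map `(Γ ∣ Θ^D ∣ υ : Υ ∣ φ : Φ ∣ υ' : Υ^d) ⟶ (Γ ∣ (Θ ∣ Υ)^D ∣ φ : Φ)` with components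
`⟨υ, υ'⟩` and `φ`, where `Υ` and `Φ` are substituted along `evens`. -/
noncomputable def interleave₁ (Θ : Tel (M.L.obj Γ)) (Υ : Tel Θ.ext) (Φ : Tel Υ.ext) :
    ((F.d Θ Υ).sub (F.restrict₁ Θ Υ Φ)).ext ⟶ (Φ.sub (F.evens (Θ.append Υ))).ext :=
  Φ.into _ ((F.d Θ Υ).lift (F.restrict₁ Θ Υ Φ) ≫ F.interleave Θ Υ)
    (((F.d Θ Υ).sub (F.restrict₁ Θ Υ Φ)).proj ≫ (Υ.append Φ).lift (F.evens Θ)) (by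
      rw [Category.assoc, Category.assoc, F.interleave_evens, lift_proj_assoc, restrict₁,
        into_lift])

/-- The telescope `(υ' : Υ^d υ ∣ Φ^d ⟨υ, υ'⟩ φ)` in context `(Γ ∣ Θ^D ∣ υ : Υ ∣ φ : Φ)`, with `Υ`
and `Φ` substituted along `evens`. This is the `1`-part of the `Σ`-type in `Tel²` of the displays
of `Υ` and `Φ`. -/
noncomputable def sigma (Θ : Tel (M.L.obj Γ)) (Υ : Tel Θ.ext) (Φ : Tel Υ.ext) :
    Tel ((Υ.append Φ).sub (F.evens Θ)).ext :=
  ((F.d Θ Υ).sub (F.restrict₁ Θ Υ Φ)).append ((F.d (Θ.append Υ) Φ).sub (F.interleave₁ Θ Υ Φ))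

/-- The projection from `(Γ ∣ Θ^D ∣ υ : Υ ∣ φ : Φ ∣ (Υ ∣ Φ)^d)` to `(Γ ∣ Θ^D ∣ υ : Υ ∣ Υ^d)`. -/
noncomputable def sigmaFst {Θ : Tel (M.L.obj Γ)} {Υ : Tel Θ.ext} {Φ : Tel Υ.ext}
    (h : F.d Θ (Υ.append Φ) = F.sigma Θ Υ Φ) : (F.d Θ (Υ.append Φ)).ext ⟶ (F.d Θ Υ).ext :=
  eqToHom (congrArg Tel.ext h) ≫
    ((F.d (Θ.append Υ) Φ).sub (F.interleave₁ Θ Υ Φ)).proj ≫ (F.d Θ Υ).lift (F.restrict₁ Θ Υ Φ)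

/-- The map from `(Γ ∣ Θ^D ∣ υ : Υ ∣ φ : Φ ∣ (Υ ∣ Φ)^d)` to `(Γ ∣ (Θ ∣ Υ)^D ∣ φ : Φ ∣ Φ^d)`. -/
noncomputable def sigmaSnd {Θ : Tel (M.L.obj Γ)} {Υ : Tel Θ.ext} {Φ : Tel Υ.ext}
    (h : F.d Θ (Υ.append Φ) = F.sigma Θ Υ Φ) :
    (F.d Θ (Υ.append Φ)).ext ⟶ (F.d (Θ.append Υ) Φ).ext :=
  eqToHom (congrArg Tel.ext h) ≫ (F.d (Θ.append Υ) Φ).lift (F.interleave₁ Θ Υ Φ)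

end PseudoDisplay

/-- A strict internal morphism of CwFs `(🔒_△□)^* Tel ⟶ Tel` with underlying internal functor
`F`. -/
structure DepDecalage {M : DTTNaturalModel.{u, v, w}} (F : DecFunctor M) where
  /-- Décalage of dependent telescopes. -/
  decTy : ∀ {Γ : M.Ctx .sm} (Θ : Tel (M.L.obj Γ)), Tel Θ.ext → Tel (F.D Θ).ext
  decTy_map : ∀ {Γ : M.Ctx .sm} {Θ' Θ : Tel (M.L.obj Γ)} (f : Θ' ⟶ Θ) (A : Tel Θ.ext),
    decTy Θ' (A.sub f.hom) = (decTy Θ A).sub ((F.dec Γ).map f).hom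
  decTy_sub : ∀ {Γ' Γ : M.Ctx .sm} (τ : Γ' ⟶ Γ) (Θ : Tel (M.L.obj Γ)) (A : Tel Θ.ext),
    decTy (Θ.sub (M.L.map τ)) (A.sub (Θ.lift (M.L.map τ))) =
      (decTy Θ A).sub (liftTo (F.dec_sub τ Θ))
  /-- Décalage of dependent partial substitutions. -/
  decTm : ∀ {Γ : M.Ctx .sm} (Θ : Tel (M.L.obj Γ)) (A : Tel Θ.ext), A.Sec → (decTy Θ A).Sec
  decTm_map : ∀ {Γ : M.Ctx .sm} {Θ' Θ : Tel (M.L.obj Γ)} (f : Θ' ⟶ Θ) (A : Tel Θ.ext)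
    (t : A.Sec), (decTm Θ' (A.sub f.hom) (t.sub f.hom)).hom ≫ liftTo (decTy_map f A) =
      ((F.dec Γ).map f).hom ≫ (decTm Θ A t).hom
  decTm_sub : ∀ {Γ' Γ : M.Ctx .sm} (τ : Γ' ⟶ Γ) (Θ : Tel (M.L.obj Γ)) (A : Tel Θ.ext)
    (t : A.Sec),
    (decTm (Θ.sub (M.L.map τ)) (A.sub (Θ.lift (M.L.map τ)))
        (t.sub (Θ.lift (M.L.map τ)))).hom ≫ liftTo (decTy_sub τ Θ A) =
      liftTo (F.dec_sub τ Θ) ≫ (decTm Θ A t).hom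
  /-- Strict preservation of context extension. -/
  dec_append : ∀ {Γ : M.Ctx .sm} (Θ : Tel (M.L.obj Γ)) (A : Tel Θ.ext),
    F.D (Θ.append A) = (F.D Θ).append (decTy Θ A)
  /-- Strict preservation of projections and variables. -/
  comparison_eq : ∀ {Γ : M.Ctx .sm} (Θ : Tel (M.L.obj Γ)) (A : Tel Θ.ext),
    (decTm (Θ.append A) (A.sub A.proj) (Sec.var A)).hom ≫ liftTo (decTy_map (wkHom Θ A) A) =
      eqToHom (congrArg Tel.ext (dec_append Θ A))

/-- Telescope display, including décalage of dependent telescopes. -/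
structure TelescopeDisplay (M : DTTNaturalModel.{u, v, w}) extends PseudoDisplay M where
  /-- Display of the empty telescope. -/
  disp_nil : ∀ {Γ : M.Ctx .sm} (Θ : Tel (M.L.obj Γ)),
    toPseudoDisplay.d Θ (nil Θ.ext) = nil _
  /-- Display preserves `Σ`-types, that is, concatenation of telescopes, strictly. -/
  disp_append : ∀ {Γ : M.Ctx .sm} (Θ : Tel (M.L.obj Γ)) (Υ : Tel Θ.ext) (Φ : Tel Υ.ext),
    toPseudoDisplay.d Θ (Υ.append Φ) = toPseudoDisplay.sigma Θ Υ Φ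
  /-- Display preserves pairs: the first component of `[s ∣ t]^d` is `s^d`. -/
  dispTm_pair_fst : ∀ {Γ : M.Ctx .sm} (Θ : Tel (M.L.obj Γ)) (Υ : Tel Θ.ext) (Φ : Tel Υ.ext)
    (s : Υ.Sec) (t : (Φ.sub s.hom).Sec),
    dispTm Θ (Υ.append Φ) (TelClass.mem_all _) (Sec.pair s t) ≫
        toPseudoDisplay.sigmaFst (disp_append Θ Υ Φ) =
      dispTm Θ Υ (TelClass.mem_all Υ) s
  /-- Display preserves pairs: the second component of `[s ∣ t]^d` is `t^d`. -/
  dispTm_pair_snd : ∀ {Γ : M.Ctx .sm} (Θ : Tel (M.L.obj Γ)) (Υ : Tel Θ.ext) (Φ : Tel Υ.ext)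
    (s : Υ.Sec) (t : (Φ.sub s.hom).Sec),
    dispTm Θ (Υ.append Φ) (TelClass.mem_all _) (Sec.pair s t) ≫
        toPseudoDisplay.sigmaSnd (disp_append Θ Υ Φ) =
      dispTm Θ (Φ.sub s.hom) (TelClass.mem_all _) t ≫ liftTo (disp_map (Sec.toHom Θ s) Φ (TelClass.mem_all Φ))
  /-- The strict morphism of CwFs `(-)^D`. -/
  depDec : DepDecalage toDecFunctor
  /-- The isomorphism `Φ^D ≅ (Φ[evens] ∣ Φ^d)` of pseudo morphisms of CwFs given by evens, odds and
  pairing, over the identity of the underlying functors. -/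
  evOd : ∀ {Γ : M.Ctx .sm} (Θ : Tel (M.L.obj Γ)) (Φ : Tel Θ.ext),
    depDec.decTy Θ Φ ≅
      (Φ.sub (toDecFunctor.evens Θ)).append (toPseudoDisplay.d Θ Φ)
  /-- Coherence of the isomorphism with context extension. As the comparison maps are isomorphisms
  and are stable under substitution, this includes the naturality of the isomorphism. -/
  evOd_comparison : ∀ {Γ : M.Ctx .sm} (Θ : Tel (M.L.obj Γ)) (Φ : Tel Θ.ext),
    eqToHom (congrArg Tel.ext (depDec.dec_append Θ Φ)) ≫ (evOd Θ Φ).hom.hom =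
      toDispAction.comparison Θ Φ (TelClass.mem_all Φ)

namespace TelescopeDisplay

variable {M : DTTNaturalModel.{u, v, w}} (F : TelescopeDisplay M) {Γ : M.Ctx .sm}
  (Θ : Tel (M.L.obj Γ)) (Φ : Tel Θ.ext)

/-- The telescope `Φ^D` over `(Γ ∣ Θ^D)`. -/
abbrev DD : Tel (F.D Θ).ext := F.depDec.decTy Θ Φ

/-- The identification of `(Γ ∣ Θ^D ∣ Φ^D)` with `(Γ ∣ (Θ ∣ Φ)^D)`. -/
def joinD : (F.DD Θ Φ).ext ⟶ (F.D (Θ.append Φ)).ext :=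
  eqToHom (congrArg Tel.ext (F.depDec.dec_append Θ Φ)).symm

/-- The map `evens : (Γ ∣ Θ^D ∣ Φ^D) ⟶ (Γ.🔒_△□ ∣ Θ ∣ Φ)`. -/
noncomputable def depEvens : (F.DD Θ Φ).ext ⟶ Φ.ext := F.joinD Θ Φ ≫ F.evens (Θ.append Φ)

/-- The map `(Γ ∣ Θ^D ∣ Φ^D ∣ A) ⟶ (Γ ∣ (Θ ∣ Φ)^D ∣ A)`, with `A` substituted along `evens`. -/
noncomputable def snocBase (A : Tel Φ.ext) :
    (A.sub (F.depEvens Θ Φ)).ext ⟶ (A.sub (F.evens (Θ.append Φ))).ext :=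
  A.into _ ((A.sub (F.depEvens Θ Φ)).proj ≫ F.joinD Θ Φ) (A.lift (F.depEvens Θ Φ)) (by
    rw [lift_proj, depEvens, Category.assoc])

/-- The telescope `(x : A[evens], x' : A^d)` over `(Γ ∣ Θ^D ∣ Φ^D)`. -/
noncomputable def snocTel (A : Tel Φ.ext) : Tel (F.DD Θ Φ).ext :=
  (A.sub (F.depEvens Θ Φ)).append ((F.d (Θ.append Φ) A).sub (F.snocBase Θ Φ A))

variable {Θ Φ}

/-- The projection from `(Γ ∣ Θ^D ∣ (Φ, A)^D)` to `(Γ ∣ Θ^D ∣ Φ^D ∣ A)`. -/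
noncomputable def snocFst {A : Tel Φ.ext}
    (h : F.DD Θ (Φ.append A) = (F.DD Θ Φ).append (F.snocTel Θ Φ A)) :
    (F.DD Θ (Φ.append A)).ext ⟶ (A.sub (F.depEvens Θ Φ)).ext :=
  eqToHom (congrArg Tel.ext h) ≫ ((F.d (Θ.append Φ) A).sub (F.snocBase Θ Φ A)).proj

/-- The map from `(Γ ∣ Θ^D ∣ (Φ, A)^D)` to `(Γ ∣ (Θ ∣ Φ)^D ∣ A ∣ A^d)`. -/
noncomputable def snocSnd {A : Tel Φ.ext}
    (h : F.DD Θ (Φ.append A) = (F.DD Θ Φ).append (F.snocTel Θ Φ A)) :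
    (F.DD Θ (Φ.append A)).ext ⟶ (F.d (Θ.append Φ) A).ext :=
  eqToHom (congrArg Tel.ext h) ≫ (F.d (Θ.append Φ) A).lift (F.snocBase Θ Φ A)

end TelescopeDisplay

/-- Complete display. -/
structure CompleteDisplay (M : DTTNaturalModel.{u, v, w}) extends TelescopeDisplay M where
  /-- The restriction to telescopes of length one satisfies the conditions on type display. -/
  isTypeDisplay : toDispAction.restrict.IsTypeDisplay
  /-- `(Φ, x :^μ A)^D = (Φ^D, x :^μ A[evens], x' : A^d)`, where the last entry is
  absent when `μ` is nontrivial since `A^d` is then empty. -/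
  dec_snoc : ∀ {Γ : M.Ctx .sm} (Θ : Tel (M.L.obj Γ)) (Φ : Tel Θ.ext) (A : MTy Φ.ext),
    depDec.decTy Θ (Φ.append (single A)) =
      (depDec.decTy Θ Φ).append (toTelescopeDisplay.snocTel Θ Φ (single A))
  /-- `[s, t]^D = [s^D, t[evens], t^d]`. -/
  decTm_snoc : ∀ {Γ : M.Ctx .sm} (Θ : Tel (M.L.obj Γ)) (Φ : Tel Θ.ext) (A : MTy Φ.ext)
    (s : Φ.Sec) (t : ((single A).sub s.hom).Sec),
    (depDec.decTm Θ (Φ.append (single A)) (Sec.pair s t)).hom ≫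
        toTelescopeDisplay.snocSnd (dec_snoc Θ Φ A) =
      dispTm Θ ((single A).sub s.hom) (TelClass.mem_all _) t ≫
        liftTo (disp_map (Sec.toHom Θ s) (single A) (TelClass.mem_all _))
  /-- `[s, t, t']^ev = [s^ev, t]`. -/
  evens_snoc : ∀ {Γ : M.Ctx .sm} (Θ : Tel (M.L.obj Γ)) (Φ : Tel Θ.ext) (A : MTy Φ.ext),
    toTelescopeDisplay.depEvens Θ (Φ.append (single A)) =
      toTelescopeDisplay.snocFst (dec_snoc Θ Φ A) ≫
        (single A).lift (toTelescopeDisplay.depEvens Θ Φ)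
  /-- `[s, t, t']^od = [s^od, t']`, and inversely `⟨[s, t], [s', t']⟩ = [⟨s, s'⟩, t, t']`. The
  rules for the display of `(Φ, x :^μ A)` and `[s, t]` are those for `(Φ ∣ A)` and `[s ∣ t]`. -/
  odds_snoc : ∀ {Γ : M.Ctx .sm} (Θ : Tel (M.L.obj Γ)) (Φ : Tel Θ.ext) (A : MTy Φ.ext),
    (evOd Θ (Φ.append (single A))).hom.hom ≫
        toPseudoDisplay.sigmaSnd (disp_append Θ Φ (single A)) =
      toTelescopeDisplay.snocSnd (dec_snoc Θ Φ A)

/-- The type display underlying a complete display. -/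
def CompleteDisplay.toTypeDisplay {M : DTTNaturalModel.{u, v, w}} (E : CompleteDisplay M) :
    TypeDisplay M :=
  ⟨E.toDispAction.restrict, E.isTypeDisplay⟩

end DTT

/-!
Décalage is already given on all telescopes by the type display, since contexts of `Tel₁` and of
`Tel` are the same; strictness on types reads `(Θ, x : A)^D = (Θ^D, x : A[evens], x' : A^d)`, so
`Θ^D` is a list in which entries from `Θ[evens]` alternate with displayed entries. What has to be
constructed is the separation of this list, for a dependent telescope `Φ` over `Θ`, into
`Φ[evens]` and `Φ^d`.

*Existence.* For `a : X ⟶ Θ^D` and `b : X ⟶ Φ` that agree in `Θ`, recursion on `Φ` produces the odd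
part of `Φ` along `a` and `b` (`TypeDisplay.odd`): a telescope over `X` together with an
interleaving map to `(Θ ∣ Φ)^D`. For `(Φ, x : A)` it is extended by `A^d`, which is a type or empty,
substituted along the interleaving map of the earlier entries. The generality in `a` and `b` makes
the induction go through: the odd part is natural in `Θ`, `Φ`, `a`, `b`
(`TypeDisplay.exists_isSub_odd`), it takes concatenations to concatenations
(`TypeDisplay.exists_isSub_odd_append`), and maps into it are pairs of compatible maps to `X` and to
`(Θ ∣ Φ)^D` (`TypeDisplay.odd_hom_ext`, `TypeDisplay.exists_odd_lift`). The display `Φ^d` is the odd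
part over the generic `a` and `b`. There the interleaving map is invertible, and its inverse is the
comparison map of the pseudo morphism; display of a term is décalage of the corresponding section
followed by this inverse. The laws for terms and for `ev`, `od` are equations of maps that can be
checked after the invertible interleaving maps. The dependent décalage is the tail of `(Θ ∣ Φ)^D`
after `Θ^D`.

*Uniqueness.* A complete display is determined by its action on contexts, types and terms: dependent
telescopes can be cancelled from a concatenation (`Tel.append_left_cancel`), terms are recovered
from sections by the comparison maps (`DispAction.dispTm_eq`, `DepDecalage.decTm_eq`), and `ev`,
`od` are prescribed by the coherence law. The action on types and the comparison maps agree with the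
constructed ones by induction on the telescope (`CompleteDisplay.exists_isSub_d`); in the step for
`(Φ, x : A)` the rule for `od` computes the comparison map from the one at the single type `A`, and
preservation of concatenation computes the display.

Equations between telescopes are handled by the relation `Tel.IsSub σ Θ' Θ g`, which says that
`Θ' = Θ[σ]` with canonical map `g`. It is closed under composition, concatenation and cancellation,
so that transports along equations of telescopes seldom have to be written.
-/

namespace DTT

/-! ### Telescopes and substitution -/

namespace DTTNaturalModel

variable (M : DTTNaturalModel.{u, v, w}) {p q : Mode} (μ : p ⟶ q) {Γ Δ : M.Ctx q}
  (A : (M.Ty p).obj (op ((M.lock μ).obj Γ))) (σ : Δ ⟶ Γ)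

theorem lift_wk : M.lift μ A σ ≫ M.wk μ Γ A = M.wk μ Δ _ ≫ σ := M.pair_wk ..

theorem var_lift : (M.Tm p).map ((M.lock μ).map (M.lift μ A σ)).op (M.var μ Γ A) =
    M.var μ Δ ((M.Ty p).map ((M.lock μ).map σ).op A) := M.var_pair ..

end DTTNaturalModel

variable {M : DTTNaturalModel.{u, v, w}}

namespace Tel

variable {q : Mode} {Γ Γ' Γ'' : M.Ctx q}

/-- Extension of a telescope by a type. -/
abbrev snoc (Υ : Tel Γ) (A : MTy Υ.ext) : Tel Γ := Υ.append (single A)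

/-- The last type of a nonempty telescope and the telescope that precedes it. -/
def unsnoc : Tel Γ → Option (Σ Θ : Tel Γ, MTy Θ.ext)
  | ⟨_, .nil⟩ => none
  | ⟨_, .snoc Θ A⟩ => some ⟨⟨_, Θ⟩, A⟩

theorem snoc_injective {Υ Υ' : Tel Γ} {A : MTy Υ.ext} {A' : MTy Υ'.ext}
    (h : Υ.snoc A = Υ'.snoc A') : (⟨Υ, A⟩ : Σ Θ : Tel Γ, MTy Θ.ext) = ⟨Υ', A'⟩ :=
  Option.some.inj (congrArg unsnoc h)

theorem single_injective {A A' : MTy Γ} (h : single A = single A') : A = A' :=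
  eq_of_heq (Sigma.mk.inj (snoc_injective (Υ := nil Γ) (Υ' := nil Γ) h)).2

@[elab_as_elim]
theorem snoc_induction {motive : Tel Γ → Prop} (nil : motive (nil Γ))
    (snoc : ∀ Υ A, motive Υ → motive (Υ.snoc A)) (Φ : Tel Γ) : motive Φ := by
  obtain ⟨Δ, Φ⟩ := Φ
  induction Φ with
  | nil => exact nil
  | snoc Θ A ih => exact snoc ⟨_, Θ⟩ A ih

/-- `IsSub σ Θ' Θ g`: the telescope `Θ'` is the substitution `Θ[σ]`, and `g` is the canonical map
of extended contexts. As an inductive family, it absorbs the transport along the equation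
`Θ' = Θ[σ]`. -/
inductive IsSub (σ : Γ' ⟶ Γ) : (Θ' : Tel Γ') → (Θ : Tel Γ) → (Θ'.ext ⟶ Θ.ext) → Prop
  | lift (Θ : Tel Γ) : IsSub σ (Θ.sub σ) Θ (Θ.lift σ)

theorem isSub_lift (Θ : Tel Γ) (σ : Γ' ⟶ Γ) : IsSub σ (Θ.sub σ) Θ (Θ.lift σ) := .lift Θ

theorem isSub_liftTo {Θ' : Tel Γ'} {Θ : Tel Γ} {σ : Γ' ⟶ Γ} (h : Θ' = Θ.sub σ) :
    IsSub σ Θ' Θ (liftTo h) := by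
  subst h
  rw [liftTo, eqToHom_refl, Category.id_comp]
  exact .lift Θ

theorem isSub_nil (σ : Γ' ⟶ Γ) : IsSub σ (nil Γ') (nil Γ) σ := isSub_lift (nil Γ) σ

namespace IsSub

variable {σ : Γ' ⟶ Γ} {Θ' : Tel Γ'} {Θ : Tel Γ} {g : Θ'.ext ⟶ Θ.ext}

theorem eq_sub (hg : IsSub σ Θ' Θ g) : Θ' = Θ.sub σ := by
  cases hg
  rfl

theorem liftTo_eq (hg : IsSub σ Θ' Θ g) (h : Θ' = Θ.sub σ) : liftTo h = g := by
  cases hg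
  exact Category.id_comp _

theorem isPullback (hg : IsSub σ Θ' Θ g) : IsPullback g Θ'.proj Θ.proj σ := by
  cases hg
  exact Θ.isPullback σ

theorem w (hg : IsSub σ Θ' Θ g) : g ≫ Θ.proj = Θ'.proj ≫ σ := hg.isPullback.w

theorem w_assoc (hg : IsSub σ Θ' Θ g) {X : M.Ctx q} (k : Γ ⟶ X) :
    g ≫ Θ.proj ≫ k = Θ'.proj ≫ σ ≫ k := by rw [← Category.assoc, hg.w, Category.assoc]

theorem hom_ext (hg : IsSub σ Θ' Θ g) {X : M.Ctx q} {a b : X ⟶ Θ'.ext}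
    (h₁ : a ≫ Θ'.proj = b ≫ Θ'.proj) (h₂ : a ≫ g = b ≫ g) : a = b :=
  hg.isPullback.hom_ext h₂ h₁

theorem exists_lift (hg : IsSub σ Θ' Θ g) {X : M.Ctx q} (a : X ⟶ Γ') (b : X ⟶ Θ.ext)
    (h : b ≫ Θ.proj = a ≫ σ) : ∃ k : X ⟶ Θ'.ext, k ≫ Θ'.proj = a ∧ k ≫ g = b :=
  ⟨hg.isPullback.lift b a h, hg.isPullback.lift_snd .., hg.isPullback.lift_fst ..⟩

theorem congr (hg : IsSub σ Θ' Θ g) {σ' : Γ' ⟶ Γ} {g' : Θ'.ext ⟶ Θ.ext} (hσ : σ' = σ)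
    (hg' : g' = g) : IsSub σ' Θ' Θ g' := by
  rwa [hσ, hg']

/-- A map of modal extensions that preserves the projections and the variables is canonical. -/
theorem single_mk {p : Mode} (μ : p ⟶ q) (A : (M.Ty p).obj (op ((M.lock μ).obj Γ)))
    (A' : (M.Ty p).obj (op ((M.lock μ).obj Γ')))
    (h : A' = (M.Ty p).map ((M.lock μ).map σ).op A) (k : M.extend μ Γ' A' ⟶ M.extend μ Γ A)
    (h₁ : k ≫ M.wk μ Γ A = M.wk μ Γ' A' ≫ σ)
    (h₂ : (M.Tm p).map ((M.lock μ).map k).op (M.var μ Γ A) = M.var μ Γ' A') :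
    IsSub σ (single ⟨p, μ, A'⟩) (single ⟨p, μ, A⟩) k := by
  subst h
  refine (isSub_lift (single ⟨p, μ, A⟩) σ).congr rfl ?_
  refine M.extend_hom_ext μ A _ _ (h₁.trans (M.pair_wk ..).symm) (h₂.trans (M.var_pair ..).symm)

theorem single_comp (A : MTy Γ) (σ : Γ' ⟶ Γ) (τ : Γ'' ⟶ Γ') :
    IsSub (τ ≫ σ) (single ((A.sub σ).sub τ)) (single A) ((A.sub σ).lift τ ≫ A.lift σ) := by
  obtain ⟨p, μ, A⟩ := A
  refine single_mk μ A _ ?_ (M.lift μ _ τ ≫ M.lift μ A σ) ?_ ?_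
  · refine Eq.symm ?_
    rw [Functor.map_comp, op_comp]
    exact Functor.map_comp_apply ..
  · rw [Category.assoc, M.lift_wk, ← Category.assoc, M.lift_wk, Category.assoc]
  · rw [Functor.map_comp, op_comp, Functor.map_comp_apply, M.var_lift, M.var_lift]

theorem single_id (A : MTy Γ) : IsSub (𝟙 Γ) (single A) (single A) (𝟙 A.ext) := by
  obtain ⟨p, μ, A⟩ := A
  refine single_mk μ A _ (by simp) (𝟙 (M.extend μ Γ A)) (by simp) (by simp)

theorem snoc_single {A' : MTy Θ'.ext} {A : MTy Θ.ext} {k : A'.ext ⟶ A.ext}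
    (hg : IsSub σ Θ' Θ g) (hk : IsSub g (single A') (single A) k) :
    IsSub σ (Θ'.snoc A') (Θ.snoc A) k := by
  cases hg
  obtain rfl : A' = A.sub (Θ.lift σ) := single_injective hk.eq_sub
  obtain rfl : k = A.lift (Θ.lift σ) := (hk.liftTo_eq rfl).symm.trans
    ((isSub_lift (single A) (Θ.lift σ)).liftTo_eq rfl)
  exact isSub_lift (Θ.snoc A) σ

theorem comp' (Θ : Tel Γ) (σ : Γ' ⟶ Γ) (τ : Γ'' ⟶ Γ') :
    IsSub (τ ≫ σ) ((Θ.sub σ).sub τ) Θ ((Θ.sub σ).lift τ ≫ Θ.lift σ) := by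
  induction Θ using snoc_induction with
  | nil => exact isSub_nil _
  | snoc Υ A ih => exact snoc_single ih (single_comp A _ _)

theorem id (Θ : Tel Γ) : IsSub (𝟙 Γ) Θ Θ (𝟙 Θ.ext) := by
  induction Θ using snoc_induction with
  | nil => exact isSub_nil _
  | snoc Υ A ih => exact snoc_single ih (single_id A)

/-- Substitution is functorial. -/
theorem comp {τ : Γ'' ⟶ Γ'} {Θ'' : Tel Γ''} {k : Θ''.ext ⟶ Θ'.ext}
    (hk : IsSub τ Θ'' Θ' k) (hg : IsSub σ Θ' Θ g) : IsSub (τ ≫ σ) Θ'' Θ (k ≫ g) := by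
  cases hg
  cases hk
  exact comp' Θ σ τ

/-- Two substitutions of a telescope along the same map agree. -/
theorem unique {Θ'' : Tel Γ'} {g' : Θ''.ext ⟶ Θ.ext} (hg : IsSub σ Θ' Θ g)
    (hg' : IsSub σ Θ'' Θ g') : Θ' = Θ'' :=
  hg.eq_sub.trans hg'.eq_sub.symm

/-- Cancellation: a map over `τ` whose composite with a canonical map is canonical is itself
canonical. -/
theorem of_comp {τ : Γ'' ⟶ Γ'} {ρ : Γ'' ⟶ Γ} {Θ'' : Tel Γ''} {k : Θ''.ext ⟶ Θ'.ext}
    {l : Θ''.ext ⟶ Θ.ext} (hg : IsSub σ Θ' Θ g) (hl : IsSub ρ Θ'' Θ l)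
    (hk : k ≫ Θ'.proj = Θ''.proj ≫ τ) (hρ : ρ = τ ≫ σ) (h : k ≫ g = l) :
    IsSub τ Θ'' Θ' k := by
  subst hρ
  have h₁ := (isSub_lift Θ' τ).comp hg
  obtain rfl := hl.unique h₁
  refine (isSub_lift Θ' τ).congr rfl (hg.hom_ext (hk.trans (lift_proj Θ' τ).symm) (h.trans ?_))
  exact (hl.liftTo_eq hl.eq_sub).symm.trans (h₁.liftTo_eq hl.eq_sub)

/-- The factorization of a canonical map through another one. -/
theorem exists_factor {τ : Γ'' ⟶ Γ'} {ρ : Γ'' ⟶ Γ} {Θ'' : Tel Γ''} {l : Θ''.ext ⟶ Θ.ext}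
    (hg : IsSub σ Θ' Θ g) (hl : IsSub ρ Θ'' Θ l) (hρ : ρ = τ ≫ σ) :
    ∃ k, IsSub τ Θ'' Θ' k ∧ k ≫ g = l := by
  obtain ⟨k, h₁, h₂⟩ := hg.exists_lift (Θ''.proj ≫ τ) l (by rw [hl.w, hρ, Category.assoc])
  exact ⟨k, hg.of_comp hl h₁ hρ h₂, h₂⟩

theorem append' (σ : Γ' ⟶ Γ) (Θ : Tel Γ) (Φ : Tel Θ.ext) :
    IsSub σ ((Θ.sub σ).append (Φ.sub (Θ.lift σ))) (Θ.append Φ) (Φ.lift (Θ.lift σ)) := by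
  induction Φ using snoc_induction with
  | nil => exact isSub_lift Θ σ
  | snoc Υ A ih => exact ih.snoc_single (isSub_lift (single A) _)

/-- Substitution commutes with concatenation. -/
theorem append {Φ' : Tel Θ'.ext} {Φ : Tel Θ.ext} {k : Φ'.ext ⟶ Φ.ext}
    (hg : IsSub σ Θ' Θ g) (hk : IsSub g Φ' Φ k) :
    IsSub σ (Θ'.append Φ') (Θ.append Φ) k := by
  cases hg
  cases hk
  exact append' σ Θ Φ

end IsSub

theorem isSub_eqToHom {Θ Θ' : Tel Γ} (h : Θ = Θ') :
    IsSub (𝟙 Γ) Θ Θ' (eqToHom (congrArg Tel.ext h)) := by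
  subst h
  exact IsSub.id Θ

/-- The canonical map between the two bracketings is the identity: their extended contexts agree
definitionally, although the telescopes do not. -/
theorem isSub_assoc (Θ : Tel Γ) (Υ : Tel Θ.ext) (Φ : Tel Υ.ext) :
    IsSub (𝟙 Γ) ((Θ.append Υ).append Φ) (Θ.append (Υ.append Φ)) (𝟙 Φ.ext) :=
  isSub_eqToHom (append_assoc Θ Υ Φ)

theorem IsSub.eq {Θ Θ' : Tel Γ} {k : Θ.ext ⟶ Θ'.ext} (hk : IsSub (𝟙 Γ) Θ Θ' k) : Θ = Θ' :=
  hk.unique (IsSub.id Θ')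

/-- A canonical map over the identity is the transport along the equation that it witnesses. -/
theorem IsSub.eqToHom_eq {Θ Θ' : Tel Γ} {k : Θ.ext ⟶ Θ'.ext} (hk : IsSub (𝟙 Γ) Θ Θ' k)
    (h : Θ = Θ') : eqToHom (congrArg Tel.ext h) = k :=
  ((isSub_eqToHom h).liftTo_eq hk.eq_sub).symm.trans (hk.liftTo_eq hk.eq_sub)

end Tel

/-! ### Décalage of morphisms over a substitution -/

open Tel

/-- A morphism of telescopes over a substitution `base` of the ambient contexts. -/
@[ext]
structure Mor {Γ' Γ : M.Ctx .sm} (Θ' : Tel (M.L.obj Γ')) (Θ : Tel (M.L.obj Γ)) where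
  /-- The substitution of ambient contexts. -/
  base : Γ' ⟶ Γ
  /-- The underlying map of extended contexts. -/
  hom : Θ'.ext ⟶ Θ.ext
  w : hom ≫ Θ.proj = Θ'.proj ≫ M.L.map base

namespace Mor

variable {Γ Γ' Γ'' : M.Ctx .sm} {Θ'' : Tel (M.L.obj Γ'')} {Θ' : Tel (M.L.obj Γ')}
  {Θ : Tel (M.L.obj Γ)}

/-- A morphism of telescopes in one ambient context, regarded as lying over its identity. -/
abbrev ofHom {Θ' Θ : Tel (M.L.obj Γ)} (f : Θ' ⟶ Θ) : Mor Θ' Θ := ⟨𝟙 Γ, f.hom, by simp⟩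

/-- The canonical morphism of a substituted telescope. -/
abbrev ofSub (τ : Γ' ⟶ Γ) (Θ : Tel (M.L.obj Γ)) : Mor (Θ.sub (M.L.map τ)) Θ :=
  ⟨τ, Θ.lift _, lift_proj ..⟩

/-- Composition, over the composite of the substitutions. -/
abbrev comp (m' : Mor Θ'' Θ') (m : Mor Θ' Θ) : Mor Θ'' Θ :=
  ⟨m'.base ≫ m.base, m'.hom ≫ m.hom, by
    rw [Category.assoc, m.w, ← Category.assoc, m'.w, Category.assoc, Functor.map_comp]⟩

/-- The factor over the identity substitution in the factorization of a morphism through the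
canonical one of a substituted telescope. -/
noncomputable def vert (m : Mor Θ' Θ) : Θ' ⟶ Θ.sub (M.L.map m.base) :=
  ⟨Θ.into _ Θ'.proj m.hom m.w, into_proj ..⟩

theorem vert_lift (m : Mor Θ' Θ) : m.vert.hom ≫ Θ.lift (M.L.map m.base) = m.hom := into_lift ..

theorem vert_comp_ofSub (m : Mor Θ' Θ) : (ofHom m.vert).comp (ofSub m.base Θ) = m :=
  Mor.ext (Category.id_comp _) m.vert_lift

/-- The morphism `(Θ' ∣ A[m]) ⟶ (Θ ∣ A)` over `m`. -/
abbrev append (m : Mor Θ' Θ) {A' : Tel Θ'.ext} {A : Tel Θ.ext} {l : A'.ext ⟶ A.ext}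
    (hl : IsSub m.hom A' A l) : Mor (Θ'.append A') (Θ.append A) :=
  ⟨m.base, l, by
    rw [append_proj, append_proj, hl.w_assoc, m.w, Category.assoc]⟩

/-- The morphism to `(Θ ∣ A)` with components `m` and `t : A[m]`. -/
abbrev pair (m : Mor Θ' Θ) {A' : Tel Θ'.ext} {A : Tel Θ.ext} {l : A'.ext ⟶ A.ext}
    (hl : IsSub m.hom A' A l) (t : A'.Sec) : Mor Θ' (Θ.append A) :=
  ⟨m.base, t.hom ≫ l, by
    rw [append_proj, Category.assoc, hl.w_assoc, m.w, ← Category.assoc, t.w, Category.id_comp]⟩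

/-- The identity of extended contexts, as a morphism between the two bracketings of an iterated
concatenation. -/
abbrev assoc (Θ : Tel (M.L.obj Γ)) (Υ : Tel Θ.ext) (Φ : Tel Υ.ext) :
    Mor (Θ.append (Υ.append Φ)) ((Θ.append Υ).append Φ) :=
  ⟨𝟙 Γ, 𝟙 _, by
    rw [CategoryTheory.Functor.map_id, Category.comp_id]
    exact (Category.id_comp _).trans (congrArg TelTo.proj (TelTo.append_assoc ..))⟩

end Mor

namespace DecFunctor

variable (F : DecFunctor M) {Γ Γ' Γ'' : M.Ctx .sm} {Θ'' : Tel (M.L.obj Γ'')}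
  {Θ' : Tel (M.L.obj Γ')} {Θ : Tel (M.L.obj Γ)}

/-- Décalage of a morphism over a substitution of ambient contexts. -/
noncomputable def map (m : Mor Θ' Θ) : (F.D Θ').ext ⟶ (F.D Θ).ext :=
  ((F.dec Γ').map m.vert).hom ≫ liftTo (F.dec_sub m.base Θ)

/-- Décalage of a morphism may be computed by any factorization into a morphism over the identity
and a canonical one. -/
theorem map_eq {τ : Γ' ⟶ Γ} {Ψ : Tel (M.L.obj Γ')} {l : Ψ.ext ⟶ Θ.ext}
    {k : (F.D Ψ).ext ⟶ (F.D Θ).ext} (f : Θ' ⟶ Ψ) (hl : IsSub (M.L.map τ) Ψ Θ l)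
    (hk : IsSub τ (F.D Ψ) (F.D Θ) k) (m : Mor Θ' Θ) (hm : m.base = τ) (h : f.hom ≫ l = m.hom) :
    F.map m = ((F.dec Γ').map f).hom ≫ k := by
  cases hm
  cases hl
  rw [map, ← hk.liftTo_eq hk.eq_sub]
  congr 3
  ext
  exact into_ext _ _ ((into_proj ..).trans f.w.symm) ((into_lift ..).trans h.symm)

theorem map_ofHom {Θ' Θ : Tel (M.L.obj Γ)} (f : Θ' ⟶ Θ) :
    F.map (.ofHom f) = ((F.dec Γ).map f).hom :=
  (F.map_eq f ((IsSub.id Θ).congr (M.L.map_id Γ) rfl) (IsSub.id _) _ rfl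
    (Category.comp_id _)).trans (Category.comp_id _)

theorem isSub_map (m : Mor Θ' Θ) (hm : IsSub (M.L.map m.base) Θ' Θ m.hom) :
    IsSub m.base (F.D Θ') (F.D Θ) (F.map m) := by
  have hk : IsSub m.base (F.D Θ') (F.D Θ)
      (liftTo ((congrArg F.D hm.eq_sub).trans (F.dec_sub m.base Θ))) := isSub_liftTo _
  refine hk.congr rfl ?_
  rw [F.map_eq (𝟙 Θ') hm hk m rfl (Category.id_comp _), CategoryTheory.Functor.map_id]
  exact Category.id_comp _

theorem map_ofSub (τ : Γ' ⟶ Γ) (Θ : Tel (M.L.obj Γ)) :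
    F.map (.ofSub τ Θ) = liftTo (F.dec_sub τ Θ) :=
  ((F.isSub_map (.ofSub τ Θ) (isSub_lift _ _)).liftTo_eq _).symm

theorem map_comp (m' : Mor Θ'' Θ') (m : Mor Θ' Θ) :
    F.map (m'.comp m) = F.map m' ≫ F.map m := by
  obtain ⟨r, hr, h⟩ : ∃ r : Θ'.sub (M.L.map m'.base) ⟶
      (Θ.sub (M.L.map m.base)).sub (M.L.map m'.base),
      ((F.dec Γ'').map r).hom ≫ liftTo (F.dec_sub m'.base _) =
        liftTo (F.dec_sub m'.base Θ') ≫ ((F.dec Γ').map m.vert).hom ∧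
      r.hom ≫ (Θ.sub (M.L.map m.base)).lift (M.L.map m'.base) = Θ'.lift _ ≫ m.vert.hom :=
    ⟨(reindex (M.L.map m'.base)).map m.vert, F.dec_map_sub .., reindex_map_lift ..⟩
  rw [F.map_eq (m'.vert ≫ r)
    (((isSub_lift _ _).comp (isSub_lift _ _)).congr (M.L.map_comp _ _) rfl)
    ((isSub_liftTo (F.dec_sub m'.base _)).comp (isSub_liftTo (F.dec_sub m.base Θ)))
    (m'.comp m) rfl, CategoryTheory.Functor.map_comp, comp_hom, map, map, Category.assoc,
    Category.assoc, ← Category.assoc _ (liftTo _) (liftTo _), hr, Category.assoc]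
  rw [comp_hom, Category.assoc, ← Category.assoc r.hom, h, Category.assoc, m.vert_lift,
    ← Category.assoc, m'.vert_lift]

theorem map_comp_evens (m : Mor Θ' Θ) : F.map m ≫ F.evens Θ = F.evens Θ' ≫ m.hom := by
  rw [map, Category.assoc, ← F.evens_sub, ← Category.assoc, F.map_evens, Category.assoc,
    m.vert_lift]

theorem map_eq_eqToHom {Θ Θ' : Tel (M.L.obj Γ)} (h : Θ' = Θ) (m : Mor Θ' Θ) (hb : m.base = 𝟙 Γ)
    (hm : m.hom = eqToHom (congrArg Tel.ext h)) :
    F.map m = eqToHom (congrArg (fun Θ => (F.D Θ).ext) h) := by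
  subst h
  obtain rfl : m = .ofHom (𝟙 _) := Mor.ext hb hm
  rw [map_ofHom, CategoryTheory.Functor.map_id]
  rfl

/-- The projection `(Θ ∣ A)^D ⟶ Θ^D`. -/
noncomputable def wk (Θ : Tel (M.L.obj Γ)) (A : Tel Θ.ext) :
    (F.D (Θ.append A)).ext ⟶ (F.D Θ).ext := ((F.dec Γ).map (wkHom Θ A)).hom

theorem wk_evens (Θ : Tel (M.L.obj Γ)) (A : Tel Θ.ext) :
    F.wk Θ A ≫ F.evens Θ = F.evens (Θ.append A) ≫ A.proj := F.map_evens (wkHom Θ A)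

theorem wk_nil (Θ : Tel (M.L.obj Γ)) : F.wk Θ (nil Θ.ext) = 𝟙 (F.D Θ).ext :=
  congrArg Hom.hom ((F.dec Γ).map_id Θ)

theorem map_append_wk (m : Mor Θ' Θ) {A' : Tel Θ'.ext} {A : Tel Θ.ext} {l : A'.ext ⟶ A.ext}
    (hl : IsSub m.hom A' A l) : F.map (m.append hl) ≫ F.wk Θ A = F.wk Θ' A' ≫ F.map m := by
  rw [wk, wk, ← map_ofHom, ← map_ofHom, ← map_comp, ← map_comp]
  congr 1
  refine Mor.ext ?_ hl.w
  simp

theorem map_pair_wk (m : Mor Θ' Θ) {A' : Tel Θ'.ext} {A : Tel Θ.ext} {l : A'.ext ⟶ A.ext}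
    (hl : IsSub m.hom A' A l) (t : A'.Sec) : F.map (m.pair hl t) ≫ F.wk Θ A = F.map m := by
  rw [wk, ← map_ofHom, ← map_comp]
  congr 1
  refine Mor.ext (Category.comp_id _) ?_
  refine (Category.assoc _ _ _).trans ?_
  refine (congrArg (t.hom ≫ ·) hl.w).trans ?_
  rw [← Category.assoc, t.w, Category.id_comp]

/-- The morphism `assoc` mediates between forgetting `(Υ ∣ Φ)` and forgetting `Φ`, then `Υ`. -/
theorem map_assoc_wk (Θ : Tel (M.L.obj Γ)) (Υ : Tel Θ.ext) (Φ : Tel Υ.ext) :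
    F.map (.assoc Θ Υ Φ) ≫ F.wk (Θ.append Υ) Φ ≫ F.wk Θ Υ = F.wk Θ (Υ.append Φ) := by
  rw [wk, wk, wk, ← map_ofHom, ← map_ofHom, ← map_ofHom, ← map_comp, ← map_comp]
  congr 1
  refine Mor.ext (by simp) ?_
  refine (Category.id_comp _).trans (append_proj Υ Φ).symm

/-- The map `(Θ'^D ∣ A[m][evens]) ⟶ (Θ^D ∣ A[evens])` over `m^D`. -/
noncomputable def morExt (m : Mor Θ' Θ) {A' : Tel Θ'.ext} {A : Tel Θ.ext} {l : A'.ext ⟶ A.ext}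
    (hl : IsSub m.hom A' A l) : (A'.sub (F.evens Θ')).ext ⟶ (A.sub (F.evens Θ)).ext :=
  A.into _ ((A'.sub (F.evens Θ')).proj ≫ F.map m) (A'.lift (F.evens Θ') ≫ l) (by
    rw [Category.assoc, hl.w, lift_proj_assoc, Category.assoc, F.map_comp_evens])

section

variable (m : Mor Θ' Θ) {A' : Tel Θ'.ext} {A : Tel Θ.ext} {l : A'.ext ⟶ A.ext}
  (hl : IsSub m.hom A' A l)

theorem morExt_proj : F.morExt m hl ≫ (A.sub (F.evens Θ)).proj =
    (A'.sub (F.evens Θ')).proj ≫ F.map m := into_proj ..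

theorem morExt_lift : F.morExt m hl ≫ A.lift (F.evens Θ) = A'.lift (F.evens Θ') ≫ l :=
  into_lift ..

theorem morExt_comp (m' : Mor Θ'' Θ') {A'' : Tel Θ''.ext} {l' : A''.ext ⟶ A'.ext}
    (hl' : IsSub m'.hom A'' A' l') :
    F.morExt (m'.comp m) (hl'.comp hl) = F.morExt m' hl' ≫ F.morExt m hl := by
  refine into_ext _ _ ?_ ?_
  · rw [morExt_proj, Category.assoc, morExt_proj, ← Category.assoc, morExt_proj, map_comp,
      Category.assoc]
  · rw [morExt_lift, Category.assoc, morExt_lift, ← Category.assoc, ← Category.assoc, morExt_lift]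

end

end DecFunctor

/-! ### Stability of display actions -/

namespace DispAction

variable {P : TelClass M} (F : DispAction P) {Γ Γ' Γ'' : M.Ctx .sm} {Θ'' : Tel (M.L.obj Γ'')}
  {Θ' : Tel (M.L.obj Γ')} {Θ : Tel (M.L.obj Γ)}

/-- Stability of display of types and terms under the morphism `m`, in a form that combines the
separate stability laws for morphisms of telescopes and for substitutions. -/
def StableUnder (m : Mor Θ' Θ) : Prop :=
  ∀ {A' : Tel Θ'.ext} {A : Tel Θ.ext} {l : A'.ext ⟶ A.ext} (hl : IsSub m.hom A' A l)
    (hA' : P.mem A') (hA : P.mem A), ∃ q, IsSub (F.morExt m hl) (F.disp Θ' A' hA')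
      (F.disp Θ A hA) q ∧ ∀ (t' : A'.Sec) (t : A.Sec), t'.hom ≫ l = m.hom ≫ t.hom →
        F.dispTm Θ' A' hA' t' ≫ q = F.map m ≫ F.dispTm Θ A hA t

theorem _root_.DTT.Tel.Sec.eq_sub_of_comp_lift {Γ Γ' : M.Ctx .sm} {A : Tel Γ} {σ : Γ' ⟶ Γ}
    {t' : (A.sub σ).Sec} {t : A.Sec} (h : t'.hom ≫ A.lift σ = σ ≫ t.hom) : t' = t.sub σ :=
  Sec.ext (into_ext _ _ (t'.w.trans (t.sub σ).w.symm) (h.trans (t.sub_lift σ).symm))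

theorem stableUnder_ofHom {Θ' Θ : Tel (M.L.obj Γ)} (f : Θ' ⟶ Θ) :
    F.StableUnder (.ofHom f) := by
  intro A' A l hl hA' hA
  cases hl
  refine ⟨_, (isSub_liftTo (F.disp_map f A hA)).congr ?_ rfl, fun t' t h => ?_⟩
  · refine into_ext _ _ ?_ ?_
    · rw [F.morExt_proj, DecFunctor.mapExt, into_proj, F.map_ofHom]
    · rw [F.morExt_lift, DecFunctor.mapExt, into_lift]
  · rw [Sec.eq_sub_of_comp_lift h, F.map_ofHom]
    exact F.dispTm_map f A hA t

theorem stableUnder_ofSub (τ : Γ' ⟶ Γ) (Θ : Tel (M.L.obj Γ)) :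
    F.StableUnder (.ofSub τ Θ) := by
  intro A' A l hl hA' hA
  cases hl
  refine ⟨_, (isSub_liftTo (F.disp_sub τ Θ A hA)).congr ?_ rfl, fun t' t h => ?_⟩
  · refine into_ext _ _ ?_ ?_
    · rw [F.morExt_proj, DecFunctor.baseExt, into_proj, F.map_ofSub]
    · rw [F.morExt_lift, DecFunctor.baseExt, into_lift]
  · rw [Sec.eq_sub_of_comp_lift h, F.map_ofSub]
    exact F.dispTm_sub τ Θ A hA t

theorem StableUnder.comp {m' : Mor Θ'' Θ'} {m : Mor Θ' Θ} (h' : F.StableUnder m')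
    (h : F.StableUnder m) : F.StableUnder (m'.comp m) := by
  intro A'' A l hl hA'' hA
  obtain ⟨l', hl', rfl⟩ := (isSub_lift A m.hom).exists_factor hl rfl
  obtain ⟨q', hq', e'⟩ := h' hl' hA'' (P.sub hA)
  obtain ⟨q, hq, e⟩ := h (isSub_lift A m.hom) (P.sub hA) hA
  refine ⟨q' ≫ q, (hq'.comp hq).congr (F.morExt_comp ..) rfl, fun t' t ht => ?_⟩
  rw [← Category.assoc, e' t' (t.sub m.hom), Category.assoc, e _ t (t.sub_lift _), F.map_comp,
    Category.assoc]
  refine into_ext _ _ ?_ ?_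
  · rw [Category.assoc, hl'.w, Category.assoc, (t.sub m.hom).w, ← Category.assoc, t'.w,
      Category.id_comp, Category.comp_id]
  · rw [Category.assoc, ht, Category.assoc, Category.assoc, t.sub_lift]

/-- Every morphism is a morphism over the identity followed by a canonical one, and the two kinds
are covered by the stability laws. -/
theorem stableUnder (m : Mor Θ' Θ) : F.StableUnder m := by
  rw [← m.vert_comp_ofSub]
  exact StableUnder.comp F (F.stableUnder_ofHom _) (F.stableUnder_ofSub _ _)

/-- Display of terms is décalage of sections followed by the comparison map, in a form relative to a
morphism `m`. A term `t` is the variable substituted along the section that it defines. -/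
theorem dispTm_comp (m : Mor Θ' Θ) {A' : Tel Θ'.ext} {A : Tel Θ.ext} {l : A'.ext ⟶ A.ext}
    (hl : IsSub m.hom A' A l) (hA' : P.mem A') (hA : P.mem A)
    {q : (F.disp Θ' A' hA').ext ⟶ (F.disp Θ A hA).ext}
    (hq : IsSub (F.morExt m hl) (F.disp Θ' A' hA') (F.disp Θ A hA) q) (t : A'.Sec) :
    F.dispTm Θ' A' hA' t ≫ q = F.map (m.pair hl t) ≫ F.comparison Θ A hA := by
  have hk : (m.pair hl t).hom ≫ A.proj = m.hom := by
    rw [Category.assoc, hl.w, ← Category.assoc, t.w, Category.id_comp]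
  obtain ⟨l', hl', h⟩ := (isSub_lift A A.proj).exists_factor (τ := (m.pair hl t).hom) hl hk.symm
  obtain ⟨q₁, hq₁, e₁⟩ := F.stableUnder (m.pair hl t) hl' hA' (P.sub hA)
  have hq₂ := isSub_liftTo (F.disp_map (wkHom Θ A) A hA)
  have hb : F.morExt m hl = F.morExt (m.pair hl t) hl' ≫ F.mapExt (wkHom Θ A) A := by
    refine into_ext _ _ ?_ ?_
    · rw [F.morExt_proj, DecFunctor.mapExt, Category.assoc, into_proj, ← Category.assoc,
        F.morExt_proj, Category.assoc]
      exact congrArg _ (F.map_pair_wk m hl t).symm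
    · rw [F.morExt_lift, DecFunctor.mapExt, Category.assoc, into_lift]
      refine Eq.trans ?_ (Category.assoc _ _ _)
      rw [F.morExt_lift, Category.assoc, h]
  have e : q = q₁ ≫ liftTo (F.disp_map (wkHom Θ A) A hA) :=
    (hq.liftTo_eq hq.eq_sub).symm.trans (((hq₁.comp hq₂).congr hb rfl).liftTo_eq hq.eq_sub)
  rw [e, ← Category.assoc, e₁ t (Sec.var A), Category.assoc, comparison]
  refine into_ext _ _ ?_ ?_
  · rw [Category.assoc, hl'.w, ← Category.assoc, t.w, Category.assoc, (Sec.var A).w,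
      Category.id_comp, Category.comp_id]
  · rw [Category.assoc, h, Category.assoc, Sec.var, into_lift, Category.comp_id]

/-- Display of terms is determined by the underlying functor and the comparison maps. -/
theorem dispTm_eq (A : Tel Θ.ext) (hA : P.mem A) (t : A.Sec) :
    F.dispTm Θ A hA t =
      ((F.dec Γ).map (Sec.toHom Θ t)).hom ≫ F.comparison Θ A hA := by
  have hl : IsSub (Mor.ofHom (𝟙 Θ)).hom A A (𝟙 _) := IsSub.id A
  have hb : F.morExt (.ofHom (𝟙 Θ)) hl = 𝟙 _ := by
    refine into_ext _ _ ?_ ?_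
    · rw [F.morExt_proj, F.map_ofHom, CategoryTheory.Functor.map_id, id_hom, Category.id_comp,
        Category.comp_id]
    · rw [F.morExt_lift, Category.id_comp, Category.comp_id]
  have h := F.dispTm_comp (.ofHom (𝟙 Θ)) hl hA hA ((IsSub.id (F.disp Θ A hA)).congr hb rfl) t
  rw [Category.comp_id] at h
  rw [h, ← F.map_ofHom]
  congr 2
  exact Mor.ext rfl (Category.comp_id _)

/-- Naturality of the comparison maps. -/
theorem comparison_comp (m : Mor Θ' Θ) {A' : Tel Θ'.ext} {A : Tel Θ.ext} {l : A'.ext ⟶ A.ext}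
    (hl : IsSub m.hom A' A l) (hA' : P.mem A') (hA : P.mem A)
    {q : (F.disp Θ' A' hA').ext ⟶ (F.disp Θ A hA).ext}
    (hq : IsSub (F.morExt m hl) (F.disp Θ' A' hA') (F.disp Θ A hA) q) :
    F.comparison Θ' A' hA' ≫ q = F.map (m.append hl) ≫ F.comparison Θ A hA := by
  have hw := isSub_liftTo (F.disp_map (wkHom Θ' A') A' hA')
  let m₁ : Mor (Θ'.append A') Θ := (Mor.ofHom (wkHom Θ' A')).comp m
  have hl₁ : IsSub m₁.hom (A'.sub A'.proj) A (A'.lift A'.proj ≫ l) := (isSub_lift _ _).comp hl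
  have hb : F.morExt m₁ hl₁ = F.mapExt (wkHom Θ' A') A' ≫ F.morExt m hl := by
    refine into_ext _ _ ?_ ?_
    · rw [F.morExt_proj, Category.assoc, F.morExt_proj, ← Category.assoc, DecFunctor.mapExt,
        into_proj, F.map_comp, F.map_ofHom, Category.assoc]
    · rw [F.morExt_lift, Category.assoc, F.morExt_lift, DecFunctor.mapExt, into_lift_assoc,
        Category.assoc]
  have h := F.dispTm_comp m₁ hl₁ (P.sub hA') hA ((hw.comp hq).congr hb rfl) (Sec.var A')
  rw [comparison, Category.assoc, h]
  congr 2
  refine Mor.ext (Category.id_comp _) ?_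
  refine (Category.assoc _ _ _).symm.trans ?_
  rw [Sec.var, into_lift, Category.id_comp]

theorem comparison_proj (A : Tel Θ.ext) (hA : P.mem A) :
    F.comparison Θ A hA ≫ (F.disp Θ A hA).proj ≫ (A.sub (F.evens Θ)).proj = F.wk Θ A := by
  have h : F.comparison Θ A hA ≫ (F.disp Θ A hA).proj =
      ((Sec.var A).sub (F.evens (Θ.append A))).hom ≫ F.mapExt (wkHom Θ A) A := by
    rw [comparison, Category.assoc, liftTo_proj, ← Category.assoc]
    exact congrArg (· ≫ F.mapExt (wkHom Θ A) A) (F.dispTm_proj (Θ.append A) (A.sub A.proj) _ _)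
  rw [← Category.assoc, h, Category.assoc, DecFunctor.mapExt, into_proj, ← Category.assoc,
    ((Sec.var A).sub _).w]
  exact Category.id_comp _

end DispAction

/-! ### Décalage of a telescope extended by a type -/

namespace TypeDisplay

variable (T : TypeDisplay M) {Γ Γ' : M.Ctx .sm} {Θ' : Tel (M.L.obj Γ')} {Θ : Tel (M.L.obj Γ)}

/-- The display of a type. -/
def d₁ (Θ : Tel (M.L.obj Γ)) (A : MTy Θ.ext) : Tel ((single A).sub (T.evens Θ)).ext :=
  T.disp Θ (single A) (TelClass.len1_single A)

theorem dec_snoc (Θ : Tel (M.L.obj Γ)) (A : MTy Θ.ext) :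
    T.D (Θ.snoc A) = ((T.D Θ).append ((single A).sub (T.evens Θ))).append (T.d₁ Θ A) :=
  (T.isTypeDisplay.strict Γ Θ (single A) (TelClass.len1_single A)).1

/-- The identification of `(Θ^D ∣ A[evens] ∣ A^d)` with `(Θ, A)^D`. -/
def join (Θ : Tel (M.L.obj Γ)) (A : MTy Θ.ext) : (T.d₁ Θ A).ext ⟶ (T.D (Θ.snoc A)).ext :=
  eqToHom (congrArg Tel.ext (T.dec_snoc Θ A)).symm

instance (Θ : Tel (M.L.obj Γ)) (A : MTy Θ.ext) : IsIso (T.join Θ A) := by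
  unfold join
  infer_instance

/-- The identification of `(Θ, A)^D` with `(Θ^D ∣ A[evens] ∣ A^d)`, which is the comparison
map. -/
def split (Θ : Tel (M.L.obj Γ)) (A : MTy Θ.ext) : (T.D (Θ.snoc A)).ext ⟶ (T.d₁ Θ A).ext :=
  eqToHom (congrArg Tel.ext (T.dec_snoc Θ A))

theorem comparison_eq_split (Θ : Tel (M.L.obj Γ)) (A : MTy Θ.ext) :
    T.comparison Θ (single A) (TelClass.len1_single A) = T.split Θ A :=
  (T.isTypeDisplay.strict Γ Θ (single A) (TelClass.len1_single A)).2

theorem join_split (Θ : Tel (M.L.obj Γ)) (A : MTy Θ.ext) :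
    T.join Θ A ≫ T.split Θ A = 𝟙 _ := eqToHom_trans _ _

theorem split_join (Θ : Tel (M.L.obj Γ)) (A : MTy Θ.ext) :
    T.split Θ A ≫ T.join Θ A = 𝟙 _ := eqToHom_trans _ _

theorem split_proj (Θ : Tel (M.L.obj Γ)) (A : MTy Θ.ext) :
    T.split Θ A ≫ (T.d₁ Θ A).proj ≫ ((single A).sub (T.evens Θ)).proj = T.wk Θ (single A) := by
  rw [← comparison_eq_split]
  exact T.comparison_proj _ _

theorem split_evens (Θ : Tel (M.L.obj Γ)) (A : MTy Θ.ext) :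
    T.split Θ A ≫ (T.d₁ Θ A).proj ≫ (single A).lift (T.evens Θ) = T.evens (Θ.snoc A) := by
  rw [← comparison_eq_split]
  exact T.comparison_evens _ _ _

theorem join_wk (Θ : Tel (M.L.obj Γ)) (A : MTy Θ.ext) :
    T.join Θ A ≫ T.wk Θ (single A) =
      (T.d₁ Θ A).proj ≫ ((single A).sub (T.evens Θ)).proj := by
  rw [← T.split_proj, ← Category.assoc, join_split, Category.id_comp]

theorem join_evens (Θ : Tel (M.L.obj Γ)) (A : MTy Θ.ext) :
    T.join Θ A ≫ T.evens (Θ.snoc A) = (T.d₁ Θ A).proj ≫ (single A).lift (T.evens Θ) := by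
  rw [← T.split_evens, ← Category.assoc, join_split, Category.id_comp]

/-- Stability of the display of types, and of its identification with décalage. -/
theorem exists_isSub_d₁ (m : Mor Θ' Θ) {A' : MTy Θ'.ext} {A : MTy Θ.ext}
    {l : (single A').ext ⟶ (single A).ext} (hl : IsSub m.hom (single A') (single A) l) :
    ∃ q, IsSub (T.morExt m hl) (T.d₁ Θ' A') (T.d₁ Θ A) q ∧
      q ≫ T.join Θ A = T.join Θ' A' ≫ T.map (m.append hl) := by
  obtain ⟨q, hq, h⟩ : ∃ q, IsSub (T.morExt m hl) (T.d₁ Θ' A') (T.d₁ Θ A) q ∧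
      T.split Θ' A' ≫ q = T.map (m.append hl) ≫ T.split Θ A := by
    obtain ⟨q, hq, -⟩ := T.stableUnder m hl (TelClass.len1_single A') (TelClass.len1_single A)
    refine ⟨q, hq, ?_⟩
    rw [← comparison_eq_split, ← comparison_eq_split]
    exact T.comparison_comp m hl _ _ hq
  refine ⟨q, hq, ?_⟩
  have e : q = T.join Θ' A' ≫ T.map (m.append hl) ≫ T.split Θ A := by
    rw [← h, ← Category.assoc, join_split, Category.id_comp]
  rw [e, Category.assoc, Category.assoc, split_join]
  exact congrArg _ (Category.comp_id _)

end TypeDisplay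

/-! ### The odd part of a telescope -/

namespace TypeDisplay

variable (T : TypeDisplay M) {Γ Γ' : M.Ctx .sm} {Θ' : Tel (M.L.obj Γ')} {Θ : Tel (M.L.obj Γ)}

/-- The odd part of `Φ` along maps `a : X ⟶ Θ^D` and `b : X ⟶ Φ`: a telescope over `X`, and the map
that interleaves its entries with those of `b` to give the entries of `(Θ ∣ Φ)^D` after `a`. -/
structure Odd (Θ : Tel (M.L.obj Γ)) (Φ : Tel Θ.ext) {X : M.Ctx .sm} (a : X ⟶ (T.D Θ).ext)
    (b : X ⟶ Φ.ext) where
  /-- The telescope. -/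
  tel : Tel X
  /-- The interleaving map. -/
  lift : tel.ext ⟶ (T.D (Θ.append Φ)).ext
  lift_wk : lift ≫ T.wk Θ Φ = tel.proj ≫ a
  lift_evens : lift ≫ T.evens (Θ.append Φ) = tel.proj ≫ b

section

variable (Θ : Tel (M.L.obj Γ)) (Υ : Tel Θ.ext) (A : MTy Υ.ext)

/-- The map `join`, for the last type of a dependent telescope. The telescopes `Θ.append (Υ.snoc A)`
and `(Θ.append Υ).snoc A` are definitionally equal. -/
def joinSnoc : (T.d₁ (Θ.append Υ) A).ext ⟶ (T.D (Θ.append (Υ.snoc A))).ext :=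
  T.join (Θ.append Υ) A

/-- The map `split`, for the last type of a dependent telescope. -/
def splitSnoc : (T.D (Θ.append (Υ.snoc A))).ext ⟶ (T.d₁ (Θ.append Υ) A).ext :=
  T.split (Θ.append Υ) A

/-- The projection that forgets the last type of a dependent telescope. -/
noncomputable def wkSnoc : (T.D (Θ.append (Υ.snoc A))).ext ⟶ (T.D (Θ.append Υ)).ext :=
  T.wk (Θ.append Υ) (single A)

theorem splitSnoc_joinSnoc : T.splitSnoc Θ Υ A ≫ T.joinSnoc Θ Υ A = 𝟙 _ :=
  T.split_join (Θ.append Υ) A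

theorem joinSnoc_splitSnoc : T.joinSnoc Θ Υ A ≫ T.splitSnoc Θ Υ A = 𝟙 _ :=
  T.join_split (Θ.append Υ) A

instance : IsIso (T.joinSnoc Θ Υ A) :=
  ⟨T.splitSnoc Θ Υ A, T.joinSnoc_splitSnoc Θ Υ A, T.splitSnoc_joinSnoc Θ Υ A⟩

theorem joinSnoc_wkSnoc : T.joinSnoc Θ Υ A ≫ T.wkSnoc Θ Υ A =
    (T.d₁ (Θ.append Υ) A).proj ≫ ((single A).sub (T.evens (Θ.append Υ))).proj :=
  T.join_wk (Θ.append Υ) A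

theorem joinSnoc_evens : T.joinSnoc Θ Υ A ≫ T.evens (Θ.append (Υ.snoc A)) =
    (T.d₁ (Θ.append Υ) A).proj ≫ (single A).lift (T.evens (Θ.append Υ)) :=
  T.join_evens (Θ.append Υ) A

theorem splitSnoc_proj : T.splitSnoc Θ Υ A ≫ (T.d₁ (Θ.append Υ) A).proj ≫
    ((single A).sub (T.evens (Θ.append Υ))).proj = T.wkSnoc Θ Υ A :=
  T.split_proj (Θ.append Υ) A

theorem splitSnoc_evens : T.splitSnoc Θ Υ A ≫ (T.d₁ (Θ.append Υ) A).proj ≫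
    (single A).lift (T.evens (Θ.append Υ)) = T.evens (Θ.append (Υ.snoc A)) :=
  T.split_evens (Θ.append Υ) A

theorem wkSnoc_evens : T.wkSnoc Θ Υ A ≫ T.evens (Θ.append Υ) =
    T.evens (Θ.append (Υ.snoc A)) ≫ (single A).proj :=
  T.wk_evens (Θ.append Υ) (single A)

theorem wkSnoc_wk : T.wkSnoc Θ Υ A ≫ T.wk Θ Υ = T.wk Θ (Υ.snoc A) := by
  have h : T.map (.assoc Θ Υ (single A)) = 𝟙 _ := T.map_eq_eqToHom rfl _ rfl rfl
  refine Eq.trans ?_ (T.map_assoc_wk Θ Υ (single A))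
  exact ((congrArg (· ≫ T.wkSnoc Θ Υ A ≫ T.wk Θ Υ) h).trans (Category.id_comp _)).symm

end

/-- Stability of the display of the last type of a dependent telescope. -/
theorem exists_isSub_d₁_snoc {Υ' : Tel Θ'.ext} {A' : MTy Υ'.ext} {Υ : Tel Θ.ext} {A : MTy Υ.ext}
    (n : Mor (Θ'.append Υ') (Θ.append Υ)) {l : (single A').ext ⟶ (single A).ext}
    (hl : IsSub n.hom (single A') (single A) l)
    (n' : Mor (Θ'.append (Υ'.snoc A')) (Θ.append (Υ.snoc A))) (hn : n'.base = n.base)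
    (hn' : n'.hom = l) :
    ∃ q, IsSub (T.morExt n hl) (T.d₁ (Θ'.append Υ') A') (T.d₁ (Θ.append Υ) A) q ∧
      q ≫ T.joinSnoc Θ Υ A = T.joinSnoc Θ' Υ' A' ≫ T.map n' := by
  obtain rfl : n' = n.append hl := Mor.ext hn hn'
  exact T.exists_isSub_d₁ n hl

namespace Odd

variable {T}

section

variable {Υ : Tel Θ.ext} {A : MTy Υ.ext} {X : M.Ctx .sm} {a : X ⟶ (T.D Θ).ext}
  {b : X ⟶ (Υ.snoc A).ext} (o : T.Odd Θ Υ a (b ≫ (single A).proj))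

/-- The argument at which `A^d` is taken in the odd part of `(Υ, A)`: the interleaving of the
earlier entries, and the last entry of `b`. -/
noncomputable def arg : o.tel.ext ⟶ ((single A).sub (T.evens (Θ.append Υ))).ext :=
  (single A).into _ o.lift (o.tel.proj ≫ b) (by
    rw [o.lift_evens, Category.assoc])

theorem arg_proj : o.arg ≫ ((single A).sub (T.evens (Θ.append Υ))).proj = o.lift := into_proj ..

theorem arg_lift : o.arg ≫ (single A).lift (T.evens (Θ.append Υ)) = o.tel.proj ≫ b :=
  into_lift ..

/-- The odd part of `(Υ, A)`. -/
noncomputable abbrev snoc : T.Odd Θ (Υ.snoc A) a b where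
  tel := o.tel.append ((T.d₁ (Θ.append Υ) A).sub o.arg)
  lift := (T.d₁ (Θ.append Υ) A).lift o.arg ≫ T.joinSnoc Θ Υ A
  lift_wk := by
    rw [← T.wkSnoc_wk, Category.assoc, ← Category.assoc (T.joinSnoc _ _ _), T.joinSnoc_wkSnoc,
      Category.assoc, lift_proj_assoc, ← Category.assoc o.arg, arg_proj, o.lift_wk, append_proj,
      Category.assoc]
  lift_evens := by
    rw [Category.assoc, T.joinSnoc_evens, lift_proj_assoc, arg_lift, append_proj, Category.assoc]

end

/-- Naturality of the last step in the construction of the odd part. -/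
theorem exists_isSub_step {Υ' : Tel Θ'.ext} {A' : MTy Υ'.ext} {X' : M.Ctx .sm}
    {a' : X' ⟶ (T.D Θ').ext} {b' : X' ⟶ (Υ'.snoc A').ext}
    (o' : T.Odd Θ' Υ' a' (b' ≫ (single A').proj))
    {Υ : Tel Θ.ext} {A : MTy Υ.ext} {X : M.Ctx .sm} {a : X ⟶ (T.D Θ).ext}
    {b : X ⟶ (Υ.snoc A).ext} (o : T.Odd Θ Υ a (b ≫ (single A).proj))
    (n : Mor (Θ'.append Υ') (Θ.append Υ)) {l : (single A').ext ⟶ (single A).ext}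
    (hl : IsSub n.hom (single A') (single A) l)
    (n' : Mor (Θ'.append (Υ'.snoc A')) (Θ.append (Υ.snoc A))) (hn : n'.base = n.base)
    (hn' : n'.hom = l) (y : o'.tel.ext ⟶ o.tel.ext)
    (hy : y ≫ o.lift = o'.lift ≫ T.map n) (hb : y ≫ o.tel.proj ≫ b = o'.tel.proj ≫ b' ≫ l) :
    ∃ q, IsSub y ((T.d₁ (Θ'.append Υ') A').sub o'.arg) ((T.d₁ (Θ.append Υ) A).sub o.arg) q ∧
      q ≫ o.snoc.lift = o'.snoc.lift ≫ T.map n' := by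
  obtain ⟨q, hq, e⟩ := T.exists_isSub_d₁_snoc n hl n' hn hn'
  have h : o'.arg ≫ T.morExt n hl = y ≫ o.arg := by
    refine into_ext _ _ ?_ ?_
    · rw [Category.assoc, T.morExt_proj, Category.assoc, arg_proj, hy, ← Category.assoc,
        arg_proj]
    · rw [Category.assoc, T.morExt_lift, Category.assoc, arg_lift, hb, ← Category.assoc,
        arg_lift, Category.assoc]
  obtain ⟨k, hk, e'⟩ := (isSub_lift (T.d₁ (Θ.append Υ) A) o.arg).exists_factor
    ((isSub_lift _ o'.arg).comp hq) h
  refine ⟨k, hk, ?_⟩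
  rw [← Category.assoc, e', Category.assoc, Category.assoc, e]

/-- The step of `TypeDisplay.odd_hom_ext`. -/
theorem snoc_hom_ext {Υ : Tel Θ.ext} {A : MTy Υ.ext} {X : M.Ctx .sm} {a : X ⟶ (T.D Θ).ext}
    {b : X ⟶ (Υ.snoc A).ext} (o : T.Odd Θ Υ a (b ≫ (single A).proj)) {Y : M.Ctx .sm}
    (ih : ∀ y y' : Y ⟶ o.tel.ext, y ≫ o.tel.proj = y' ≫ o.tel.proj →
      y ≫ o.lift = y' ≫ o.lift → y = y') {y y' : Y ⟶ o.snoc.tel.ext}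
    (e : y ≫ o.snoc.tel.proj = y' ≫ o.snoc.tel.proj)
    (e' : y ≫ o.snoc.lift = y' ≫ o.snoc.lift) : y = y' := by
  rw [← Category.assoc, ← Category.assoc, cancel_mono] at e'
  rw [append_proj, ← Category.assoc, ← Category.assoc] at e
  refine into_ext _ _ (ih _ _ e ?_) e'
  have h := congrArg (· ≫ (T.d₁ (Θ.append Υ) A).proj ≫
    ((single A).sub (T.evens (Θ.append Υ))).proj) e'
  simp only [Category.assoc] at h
  rw [lift_proj_assoc, o.arg_proj] at h
  simpa only [Category.assoc] using h

/-- The step of `TypeDisplay.exists_odd_lift`. -/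
theorem exists_snoc_lift {Υ : Tel Θ.ext} {A : MTy Υ.ext} {X : M.Ctx .sm} {a : X ⟶ (T.D Θ).ext}
    {b : X ⟶ (Υ.snoc A).ext} (o : T.Odd Θ Υ a (b ≫ (single A).proj)) {Y : M.Ctx .sm}
    (x : Y ⟶ X) (z : Y ⟶ (T.D (Θ.append (Υ.snoc A))).ext)
    (hz : z ≫ T.evens (Θ.append (Υ.snoc A)) = x ≫ b) (y : Y ⟶ o.tel.ext)
    (hy : y ≫ o.tel.proj = x) (hy' : y ≫ o.lift = z ≫ T.wkSnoc Θ Υ A) :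
    ∃ y : Y ⟶ o.snoc.tel.ext, y ≫ o.snoc.tel.proj = x ∧ y ≫ o.snoc.lift = z := by
  refine ⟨(T.d₁ (Θ.append Υ) A).into o.arg y (z ≫ T.splitSnoc Θ Υ A) ?_, ?_, ?_⟩
  · refine into_ext _ _ ?_ ?_
    · rw [Category.assoc, Category.assoc, T.splitSnoc_proj, Category.assoc, o.arg_proj, hy']
    · rw [Category.assoc, Category.assoc, T.splitSnoc_evens, Category.assoc, o.arg_lift,
        ← Category.assoc, hy, hz]
  · rw [append_proj, ← Category.assoc, into_proj, hy]
  · rw [← Category.assoc, into_lift, Category.assoc, T.splitSnoc_joinSnoc, Category.comp_id]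

end Odd

/-- The odd part, by recursion on the list of types. -/
noncomputable def oddTo (Θ : Tel (M.L.obj Γ)) : {Δ : M.Ctx .sm} → (Φ : TelTo Θ.ext Δ) →
    {X : M.Ctx .sm} → (a : X ⟶ (T.D Θ).ext) → (b : X ⟶ Δ) → b ≫ Φ.proj = a ≫ T.evens Θ →
      T.Odd Θ ⟨Δ, Φ⟩ a b
  | _, .nil, X, a, b, h =>
    { tel := nil X
      lift := a
      lift_wk := by
        refine (congrArg (a ≫ ·) (T.wk_nil Θ)).trans ?_
        exact (Category.comp_id _).trans (Category.id_comp _).symm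
      lift_evens := h.symm.trans ((Category.comp_id _).trans (Category.id_comp _).symm) }
  | _, .snoc Υ A, _, a, b, h => Odd.snoc (Υ := ⟨_, Υ⟩) (b := b)
      (oddTo Θ Υ a (b ≫ (single A).proj) (by
        refine Eq.trans ?_ h
        exact (Category.assoc _ _ _).trans (congrArg (b ≫ · ≫ Υ.proj) (Category.comp_id A.wk))))

/-- The odd part of a telescope. -/
noncomputable def odd (Θ : Tel (M.L.obj Γ)) (Φ : Tel Θ.ext) {X : M.Ctx .sm}
    (a : X ⟶ (T.D Θ).ext) (b : X ⟶ Φ.ext) (h : b ≫ Φ.proj = a ≫ T.evens Θ) : T.Odd Θ Φ a b :=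
  T.oddTo Θ Φ.path a b h

theorem comp_proj_snoc {Υ : Tel Θ.ext} {A : MTy Υ.ext} {X : M.Ctx .sm} {b : X ⟶ (Υ.snoc A).ext}
    {a : X ⟶ Θ.ext} (h : b ≫ (Υ.snoc A).proj = a) : (b ≫ (single A).proj) ≫ Υ.proj = a := by
  rw [Category.assoc, ← append_proj, h]

/-- The step of `TypeDisplay.exists_isSub_odd`. -/
theorem exists_isSub_odd_snoc (m : Mor Θ' Θ) {Υ' : Tel Θ'.ext} {Υ : Tel Θ.ext}
    {l : Υ'.ext ⟶ Υ.ext} (hl : IsSub m.hom Υ' Υ l) {A' : MTy Υ'.ext} {A : MTy Υ.ext}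
    {l' : (single A').ext ⟶ (single A).ext} (hl' : IsSub l (single A') (single A) l')
    {X' X : M.Ctx .sm} (x : X' ⟶ X) {a' : X' ⟶ (T.D Θ').ext} {b' : X' ⟶ (Υ'.snoc A').ext}
    (h' : b' ≫ (Υ'.snoc A').proj = a' ≫ T.evens Θ') {a : X ⟶ (T.D Θ).ext}
    {b : X ⟶ (Υ.snoc A).ext} (h : b ≫ (Υ.snoc A).proj = a ≫ T.evens Θ)
    (hb : b' ≫ l' = x ≫ b)
    (ih : ∀ {b' : X' ⟶ Υ'.ext} (h' : b' ≫ Υ'.proj = a' ≫ T.evens Θ') {b : X ⟶ Υ.ext}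
      (h : b ≫ Υ.proj = a ≫ T.evens Θ), b' ≫ l = x ≫ b →
      ∃ k, IsSub x (T.odd Θ' Υ' a' b' h').tel (T.odd Θ Υ a b h).tel k ∧
        k ≫ (T.odd Θ Υ a b h).lift = (T.odd Θ' Υ' a' b' h').lift ≫ T.map (m.append hl)) :
    ∃ k, IsSub x (T.odd Θ' (Υ'.snoc A') a' b' h').tel (T.odd Θ (Υ.snoc A) a b h).tel k ∧
      k ≫ (T.odd Θ (Υ.snoc A) a b h).lift = (T.odd Θ' (Υ'.snoc A') a' b' h').lift ≫
        T.map (m.append (hl.append hl')) := by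
  obtain ⟨k, hk, e⟩ := ih (comp_proj_snoc h') (comp_proj_snoc h) (by
    rw [Category.assoc, ← hl'.w, ← Category.assoc, ← Category.assoc, hb])
  obtain ⟨q, hq, e'⟩ := Odd.exists_isSub_step _ _ (m.append hl) hl' (m.append (hl.append hl'))
    rfl rfl k e (by rw [← Category.assoc, hk.w, Category.assoc, hb])
  exact ⟨q, hk.append hq, e'⟩

/-- The odd part is natural in all arguments. -/
theorem exists_isSub_odd (m : Mor Θ' Θ) {Φ' : Tel Θ'.ext} {Φ : Tel Θ.ext} {l : Φ'.ext ⟶ Φ.ext}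
    (hl : IsSub m.hom Φ' Φ l) {X' X : M.Ctx .sm} (x : X' ⟶ X) {a' : X' ⟶ (T.D Θ').ext}
    {b' : X' ⟶ Φ'.ext} (h' : b' ≫ Φ'.proj = a' ≫ T.evens Θ') {a : X ⟶ (T.D Θ).ext}
    {b : X ⟶ Φ.ext} (h : b ≫ Φ.proj = a ≫ T.evens Θ) (ha : a' ≫ T.map m = x ≫ a)
    (hb : b' ≫ l = x ≫ b) :
    ∃ k, IsSub x (T.odd Θ' Φ' a' b' h').tel (T.odd Θ Φ a b h).tel k ∧
      k ≫ (T.odd Θ Φ a b h).lift = (T.odd Θ' Φ' a' b' h').lift ≫ T.map (m.append hl) := by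
  cases hl
  induction Φ using snoc_induction with
  | nil => exact ⟨x, isSub_nil x, ha.symm⟩
  | snoc Υ A ih =>
    exact T.exists_isSub_odd_snoc m (isSub_lift Υ m.hom) (isSub_lift (single A) (Υ.lift m.hom)) x
      h' h hb fun h' _ h hb => ih h h' hb

/-- The odd part of `(Υ ∣ Φ)` is the odd part of `Υ`, followed by the odd part of `Φ` over the
interleaving of `Υ`. -/
theorem exists_isSub_odd_append (Θ : Tel (M.L.obj Γ)) (Υ : Tel Θ.ext) (Φ : Tel Υ.ext)
    {X : M.Ctx .sm} {a : X ⟶ (T.D Θ).ext} {b : X ⟶ Φ.ext} {b₁ : X ⟶ Υ.ext}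
    (h : b ≫ (Υ.append Φ).proj = a ≫ T.evens Θ) (h₁ : b₁ ≫ Υ.proj = a ≫ T.evens Θ)
    {b₂ : (T.odd Θ Υ a b₁ h₁).tel.ext ⟶ Φ.ext}
    (h₂ : b₂ ≫ Φ.proj = (T.odd Θ Υ a b₁ h₁).lift ≫ T.evens (Θ.append Υ))
    (hb₁ : b₁ = b ≫ Φ.proj) (hb₂ : b₂ = (T.odd Θ Υ a b₁ h₁).tel.proj ≫ b) :
    ∃ k, IsSub (𝟙 X) (T.odd Θ (Υ.append Φ) a b h).tel ((T.odd Θ Υ a b₁ h₁).tel.append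
        (T.odd (Θ.append Υ) Φ (T.odd Θ Υ a b₁ h₁).lift b₂ h₂).tel) k ∧
      k ≫ (T.odd (Θ.append Υ) Φ (T.odd Θ Υ a b₁ h₁).lift b₂ h₂).lift =
        (T.odd Θ (Υ.append Φ) a b h).lift ≫ T.map (.assoc Θ Υ Φ) := by
  induction Φ using snoc_induction with
  | nil =>
    obtain rfl : b₁ = b := hb₁.trans (Category.comp_id b)
    obtain rfl : b₂ = _ := hb₂
    refine ⟨𝟙 _, IsSub.id _, (Category.id_comp _).trans ?_⟩
    have e : T.map (.assoc Θ Υ (nil Υ.ext)) = 𝟙 _ := T.map_eq_eqToHom rfl _ rfl rfl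
    exact ((congrArg (_ ≫ ·) e).trans (Category.comp_id _)).symm
  | snoc Φ A ih =>
    obtain ⟨k, hk, e⟩ := ih (b := b ≫ (single A).proj) (b₂ := b₂ ≫ (single A).proj)
      (comp_proj_snoc (Υ := Υ.append Φ) h)
      (comp_proj_snoc (Θ := Θ.append Υ) h₂)
      (hb₁.trans ((congrArg (b ≫ ·) (append_proj Φ (single A))).trans (Category.assoc ..).symm))
      (by rw [hb₂, Category.assoc])
    obtain ⟨q, hq, e'⟩ := Odd.exists_isSub_step (A' := A) (A := A) (b' := b) (b := b₂)
      (T.odd Θ (Υ.append Φ) a _ (comp_proj_snoc (Υ := Υ.append Φ) h))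
      (T.odd (Θ.append Υ) Φ _ _ (comp_proj_snoc (Θ := Θ.append Υ) h₂)) (.assoc Θ Υ Φ)
      (IsSub.id (single A)) (.assoc Θ Υ (Φ.snoc A)) rfl rfl k e (by
        have h := hk.w
        rw [append_proj, Category.comp_id] at h
        refine (congrArg (k ≫ _ ≫ ·) hb₂).trans ?_
        rw [← Category.assoc _ _ b, ← Category.assoc k, h]
        exact congrArg (_ ≫ ·) (Category.comp_id b).symm)
    exact ⟨q, ((hk.append hq).comp (isSub_assoc _ _ _)).congr (Category.id_comp _).symm
      (Category.comp_id q).symm, e'⟩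

/-- Maps into the odd part are determined by their components in `X` and in `(Θ ∣ Φ)^D`. -/
theorem odd_hom_ext (Θ : Tel (M.L.obj Γ)) (Φ : Tel Θ.ext) {X : M.Ctx .sm}
    {a : X ⟶ (T.D Θ).ext} {b : X ⟶ Φ.ext} (h : b ≫ Φ.proj = a ≫ T.evens Θ) {Y : M.Ctx .sm}
    {y y' : Y ⟶ (T.odd Θ Φ a b h).tel.ext}
    (e : y ≫ (T.odd Θ Φ a b h).tel.proj = y' ≫ (T.odd Θ Φ a b h).tel.proj)
    (e' : y ≫ (T.odd Θ Φ a b h).lift = y' ≫ (T.odd Θ Φ a b h).lift) : y = y' := by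
  induction Φ using snoc_induction with
  | nil => exact (Category.comp_id y).symm.trans (e.trans (Category.comp_id y'))
  | snoc Υ A ih =>
    exact Odd.snoc_hom_ext (T.odd Θ Υ a _ (comp_proj_snoc h)) (fun y y' e e' => ih _ e e') e e'

/-- Compatible components in `X` and in `(Θ ∣ Φ)^D` define a map into the odd part. -/
theorem exists_odd_lift (Θ : Tel (M.L.obj Γ)) (Φ : Tel Θ.ext) {X : M.Ctx .sm}
    {a : X ⟶ (T.D Θ).ext} {b : X ⟶ Φ.ext} (h : b ≫ Φ.proj = a ≫ T.evens Θ) {Y : M.Ctx .sm}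
    (x : Y ⟶ X) (z : Y ⟶ (T.D (Θ.append Φ)).ext) (hz : z ≫ T.wk Θ Φ = x ≫ a)
    (hz' : z ≫ T.evens (Θ.append Φ) = x ≫ b) :
    ∃ y : Y ⟶ (T.odd Θ Φ a b h).tel.ext,
      y ≫ (T.odd Θ Φ a b h).tel.proj = x ∧ y ≫ (T.odd Θ Φ a b h).lift = z := by
  induction Φ using snoc_induction with
  | nil =>
    refine ⟨x, Category.comp_id _, hz.symm.trans ?_⟩
    exact (congrArg (z ≫ ·) (T.wk_nil Θ)).trans (Category.comp_id z)
  | snoc Υ A ih =>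
    obtain ⟨y, hy, hy'⟩ := ih (comp_proj_snoc h) (z ≫ T.wkSnoc Θ Υ A)
      (by rw [Category.assoc, wkSnoc_wk, hz])
      (by rw [Category.assoc, T.wkSnoc_evens, ← Category.assoc, hz', Category.assoc])
    exact Odd.exists_snoc_lift (T.odd Θ Υ a _ (comp_proj_snoc h)) x z hz' y hy hy'

end TypeDisplay

/-! ### Display of telescopes -/

namespace TypeDisplay

variable (T : TypeDisplay M) {Γ Γ' : M.Ctx .sm} {Θ' : Tel (M.L.obj Γ')} {Θ : Tel (M.L.obj Γ)}

/-- The display `Φ^d` of a telescope: its odd part over the generic context `(Θ^D ∣ Φ[evens])`. -/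
noncomputable def displ (Θ : Tel (M.L.obj Γ)) (Φ : Tel Θ.ext) : Tel (Φ.sub (T.evens Θ)).ext :=
  (T.odd Θ Φ _ _ (Φ.lift_proj (T.evens Θ))).tel

/-- The interleaving map `⟨φ, φ'⟩`. -/
noncomputable def inter (Θ : Tel (M.L.obj Γ)) (Φ : Tel Θ.ext) :
    (T.displ Θ Φ).ext ⟶ (T.D (Θ.append Φ)).ext :=
  (T.odd Θ Φ _ _ (Φ.lift_proj (T.evens Θ))).lift

theorem inter_wk (Θ : Tel (M.L.obj Γ)) (Φ : Tel Θ.ext) : T.inter Θ Φ ≫ T.wk Θ Φ =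
    (T.displ Θ Φ).proj ≫ (Φ.sub (T.evens Θ)).proj := Odd.lift_wk _

theorem inter_evens (Θ : Tel (M.L.obj Γ)) (Φ : Tel Θ.ext) : T.inter Θ Φ ≫ T.evens (Θ.append Φ) =
    (T.displ Θ Φ).proj ≫ Φ.lift (T.evens Θ) := Odd.lift_evens _

instance (Θ : Tel (M.L.obj Γ)) (Φ : Tel Θ.ext) : IsIso (T.inter Θ Φ) := by
  obtain ⟨y, hy, hy'⟩ := T.exists_odd_lift Θ Φ (Φ.lift_proj (T.evens Θ))
    (Φ.into (T.evens Θ) (T.wk Θ Φ) (T.evens (Θ.append Φ)) (T.wk_evens Θ Φ).symm) (𝟙 _)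
    (by rw [into_proj, Category.id_comp]) (by rw [into_lift, Category.id_comp])
  refine ⟨y, T.odd_hom_ext Θ Φ (Φ.lift_proj (T.evens Θ)) ?_ ?_, hy'⟩
  · refine (Category.assoc _ _ _).trans ((congrArg (_ ≫ ·) hy).trans ?_)
    refine Eq.trans (into_ext _ _ ?_ ?_) (Category.id_comp _).symm
    · rw [Category.assoc, into_proj, T.inter_wk]
      rfl
    · rw [Category.assoc, into_lift, T.inter_evens]
      rfl
  · refine (Category.assoc _ _ _).trans ((congrArg (_ ≫ ·) hy').trans ?_)
    exact (Category.comp_id _).trans (Category.id_comp _).symm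

/-- The comparison map, inverse to interleaving. -/
noncomputable def compar (Θ : Tel (M.L.obj Γ)) (Φ : Tel Θ.ext) :
    (T.D (Θ.append Φ)).ext ⟶ (T.displ Θ Φ).ext := inv (T.inter Θ Φ)

theorem inter_compar (Θ : Tel (M.L.obj Γ)) (Φ : Tel Θ.ext) :
    T.inter Θ Φ ≫ T.compar Θ Φ = 𝟙 _ := IsIso.hom_inv_id _

theorem compar_inter (Θ : Tel (M.L.obj Γ)) (Φ : Tel Θ.ext) :
    T.compar Θ Φ ≫ T.inter Θ Φ = 𝟙 _ := IsIso.inv_hom_id _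

theorem compar_inter_assoc (Θ : Tel (M.L.obj Γ)) (Φ : Tel Θ.ext) {X : M.Ctx .sm}
    (k : (T.D (Θ.append Φ)).ext ⟶ X) : T.compar Θ Φ ≫ T.inter Θ Φ ≫ k = k := by
  rw [← Category.assoc, compar_inter, Category.id_comp]

theorem compar_proj (Θ : Tel (M.L.obj Γ)) (Φ : Tel Θ.ext) :
    T.compar Θ Φ ≫ (T.displ Θ Φ).proj ≫ (Φ.sub (T.evens Θ)).proj = T.wk Θ Φ := by
  rw [← inter_wk, compar_inter_assoc]

theorem compar_lift (Θ : Tel (M.L.obj Γ)) (Φ : Tel Θ.ext) :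
    T.compar Θ Φ ≫ (T.displ Θ Φ).proj ≫ Φ.lift (T.evens Θ) = T.evens (Θ.append Φ) := by
  rw [← inter_evens, compar_inter_assoc]

theorem map_append_id (Θ : Tel (M.L.obj Γ)) (Φ : Tel Θ.ext) :
    T.map ((Mor.ofHom (𝟙 Θ)).append (IsSub.id Φ)) = 𝟙 _ := T.map_eq_eqToHom rfl _ rfl rfl

/-- Every odd part is a substitution of the display. -/
theorem exists_isSub_odd_displ (Θ : Tel (M.L.obj Γ)) (Φ : Tel Θ.ext) {X : M.Ctx .sm}
    (x : X ⟶ (Φ.sub (T.evens Θ)).ext) {a : X ⟶ (T.D Θ).ext} {b : X ⟶ Φ.ext}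
    (h : b ≫ Φ.proj = a ≫ T.evens Θ) (ha : a = x ≫ (Φ.sub (T.evens Θ)).proj)
    (hb : b = x ≫ Φ.lift (T.evens Θ)) :
    ∃ k, IsSub x (T.odd Θ Φ a b h).tel (T.displ Θ Φ) k ∧
      k ≫ T.inter Θ Φ = (T.odd Θ Φ a b h).lift := by
  obtain ⟨k, hk, e⟩ := T.exists_isSub_odd (.ofHom (𝟙 Θ)) (IsSub.id Φ) x h
    (Φ.lift_proj (T.evens Θ)) (by
      rw [← ha, T.map_eq_eqToHom rfl _ rfl rfl]
      exact Category.comp_id a) (by rw [← hb, Category.comp_id])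
  refine ⟨k, hk, e.trans ?_⟩
  rw [map_append_id, Category.comp_id]

/-- Stability of display of telescopes, and of interleaving. -/
theorem exists_isSub_displ (m : Mor Θ' Θ) {Φ' : Tel Θ'.ext} {Φ : Tel Θ.ext} {l : Φ'.ext ⟶ Φ.ext}
    (hl : IsSub m.hom Φ' Φ l) : ∃ q, IsSub (T.morExt m hl) (T.displ Θ' Φ') (T.displ Θ Φ) q ∧
      T.compar Θ' Φ' ≫ q = T.map (m.append hl) ≫ T.compar Θ Φ := by
  obtain ⟨q, hq, e⟩ : ∃ q, IsSub (T.morExt m hl) (T.displ Θ' Φ') (T.displ Θ Φ) q ∧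
      q ≫ T.inter Θ Φ = T.inter Θ' Φ' ≫ T.map (m.append hl) :=
    T.exists_isSub_odd m hl (T.morExt m hl) (Φ'.lift_proj (T.evens Θ'))
      (Φ.lift_proj (T.evens Θ)) (T.morExt_proj m hl).symm (T.morExt_lift m hl).symm
  refine ⟨q, hq, ?_⟩
  rw [← cancel_mono (T.inter Θ Φ), Category.assoc, e, compar_inter_assoc, Category.assoc,
    compar_inter, Category.comp_id]

/-- Display of partial substitutions: décalage of `t`, as a section of `(Θ ∣ Φ) ⟶ Θ`, lands in
`(Θ ∣ Φ)^D`, and the comparison map extracts the odd entries. -/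
noncomputable def displTm (Θ : Tel (M.L.obj Γ)) (Φ : Tel Θ.ext) (t : Φ.Sec) :
    (T.D Θ).ext ⟶ (T.displ Θ Φ).ext := ((T.dec Γ).map (Sec.toHom Θ t)).hom ≫ T.compar Θ Φ

theorem displTm_comp (m : Mor Θ' Θ) {Φ' : Tel Θ'.ext} {Φ : Tel Θ.ext} {l : Φ'.ext ⟶ Φ.ext}
    (hl : IsSub m.hom Φ' Φ l) {t' : Φ'.Sec} {t : Φ.Sec} (ht : t'.hom ≫ l = m.hom ≫ t.hom)
    {q : (T.displ Θ' Φ').ext ⟶ (T.displ Θ Φ).ext}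
    (hq : IsSub (T.morExt m hl) (T.displ Θ' Φ') (T.displ Θ Φ) q) :
    T.displTm Θ' Φ' t' ≫ q = T.map m ≫ T.displTm Θ Φ t := by
  obtain ⟨q', hq', e⟩ := T.exists_isSub_displ m hl
  obtain rfl : q' = q := (hq'.liftTo_eq hq'.eq_sub).symm.trans (hq.liftTo_eq hq'.eq_sub)
  rw [displTm, displTm, Category.assoc, e, ← T.map_ofHom, ← T.map_ofHom, ← Category.assoc,
    ← Category.assoc, ← T.map_comp, ← T.map_comp]
  congr 2
  exact Mor.ext ((Category.id_comp _).trans (Category.comp_id _).symm) ht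

theorem mapExt_eq {Θ' Θ : Tel (M.L.obj Γ)} (f : Θ' ⟶ Θ) (Φ : Tel Θ.ext) :
    T.mapExt f Φ = T.morExt (.ofHom f) (isSub_lift Φ f.hom) := by
  refine into_ext _ _ ?_ ?_
  · rw [T.morExt_proj, DecFunctor.mapExt, into_proj, T.map_ofHom]
  · rw [T.morExt_lift, DecFunctor.mapExt, into_lift]

theorem baseExt_eq (τ : Γ' ⟶ Γ) (Θ : Tel (M.L.obj Γ)) (Φ : Tel Θ.ext) :
    T.baseExt τ Θ Φ = T.morExt (.ofSub τ Θ) (isSub_lift Φ _) := by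
  refine into_ext _ _ ?_ ?_
  · rw [T.morExt_proj, DecFunctor.baseExt, into_proj, T.map_ofSub]
  · rw [T.morExt_lift, DecFunctor.baseExt, into_lift]

theorem displ_map {Θ' Θ : Tel (M.L.obj Γ)} (f : Θ' ⟶ Θ) (Φ : Tel Θ.ext) :
    T.displ Θ' (Φ.sub f.hom) = (T.displ Θ Φ).sub (T.mapExt f Φ) := by
  obtain ⟨q, hq, -⟩ := T.exists_isSub_displ (.ofHom f) (isSub_lift Φ f.hom)
  rw [mapExt_eq, hq.eq_sub]

theorem displ_sub (τ : Γ' ⟶ Γ) (Θ : Tel (M.L.obj Γ)) (Φ : Tel Θ.ext) :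
    T.displ (Θ.sub (M.L.map τ)) (Φ.sub (Θ.lift (M.L.map τ))) =
      (T.displ Θ Φ).sub (T.baseExt τ Θ Φ) := by
  obtain ⟨q, hq, -⟩ := T.exists_isSub_displ (.ofSub τ Θ) (isSub_lift Φ _)
  rw [baseExt_eq, hq.eq_sub]

theorem displTm_proj (Θ : Tel (M.L.obj Γ)) (Φ : Tel Θ.ext) (t : Φ.Sec) :
    T.displTm Θ Φ t ≫ (T.displ Θ Φ).proj = (t.sub (T.evens Θ)).hom := by
  refine into_ext _ _ ?_ ?_
  · rw [displTm, Category.assoc, Category.assoc, compar_proj, (t.sub _).w, DecFunctor.wk,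
      ← comp_hom, ← CategoryTheory.Functor.map_comp]
    have : Sec.toHom Θ t ≫ wkHom Θ Φ = 𝟙 Θ := hom_ext t.w
    rw [this, CategoryTheory.Functor.map_id, id_hom]
  · rw [displTm, Category.assoc, Category.assoc, compar_lift, T.map_evens, t.sub_lift]

/-- The action on all telescopes that extends the type display. -/
noncomputable abbrev action : DispAction (TelClass.all (M := M)) where
  toDecFunctor := T.toDecFunctor
  disp Θ Φ _ := T.displ Θ Φ
  disp_map f Φ _ := T.displ_map f Φ
  disp_sub τ Θ Φ _ := T.displ_sub τ Θ Φ
  dispTm Θ Φ _ t := T.displTm Θ Φ t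
  dispTm_proj Θ Φ _ t := T.displTm_proj Θ Φ t
  dispTm_map f Φ _ t := by
    rw [← T.map_ofHom]
    exact T.displTm_comp (.ofHom f) (isSub_lift Φ f.hom) (t.sub_lift f.hom)
      ((isSub_liftTo (T.displ_map f Φ)).congr (T.mapExt_eq f Φ).symm rfl)
  dispTm_sub τ Θ Φ _ t := by
    rw [← T.map_ofSub]
    exact T.displTm_comp (.ofSub τ Θ) (isSub_lift Φ _) (t.sub_lift _)
      ((isSub_liftTo (T.displ_sub τ Θ Φ)).congr (T.baseExt_eq τ Θ Φ).symm rfl)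

/-- The variable of `Φ`, as a section over `(Θ ∣ Φ)`, composes to the identity with the canonical
map along which `Φ` is weakened. -/
theorem dec_toHom_var_comp (Θ : Tel (M.L.obj Γ)) (Φ : Tel Θ.ext) :
    ((T.dec Γ).map (Sec.toHom (Θ.append Φ) (Sec.var Φ))).hom ≫
      T.map ((Mor.ofHom (wkHom Θ Φ)).append (isSub_lift Φ Φ.proj)) = 𝟙 _ := by
  rw [← T.map_ofHom, ← T.map_comp]
  exact T.map_eq_eqToHom rfl _ (Category.comp_id _) (into_lift ..)

/-- The comparison map of the action, defined by display of the variable, is the inverse of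
interleaving. -/
theorem comparison_action (Θ : Tel (M.L.obj Γ)) (Φ : Tel Θ.ext) :
    T.action.comparison Θ Φ (TelClass.mem_all Φ) = T.compar Θ Φ := by
  obtain ⟨q, hq, e⟩ := T.exists_isSub_displ (.ofHom (wkHom Θ Φ)) (isSub_lift Φ Φ.proj)
  have hq' : liftTo (T.displ_map (wkHom Θ Φ) Φ) = q :=
    (hq.congr (T.mapExt_eq (wkHom Θ Φ) Φ) rfl).liftTo_eq _
  change (((T.dec Γ).map (Sec.toHom (Θ.append Φ) (Sec.var Φ))).hom ≫
    T.compar (Θ.append Φ) (Φ.sub Φ.proj)) ≫ liftTo (T.displ_map (wkHom Θ Φ) Φ) = _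
  rw [hq', Category.assoc, e, ← Category.assoc, dec_toHom_var_comp, Category.id_comp]

/-- The pseudo morphism `(-)^d` generated by a type display. -/
noncomputable abbrev pseudo : PseudoDisplay M where
  toDispAction := T.action
  isIso_comparison Θ Φ := by
    rw [comparison_action]
    exact ⟨T.inter Θ Φ, T.compar_inter Θ Φ, T.inter_compar Θ Φ⟩

theorem interleave_pseudo (Θ : Tel (M.L.obj Γ)) (Φ : Tel Θ.ext) :
    T.pseudo.interleave Θ Φ = T.inter Θ Φ := by
  have := T.pseudo.isIso_comparison Θ Φ
  exact IsIso.inv_eq_of_hom_inv_id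
    ((congrArg (· ≫ T.inter Θ Φ) (T.comparison_action Θ Φ)).trans (T.compar_inter Θ Φ))

end TypeDisplay

/-! ### Display of concatenations -/

namespace TypeDisplay

variable (T : TypeDisplay M) {Γ Γ' : M.Ctx .sm} {Θ' : Tel (M.L.obj Γ')} {Θ : Tel (M.L.obj Γ)}

/-- The display of `(Υ ∣ Φ)` is the concatenation of the displays, and interleaving at `(Υ ∣ Φ)` is
interleaving at `Φ` over the interleaving at `Υ`. -/
theorem exists_isSub_sigma (Θ : Tel (M.L.obj Γ)) (Υ : Tel Θ.ext) (Φ : Tel Υ.ext) :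
    ∃ k, IsSub (𝟙 _) (T.displ Θ (Υ.append Φ)) (T.pseudo.sigma Θ Υ Φ) k ∧
      k ≫ (T.displ (Θ.append Υ) Φ).lift (T.pseudo.interleave₁ Θ Υ Φ) ≫ T.inter (Θ.append Υ) Φ =
        T.inter Θ (Υ.append Φ) ≫ T.map (.assoc Θ Υ Φ) := by
  let r : ((Υ.append Φ).sub (T.evens Θ)).ext ⟶ (Υ.sub (T.evens Θ)).ext :=
    T.pseudo.restrict₁ Θ Υ Φ
  let i : ((T.displ Θ Υ).sub r).ext ⟶ (Φ.sub (T.evens (Θ.append Υ))).ext :=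
    T.pseudo.interleave₁ Θ Υ Φ
  have hr : r ≫ (Υ.sub (T.evens Θ)).proj = ((Υ.append Φ).sub (T.evens Θ)).proj := into_proj ..
  have hr' : r ≫ Υ.lift (T.evens Θ) = (Υ.append Φ).lift (T.evens Θ) ≫ Φ.proj := into_lift ..
  have hi : i ≫ (Φ.sub (T.evens (Θ.append Υ))).proj =
      (T.displ Θ Υ).lift r ≫ T.inter Θ Υ := by
    rw [← interleave_pseudo]
    exact into_proj ..
  have hi' : i ≫ Φ.lift (T.evens (Θ.append Υ)) =
      ((T.displ Θ Υ).sub r).proj ≫ (Υ.append Φ).lift (T.evens Θ) := into_lift ..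
  have h₁ : ((Υ.append Φ).lift (T.evens Θ) ≫ Φ.proj) ≫ Υ.proj =
      ((Υ.append Φ).sub (T.evens Θ)).proj ≫ T.evens Θ := by
    rw [Category.assoc, ← append_proj, lift_proj]
  -- the odd part of `Υ` over the generic context of `(Υ ∣ Φ)`, which is the display of `Υ`
  -- restricted to that context
  let o := T.odd Θ Υ ((Υ.append Φ).sub (T.evens Θ)).proj _ h₁
  have h₂ : (o.tel.proj ≫ (Υ.append Φ).lift (T.evens Θ)) ≫ Φ.proj =
      o.lift ≫ T.evens (Θ.append Υ) := by
    rw [o.lift_evens, Category.assoc]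
  obtain ⟨k, hk, e⟩ := T.exists_isSub_odd_append Θ Υ Φ ((Υ.append Φ).lift_proj (T.evens Θ)) h₁ h₂
    rfl rfl
  obtain ⟨k₁, hk₁, e₁⟩ := T.exists_isSub_odd_displ Θ Υ r h₁ hr.symm hr'.symm
  obtain ⟨x, hx, ex⟩ := (isSub_lift (T.displ Θ Υ) r).exists_factor hk₁ (Category.id_comp r).symm
  obtain ⟨k₂, hk₂, e₂⟩ := T.exists_isSub_odd_displ (Θ.append Υ) Φ (x ≫ i) h₂
    (by rw [Category.assoc, hi, ← Category.assoc, ex, e₁])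
    (by rw [Category.assoc, hi', ← Category.assoc, hx.w, Category.comp_id])
  obtain ⟨y, hy, ey⟩ := (isSub_lift (T.displ (Θ.append Υ) Φ) i).exists_factor hk₂ rfl
  refine ⟨k ≫ y, (hk.comp (hx.append hy)).congr (Category.comp_id _).symm rfl, ?_⟩
  have e₃ : y ≫ (T.displ (Θ.append Υ) Φ).lift i ≫ T.inter (Θ.append Υ) Φ =
      (T.odd (Θ.append Υ) Φ o.lift _ h₂).lift := by rw [← Category.assoc, ey, e₂]
  exact (Category.assoc k y _).trans ((congrArg (k ≫ ·) e₃).trans e)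

theorem displ_append (Θ : Tel (M.L.obj Γ)) (Υ : Tel Θ.ext) (Φ : Tel Υ.ext) :
    T.displ Θ (Υ.append Φ) = T.pseudo.sigma Θ Υ Φ := by
  obtain ⟨k, hk, -⟩ := T.exists_isSub_sigma Θ Υ Φ
  exact hk.eq

theorem sigmaSnd_inter (Θ : Tel (M.L.obj Γ)) (Υ : Tel Θ.ext) (Φ : Tel Υ.ext) :
    T.pseudo.sigmaSnd (T.displ_append Θ Υ Φ) ≫ T.inter (Θ.append Υ) Φ =
      T.inter Θ (Υ.append Φ) ≫ T.map (.assoc Θ Υ Φ) := by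
  obtain ⟨k, hk, e⟩ := T.exists_isSub_sigma Θ Υ Φ
  rw [← e, PseudoDisplay.sigmaSnd, hk.eqToHom_eq (T.displ_append Θ Υ Φ)]
  exact Category.assoc k _ _

theorem compar_sigmaSnd (Θ : Tel (M.L.obj Γ)) (Υ : Tel Θ.ext) (Φ : Tel Υ.ext) :
    T.compar Θ (Υ.append Φ) ≫ T.pseudo.sigmaSnd (T.displ_append Θ Υ Φ) =
      T.map (.assoc Θ Υ Φ) ≫ T.compar (Θ.append Υ) Φ := by
  rw [← cancel_mono (T.inter (Θ.append Υ) Φ), Category.assoc, sigmaSnd_inter,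
    compar_inter_assoc, Category.assoc, compar_inter, Category.comp_id]

theorem compar_sigmaFst (Θ : Tel (M.L.obj Γ)) (Υ : Tel Θ.ext) (Φ : Tel Υ.ext) :
    T.compar Θ (Υ.append Φ) ≫ T.pseudo.sigmaFst (T.displ_append Θ Υ Φ) =
      T.map (.assoc Θ Υ Φ) ≫ T.wk (Θ.append Υ) Φ ≫ T.compar Θ Υ := by
  have hi : T.pseudo.interleave₁ Θ Υ Φ ≫ (Φ.sub (T.evens (Θ.append Υ))).proj =
      (T.displ Θ Υ).lift (T.pseudo.restrict₁ Θ Υ Φ) ≫ T.inter Θ Υ := by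
    rw [← interleave_pseudo]
    exact into_proj ..
  have h : T.pseudo.sigmaFst (T.displ_append Θ Υ Φ) ≫ T.inter Θ Υ =
      T.pseudo.sigmaSnd (T.displ_append Θ Υ Φ) ≫ (T.displ (Θ.append Υ) Φ).proj ≫
        (Φ.sub (T.evens (Θ.append Υ))).proj := by
    have h₀ : ((T.displ (Θ.append Υ) Φ).sub (T.pseudo.interleave₁ Θ Υ Φ)).proj ≫
        (T.displ Θ Υ).lift (T.pseudo.restrict₁ Θ Υ Φ) ≫ T.inter Θ Υ =
        (T.displ (Θ.append Υ) Φ).lift (T.pseudo.interleave₁ Θ Υ Φ) ≫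
          (T.displ (Θ.append Υ) Φ).proj ≫ (Φ.sub (T.evens (Θ.append Υ))).proj := by
      rw [lift_proj_assoc, hi]
    refine (Category.assoc _ _ _).trans (Eq.trans (congrArg (_ ≫ ·) ?_) (Category.assoc _ _ _).symm)
    exact (Category.assoc _ _ _).trans h₀
  rw [← cancel_mono (T.inter Θ Υ), Category.assoc, h, ← Category.assoc, compar_sigmaSnd,
    Category.assoc, compar_proj, Category.assoc, Category.assoc, compar_inter, Category.comp_id]

/-- The section `[s ∣ t]` is the section `t` followed by the substitution along `s`. -/
theorem map_toHom_pair (Θ : Tel (M.L.obj Γ)) (Υ : Tel Θ.ext) (Φ : Tel Υ.ext) (s : Υ.Sec)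
    (t : (Φ.sub s.hom).Sec) :
    ((T.dec Γ).map (Sec.toHom Θ (Sec.pair s t))).hom ≫ T.map (.assoc Θ Υ Φ) =
      ((T.dec Γ).map (Sec.toHom Θ t)).hom ≫
        T.map ((Mor.ofHom (Sec.toHom Θ s)).append (isSub_lift Φ s.hom)) := by
  rw [← T.map_ofHom, ← T.map_ofHom, ← T.map_comp, ← T.map_comp]
  congr 1
  exact Mor.ext rfl (Category.comp_id _)

theorem displTm_pair_snd (Θ : Tel (M.L.obj Γ)) (Υ : Tel Θ.ext) (Φ : Tel Υ.ext) (s : Υ.Sec)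
    (t : (Φ.sub s.hom).Sec) :
    T.displTm Θ (Υ.append Φ) (Sec.pair s t) ≫ T.pseudo.sigmaSnd (T.displ_append Θ Υ Φ) =
      T.displTm Θ (Φ.sub s.hom) t ≫ liftTo (T.displ_map (Sec.toHom Θ s) Φ) := by
  obtain ⟨q, hq, e⟩ := T.exists_isSub_displ (.ofHom (Sec.toHom Θ s)) (isSub_lift Φ s.hom)
  have hq' : liftTo (T.displ_map (Sec.toHom Θ s) Φ) = q :=
    (hq.congr (T.mapExt_eq (Sec.toHom Θ s) Φ) rfl).liftTo_eq _
  rw [hq', displTm, displTm, Category.assoc, compar_sigmaSnd, Category.assoc, e,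
    ← Category.assoc, map_toHom_pair, Category.assoc]

theorem displTm_pair_fst (Θ : Tel (M.L.obj Γ)) (Υ : Tel Θ.ext) (Φ : Tel Υ.ext) (s : Υ.Sec)
    (t : (Φ.sub s.hom).Sec) :
    T.displTm Θ (Υ.append Φ) (Sec.pair s t) ≫ T.pseudo.sigmaFst (T.displ_append Θ Υ Φ) =
      T.displTm Θ Υ s := by
  rw [displTm, displTm, Category.assoc, compar_sigmaFst, ← Category.assoc, map_toHom_pair,
    Category.assoc, ← Category.assoc (T.map _), T.map_append_wk, ← Category.assoc,
    ← Category.assoc, DecFunctor.wk, T.map_ofHom]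
  congr 1
  have : Sec.toHom Θ t ≫ wkHom Θ (Φ.sub s.hom) = 𝟙 Θ := hom_ext t.w
  rw [← comp_hom, ← CategoryTheory.Functor.map_comp, this, CategoryTheory.Functor.map_id]
  exact Category.id_comp _

end TypeDisplay

/-! ### The tail of the décalage of a concatenation -/

namespace Tel

variable {q : Mode} {Γ Γ' : M.Ctx q}

/-- The length of a list of types. -/
def _root_.DTT.TelTo.length : {Δ : M.Ctx q} → TelTo Γ Δ → ℕ
  | _, .nil => 0
  | _, .snoc Θ _ => TelTo.length Θ + 1

/-- The length of a telescope. -/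
def length (Θ : Tel Γ) : ℕ := Θ.path.length

theorem length_append (Θ : Tel Γ) (Φ : Tel Θ.ext) :
    (Θ.append Φ).length = Θ.length + Φ.length := by
  induction Φ using snoc_induction with
  | nil => rfl
  | snoc Υ A ih => exact congrArg (· + 1) ih

/-- Concatenation is cancellable. Comparison of lengths excludes that one of the telescopes is
empty and the other is not. -/
theorem append_left_cancel {Θ : Tel Γ} {Φ Φ' : Tel Θ.ext} (h : Θ.append Φ = Θ.append Φ') :
    Φ = Φ' := by
  have hl : Φ.length = Φ'.length := by
    have := congrArg length h
    rw [length_append, length_append] at this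
    omega
  induction Φ using snoc_induction generalizing Φ' with
  | nil =>
    cases Φ' using snoc_induction with
    | nil => rfl
    | snoc Υ' A' => exact absurd hl (Nat.succ_ne_zero _).symm
  | snoc Υ A ih =>
    cases Φ' using snoc_induction with
    | nil => exact absurd hl (Nat.succ_ne_zero _)
    | snoc Υ' A' =>
      have h' := Sigma.mk.inj (snoc_injective (Υ := Θ.append Υ) (Υ' := Θ.append Υ') h)
      obtain rfl := ih h'.1 (Nat.succ.inj hl)
      obtain rfl := eq_of_heq h'.2
      rfl

/-- The telescope `(nil ∣ Φ)` is equal to `Φ`, though not definitionally. -/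
theorem isSub_nil_append (Φ : Tel Γ) : IsSub (𝟙 Γ) ((nil Γ).append Φ) Φ (𝟙 Φ.ext) := by
  induction Φ using snoc_induction with
  | nil => exact IsSub.id _
  | snoc Υ A ih => exact ih.snoc_single (IsSub.id _)

end Tel

namespace TypeDisplay

variable (T : TypeDisplay M) {Γ Γ' : M.Ctx .sm} {Θ' : Tel (M.L.obj Γ')} {Θ : Tel (M.L.obj Γ)}

/-- `IsTail Θ Φ Ψ e`: the telescope `(Θ ∣ Φ)^D` is the concatenation of `Θ^D` and `Ψ`, by means of
the map `e` of extended contexts. -/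
def IsTail (Θ : Tel (M.L.obj Γ)) (Φ : Tel Θ.ext) (Ψ : Tel (T.D Θ).ext)
    (e : Ψ.ext ⟶ (T.D (Θ.append Φ)).ext) : Prop :=
  IsSub (𝟙 Γ) ((T.D Θ).append Ψ) (T.D (Θ.append Φ)) e

/-- The part of `(Θ, x : A)^D` that is contributed by `A`: the telescope
`(x : A[evens], x' : A^d)`. -/
noncomputable abbrev entry (Θ : Tel (M.L.obj Γ)) (A : MTy Θ.ext) : Tel (T.D Θ).ext :=
  ((single A).sub (T.evens Θ)).append (T.d₁ Θ A)

variable {T} in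
theorem IsTail.unique {Φ : Tel Θ.ext} {Ψ Ψ' : Tel (T.D Θ).ext}
    {e : Ψ.ext ⟶ (T.D (Θ.append Φ)).ext} {e' : Ψ'.ext ⟶ (T.D (Θ.append Φ)).ext}
    (h : T.IsTail Θ Φ Ψ e) (h' : T.IsTail Θ Φ Ψ' e') : Ψ = Ψ' :=
  append_left_cancel (IsSub.unique h h')

variable {T} in
theorem IsTail.unique_hom {Φ : Tel Θ.ext} {Ψ : Tel (T.D Θ).ext}
    {e e' : Ψ.ext ⟶ (T.D (Θ.append Φ)).ext}
    (h : T.IsTail Θ Φ Ψ e) (h' : T.IsTail Θ Φ Ψ e') : e = e' :=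
  (IsSub.liftTo_eq h h.eq_sub).symm.trans (IsSub.liftTo_eq h' h.eq_sub)

theorem isTail_nil (Θ : Tel (M.L.obj Γ)) : T.IsTail Θ (nil Θ.ext) (nil (T.D Θ).ext) (𝟙 _) :=
  IsSub.id (T.D Θ)

variable {T} in
theorem IsTail.snoc {Υ : Tel Θ.ext} {A : MTy Υ.ext} {Ψ : Tel (T.D Θ).ext}
    {e : Ψ.ext ⟶ (T.D (Θ.append Υ)).ext} (h : T.IsTail Θ Υ Ψ e) {Q : Tel Ψ.ext}
    {k : Q.ext ⟶ (T.entry (Θ.append Υ) A).ext} (hk : IsSub e Q (T.entry (Θ.append Υ) A) k) :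
    T.IsTail Θ (Υ.snoc A) (Ψ.append Q) (k ≫ T.joinSnoc Θ Υ A) := by
  have h₁ : IsSub (𝟙 Γ) ((T.D Θ).append (Ψ.append Q)) (((T.D Θ).append Ψ).append Q) (𝟙 _) :=
    isSub_eqToHom (append_assoc (T.D Θ) Ψ Q).symm
  have h₂ : IsSub (𝟙 Γ) (((T.D Θ).append Ψ).append Q)
    ((T.D (Θ.append Υ)).append (T.entry (Θ.append Υ) A)) k := IsSub.append h hk
  have h₃ : IsSub (𝟙 Γ) ((T.D (Θ.append Υ)).append (T.entry (Θ.append Υ) A))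
    (((T.D (Θ.append Υ)).append ((single A).sub (T.evens (Θ.append Υ)))).append
      (T.d₁ (Θ.append Υ) A)) (𝟙 _) := isSub_eqToHom (append_assoc _ _ _).symm
  have h₄ : IsSub (𝟙 Γ) (((T.D (Θ.append Υ)).append ((single A).sub (T.evens (Θ.append Υ)))).append
      (T.d₁ (Θ.append Υ) A)) (T.D (Θ.append (Υ.snoc A))) (T.joinSnoc Θ Υ A) :=
    isSub_eqToHom (T.dec_snoc (Θ.append Υ) A).symm
  refine (((h₁.comp h₂).comp h₃).comp h₄).congr (by simp) ?_
  refine congrArg (· ≫ T.joinSnoc Θ Υ A) ?_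
  exact ((Category.comp_id _).trans (Category.id_comp k)).symm

theorem exists_isTail (Θ : Tel (M.L.obj Γ)) (Φ : Tel Θ.ext) : ∃ Ψ e, T.IsTail Θ Φ Ψ e := by
  induction Φ using snoc_induction with
  | nil => exact ⟨_, _, T.isTail_nil Θ⟩
  | snoc Υ A ih =>
    obtain ⟨Ψ, e, h⟩ := ih
    exact ⟨_, _, h.snoc (isSub_lift (T.entry (Θ.append Υ) A) e)⟩

variable {T} in
theorem IsTail.wk {Φ : Tel Θ.ext} {Ψ : Tel (T.D Θ).ext}
    {e : Ψ.ext ⟶ (T.D (Θ.append Φ)).ext} (h : T.IsTail Θ Φ Ψ e) : e ≫ T.wk Θ Φ = Ψ.proj := by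
  induction Φ using snoc_induction generalizing Ψ with
  | nil =>
    obtain rfl := h.unique (T.isTail_nil Θ)
    obtain rfl := h.unique_hom (T.isTail_nil Θ)
    exact (Category.id_comp _).trans (T.wk_nil Θ)
  | snoc Υ A ih =>
    obtain ⟨Ψ₀, e₀, h₀⟩ := T.exists_isTail Θ Υ
    have hk := isSub_lift (T.entry (Θ.append Υ) A) e₀
    obtain rfl := h.unique (h₀.snoc hk)
    obtain rfl := h.unique_hom (h₀.snoc hk)
    refine (Category.assoc _ _ _).trans ?_
    rw [← T.wkSnoc_wk, ← Category.assoc (T.joinSnoc Θ Υ A), T.joinSnoc_wkSnoc, ← append_proj,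
      hk.w_assoc, ih h₀, append_proj]

/-- Tails are stable under morphisms. -/
theorem exists_isSub_isTail (m : Mor Θ' Θ) {Φ' : Tel Θ'.ext} {Φ : Tel Θ.ext}
    {l : Φ'.ext ⟶ Φ.ext} (hl : IsSub m.hom Φ' Φ l) {Ψ' : Tel (T.D Θ').ext}
    {e' : Ψ'.ext ⟶ (T.D (Θ'.append Φ')).ext} (h' : T.IsTail Θ' Φ' Ψ' e')
    {Ψ : Tel (T.D Θ).ext} {e : Ψ.ext ⟶ (T.D (Θ.append Φ)).ext} (h : T.IsTail Θ Φ Ψ e) :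
    ∃ k, IsSub (T.map m) Ψ' Ψ k ∧ k ≫ e = e' ≫ T.map (m.append hl) := by
  cases hl
  induction Φ using snoc_induction generalizing Ψ Ψ' with
  | nil =>
    obtain rfl := h.unique (T.isTail_nil Θ)
    obtain rfl := h.unique_hom (T.isTail_nil Θ)
    obtain rfl := h'.unique (T.isTail_nil Θ')
    obtain rfl := h'.unique_hom (T.isTail_nil Θ')
    exact ⟨_, isSub_nil _, (Category.comp_id _).trans (Category.id_comp _).symm⟩
  | snoc Υ A ih =>
    have hA : IsSub (Υ.lift m.hom) (single (A.sub (Υ.lift m.hom))) (single A) _ :=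
      isSub_lift (single A) _
    obtain ⟨Ψ₀, e₀, h₀⟩ := T.exists_isTail Θ Υ
    obtain ⟨Ψ₀', e₀', h₀'⟩ := T.exists_isTail Θ' (Υ.sub m.hom)
    have hk := isSub_lift (T.entry (Θ.append Υ) A) e₀
    have hk' := isSub_lift (T.entry (Θ'.append (Υ.sub m.hom)) (A.sub (Υ.lift m.hom))) e₀'
    obtain rfl := h.unique (h₀.snoc hk)
    obtain rfl := h.unique_hom (h₀.snoc hk)
    obtain rfl := h'.unique (h₀'.snoc hk')
    obtain rfl := h'.unique_hom (h₀'.snoc hk')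
    obtain ⟨k, hk₀, ek⟩ := ih h₀ h₀'
    obtain ⟨q, hq, eq⟩ := T.exists_isSub_d₁_snoc (m.append (isSub_lift Υ m.hom)) hA
      (m.append (isSub_lift (Υ.snoc A) m.hom)) rfl rfl
    have hE : IsSub (T.map (m.append (isSub_lift Υ m.hom)))
        ((single (A.sub (Υ.lift m.hom))).sub (T.evens (Θ'.append (Υ.sub m.hom))))
        ((single A).sub (T.evens (Θ.append Υ))) (T.morExt (m.append (isSub_lift Υ m.hom)) hA) :=
      (isSub_lift _ _).of_comp ((isSub_lift _ _).comp hA) (T.morExt_proj ..)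
        (T.map_comp_evens (m.append (isSub_lift Υ m.hom))).symm (T.morExt_lift ..)
    obtain ⟨y, hy, ey⟩ := hk.exists_factor (hk'.comp (hE.append hq)) ek.symm
    refine ⟨y, hk₀.append hy, ?_⟩
    refine (Category.assoc _ _ _).symm.trans ((congrArg (· ≫ T.joinSnoc Θ Υ A) ey).trans ?_)
    refine (Category.assoc _ _ _).trans ((congrArg (_ ≫ ·) eq).trans (Category.assoc _ _ _).symm)

end TypeDisplay

/-! ### Décalage of dependent telescopes -/

namespace TypeDisplay

variable (T : TypeDisplay M) {Γ Γ' : M.Ctx .sm} {Θ' : Tel (M.L.obj Γ')} {Θ : Tel (M.L.obj Γ)}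

/-- Décalage of dependent telescopes: the tail of the décalage of the concatenation. -/
noncomputable def decTy (Θ : Tel (M.L.obj Γ)) (Φ : Tel Θ.ext) : Tel (T.D Θ).ext :=
  (T.exists_isTail Θ Φ).choose

theorem dec_append (Θ : Tel (M.L.obj Γ)) (Φ : Tel Θ.ext) :
    T.D (Θ.append Φ) = (T.D Θ).append (T.decTy Θ Φ) :=
  (T.exists_isTail Θ Φ).choose_spec.choose_spec.eq.symm

/-- The identification of `(Θ^D ∣ Φ^D)` with `(Θ ∣ Φ)^D`. -/
noncomputable def joinTail (Θ : Tel (M.L.obj Γ)) (Φ : Tel Θ.ext) :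
    (T.decTy Θ Φ).ext ⟶ (T.D (Θ.append Φ)).ext :=
  eqToHom (congrArg Tel.ext (T.dec_append Θ Φ)).symm

/-- The identification of `(Θ ∣ Φ)^D` with `(Θ^D ∣ Φ^D)`. -/
noncomputable def splitTail (Θ : Tel (M.L.obj Γ)) (Φ : Tel Θ.ext) :
    (T.D (Θ.append Φ)).ext ⟶ (T.decTy Θ Φ).ext :=
  eqToHom (congrArg Tel.ext (T.dec_append Θ Φ))

theorem joinTail_splitTail (Θ : Tel (M.L.obj Γ)) (Φ : Tel Θ.ext) :
    T.joinTail Θ Φ ≫ T.splitTail Θ Φ = 𝟙 _ := eqToHom_trans _ _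

theorem splitTail_joinTail (Θ : Tel (M.L.obj Γ)) (Φ : Tel Θ.ext) :
    T.splitTail Θ Φ ≫ T.joinTail Θ Φ = 𝟙 _ := eqToHom_trans _ _

instance (Θ : Tel (M.L.obj Γ)) (Φ : Tel Θ.ext) : IsIso (T.joinTail Θ Φ) :=
  ⟨_, T.joinTail_splitTail Θ Φ, T.splitTail_joinTail Θ Φ⟩

theorem isTail_decTy (Θ : Tel (M.L.obj Γ)) (Φ : Tel Θ.ext) :
    T.IsTail Θ Φ (T.decTy Θ Φ) (T.joinTail Θ Φ) :=
  isSub_eqToHom (T.dec_append Θ Φ).symm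

theorem joinTail_wk (Θ : Tel (M.L.obj Γ)) (Φ : Tel Θ.ext) :
    T.joinTail Θ Φ ≫ T.wk Θ Φ = (T.decTy Θ Φ).proj := (T.isTail_decTy Θ Φ).wk

theorem splitTail_proj (Θ : Tel (M.L.obj Γ)) (Φ : Tel Θ.ext) :
    T.splitTail Θ Φ ≫ (T.decTy Θ Φ).proj = T.wk Θ Φ := by
  rw [← joinTail_wk, ← Category.assoc, splitTail_joinTail, Category.id_comp]

theorem exists_isSub_decTy (m : Mor Θ' Θ) {Φ' : Tel Θ'.ext} {Φ : Tel Θ.ext}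
    {l : Φ'.ext ⟶ Φ.ext} (hl : IsSub m.hom Φ' Φ l) :
    ∃ k, IsSub (T.map m) (T.decTy Θ' Φ') (T.decTy Θ Φ) k ∧
      T.splitTail Θ' Φ' ≫ k = T.map (m.append hl) ≫ T.splitTail Θ Φ := by
  obtain ⟨k, hk, e⟩ := T.exists_isSub_isTail m hl (T.isTail_decTy Θ' Φ') (T.isTail_decTy Θ Φ)
  refine ⟨k, hk, ?_⟩
  rw [← cancel_mono (T.joinTail Θ Φ), Category.assoc, e, ← Category.assoc, splitTail_joinTail,
    Category.id_comp, Category.assoc, splitTail_joinTail, Category.comp_id]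

theorem decTy_map {Θ' Θ : Tel (M.L.obj Γ)} (f : Θ' ⟶ Θ) (Φ : Tel Θ.ext) :
    T.decTy Θ' (Φ.sub f.hom) = (T.decTy Θ Φ).sub ((T.dec Γ).map f).hom := by
  obtain ⟨k, hk, -⟩ := T.exists_isSub_decTy (.ofHom f) (isSub_lift Φ f.hom)
  rw [hk.eq_sub, T.map_ofHom]

theorem decTy_sub (τ : Γ' ⟶ Γ) (Θ : Tel (M.L.obj Γ)) (Φ : Tel Θ.ext) :
    T.decTy (Θ.sub (M.L.map τ)) (Φ.sub (Θ.lift (M.L.map τ))) =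
      (T.decTy Θ Φ).sub (liftTo (T.dec_sub τ Θ)) := by
  obtain ⟨k, hk, -⟩ := T.exists_isSub_decTy (.ofSub τ Θ) (isSub_lift Φ _)
  rw [hk.eq_sub, T.map_ofSub]

theorem dec_toHom_wk (Θ : Tel (M.L.obj Γ)) {Φ : Tel Θ.ext} (t : Φ.Sec) :
    ((T.dec Γ).map (Sec.toHom Θ t)).hom ≫ T.wk Θ Φ = 𝟙 _ := by
  have : Sec.toHom Θ t ≫ wkHom Θ Φ = 𝟙 Θ := hom_ext t.w
  rw [DecFunctor.wk, ← comp_hom, ← CategoryTheory.Functor.map_comp, this,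
    CategoryTheory.Functor.map_id, id_hom]

/-- Décalage of dependent partial substitutions: that of the corresponding section. -/
noncomputable def decTm (Θ : Tel (M.L.obj Γ)) (Φ : Tel Θ.ext) (t : Φ.Sec) : (T.decTy Θ Φ).Sec where
  hom := ((T.dec Γ).map (Sec.toHom Θ t)).hom ≫ T.splitTail Θ Φ
  w := by rw [Category.assoc, splitTail_proj, dec_toHom_wk]

theorem decTm_hom (Θ : Tel (M.L.obj Γ)) (Φ : Tel Θ.ext) (t : Φ.Sec) :
    (T.decTm Θ Φ t).hom = ((T.dec Γ).map (Sec.toHom Θ t)).hom ≫ T.splitTail Θ Φ := rfl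

theorem decTm_comp (m : Mor Θ' Θ) {Φ' : Tel Θ'.ext} {Φ : Tel Θ.ext} {l : Φ'.ext ⟶ Φ.ext}
    (hl : IsSub m.hom Φ' Φ l) {t' : Φ'.Sec} {t : Φ.Sec} (ht : t'.hom ≫ l = m.hom ≫ t.hom)
    {q : (T.decTy Θ' Φ').ext ⟶ (T.decTy Θ Φ).ext}
    (hq : IsSub (T.map m) (T.decTy Θ' Φ') (T.decTy Θ Φ) q) :
    (T.decTm Θ' Φ' t').hom ≫ q = T.map m ≫ (T.decTm Θ Φ t).hom := by
  obtain ⟨q', hq', e⟩ := T.exists_isSub_decTy m hl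
  obtain rfl : q' = q := (hq'.liftTo_eq hq'.eq_sub).symm.trans (hq.liftTo_eq hq'.eq_sub)
  rw [decTm_hom, decTm_hom, Category.assoc, e, ← T.map_ofHom, ← T.map_ofHom, ← Category.assoc,
    ← Category.assoc, ← T.map_comp, ← T.map_comp]
  congr 2
  exact Mor.ext ((Category.id_comp _).trans (Category.comp_id _).symm) ht

/-- The strict morphism `(-)^D` generated by a type display. -/
noncomputable abbrev depDec : DepDecalage T.toDecFunctor where
  decTy Θ Φ := T.decTy Θ Φ
  decTy_map f Φ := T.decTy_map f Φ
  decTy_sub τ Θ Φ := T.decTy_sub τ Θ Φ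
  decTm Θ Φ t := T.decTm Θ Φ t
  decTm_map f Φ t := by
    refine (T.decTm_comp (.ofHom f) (isSub_lift Φ f.hom) (t.sub_lift f.hom)
      ((isSub_liftTo (T.decTy_map f Φ)).congr (T.map_ofHom f) rfl)).trans ?_
    exact congrArg (· ≫ (T.decTm _ Φ t).hom) (T.map_ofHom f)
  decTm_sub τ Θ Φ t := by
    refine (T.decTm_comp (.ofSub τ Θ) (isSub_lift Φ _) (t.sub_lift _)
      ((isSub_liftTo (T.decTy_sub τ Θ Φ)).congr (T.map_ofSub τ Θ) rfl)).trans ?_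
    exact congrArg (· ≫ (T.decTm Θ Φ t).hom) (T.map_ofSub τ Θ)
  dec_append Θ Φ := T.dec_append Θ Φ
  comparison_eq Θ Φ := by
    obtain ⟨q, hq, e⟩ := T.exists_isSub_decTy (.ofHom (wkHom Θ Φ)) (isSub_lift Φ Φ.proj)
    have hq' : liftTo (T.decTy_map (wkHom Θ Φ) Φ) = q :=
      (hq.congr (T.map_ofHom (wkHom Θ Φ)).symm rfl).liftTo_eq _
    rw [hq', decTm_hom, Category.assoc, e, ← Category.assoc, dec_toHom_var_comp]
    exact Category.id_comp _

theorem displ_nil (Θ : Tel (M.L.obj Γ)) :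
    T.displ Θ (nil Θ.ext) = nil ((nil Θ.ext).sub (T.evens Θ)).ext := rfl

/-- The isomorphism `Φ^D ≅ (Φ[evens] ∣ Φ^d)` given by evens and odds, with interleaving as its
inverse. -/
noncomputable def evOd (Θ : Tel (M.L.obj Γ)) (Φ : Tel Θ.ext) :
    T.decTy Θ Φ ≅ (Φ.sub (T.evens Θ)).append (T.displ Θ Φ) where
  hom := ⟨T.joinTail Θ Φ ≫ T.compar Θ Φ, by
    rw [append_proj, Category.assoc, compar_proj, joinTail_wk]⟩
  inv := ⟨T.inter Θ Φ ≫ T.splitTail Θ Φ, by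
    rw [append_proj, Category.assoc, splitTail_proj, inter_wk]⟩
  hom_inv_id := by
    ext
    rw [comp_hom, Category.assoc, compar_inter_assoc, joinTail_splitTail, id_hom]
  inv_hom_id := by
    ext
    rw [comp_hom, Category.assoc, ← Category.assoc (T.splitTail Θ Φ), splitTail_joinTail,
      Category.id_comp, inter_compar, id_hom]

/-- The telescope display generated by a type display. -/
noncomputable abbrev telescope : TelescopeDisplay M where
  toPseudoDisplay := T.pseudo
  disp_nil Θ := T.displ_nil Θ
  disp_append Θ Υ Φ := T.displ_append Θ Υ Φ
  dispTm_pair_fst Θ Υ Φ s t := T.displTm_pair_fst Θ Υ Φ s t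
  dispTm_pair_snd Θ Υ Φ s t := T.displTm_pair_snd Θ Υ Φ s t
  depDec := T.depDec
  evOd Θ Φ := T.evOd Θ Φ
  evOd_comparison Θ Φ := by
    rw [comparison_action]
    refine (Category.assoc _ _ _).symm.trans ?_
    refine (congrArg (· ≫ T.compar Θ Φ) (T.splitTail_joinTail Θ Φ)).trans ?_
    exact Category.id_comp _

/-- On telescopes of length one, the display agrees with the given one. The recursion yields the
given display preceded by the empty telescope. -/
theorem exists_isSub_single (Θ : Tel (M.L.obj Γ)) (A : MTy Θ.ext) :
    ∃ e, IsSub (𝟙 _) (T.displ Θ (single A)) (T.d₁ Θ A) e ∧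
      e ≫ T.join Θ A = T.inter Θ (single A) := by
  let b : ((single A).sub (T.evens Θ)).ext ⟶ ((nil Θ.ext).snoc A).ext :=
    (single A).lift (T.evens Θ)
  have h : (b ≫ (single A).proj) ≫ (nil Θ.ext).proj =
      ((single A).sub (T.evens Θ)).proj ≫ T.evens Θ :=
    (Category.comp_id _).trans ((single A).lift_proj (T.evens Θ))
  let o : T.Odd Θ (nil Θ.ext) ((single A).sub (T.evens Θ)).proj (b ≫ (single A).proj) :=
    T.odd Θ (nil Θ.ext) _ _ h
  -- over the empty telescope interleaving is trivial, so the last type is displayed in its own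
  -- generic context
  have ho : o.arg = 𝟙 _ := by
    refine into_ext (single A) (T.evens Θ) ?_ ?_
    · exact (o.arg_proj).trans (Category.id_comp _).symm
    · exact o.arg_lift
  refine ⟨(T.d₁ Θ A).lift o.arg, ?_, rfl⟩
  exact ((isSub_nil_append ((T.d₁ Θ A).sub o.arg)).comp (isSub_lift (T.d₁ Θ A) o.arg)).congr
    (by rw [ho]; exact (Category.comp_id _).symm) (Category.id_comp _).symm

end TypeDisplay

/-! ### The complete display generated by a type display -/

namespace DispAction

/-- An action is determined by its underlying functor, its effect on types, and its comparison
maps. -/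
theorem ext_comparison {P : TelClass M} {F G : DispAction P}
    (h : F.toDecFunctor = G.toDecFunctor)
    (hd : ∀ (Γ : M.Ctx .sm) (Θ : Tel (M.L.obj Γ)) (A : Tel Θ.ext) (hA : P.mem A),
      HEq (F.disp Θ A hA) (G.disp Θ A hA))
    (hc : ∀ (Γ : M.Ctx .sm) (Θ : Tel (M.L.obj Γ)) (A : Tel Θ.ext) (hA : P.mem A),
      HEq (F.comparison Θ A hA) (G.comparison Θ A hA)) : F = G := by
  have hF := @F.dispTm_eq
  have hG := @G.dispTm_eq
  obtain ⟨D, disp, _, _, dispTm, _, _, _⟩ := F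
  obtain ⟨D', disp', _, _, dispTm', _, _, _⟩ := G
  cases h
  obtain rfl : @disp = @disp' := by
    funext Γ Θ A hA
    exact eq_of_heq (hd Γ Θ A hA)
  obtain rfl : @dispTm = @dispTm' := by
    funext Γ Θ A hA t
    exact (hF A hA t).trans
      ((congrArg (_ ≫ ·) (eq_of_heq (hc Γ Θ A hA))).trans (hG A hA t).symm)
  rfl

end DispAction

namespace Tel

variable {q : Mode} {Γ : M.Ctx q}

/-- A map with values in a telescope extension is unchanged, up to heterogeneous equality, by a
canonical map over the identity. -/
theorem IsSub.heq_of_comp {Θ Θ' : Tel Γ} {k : Θ.ext ⟶ Θ'.ext} (hk : IsSub (𝟙 Γ) Θ Θ' k)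
    {X : M.Ctx q} {a : X ⟶ Θ.ext} {b : X ⟶ Θ'.ext} (h : a ≫ k = b) : HEq a b := by
  subst h
  cases hk.eq
  obtain rfl : 𝟙 Θ.ext = k := hk.eqToHom_eq rfl
  rw [Category.comp_id]

end Tel

namespace TypeDisplay

variable (T : TypeDisplay M) {Γ : M.Ctx .sm}

theorem exists_isSub_d₁_single (Θ : Tel (M.L.obj Γ)) (A : MTy Θ.ext) :
    ∃ e, IsSub (𝟙 _) (T.displ Θ (single A)) (T.d₁ Θ A) e ∧
      T.compar Θ (single A) ≫ e = T.comparison Θ (single A) (TelClass.len1_single A) := by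
  obtain ⟨e, he, h⟩ := T.exists_isSub_single Θ A
  have h' : T.compar Θ (single A) ≫ e = T.split Θ A := by
    rw [← cancel_mono (T.join Θ A), Category.assoc, h, compar_inter]
    exact (T.split_join Θ A).symm
  exact ⟨e, he, h'.trans (T.comparison_eq_split Θ A).symm⟩

theorem restrict_action : T.action.restrict = T.toDispAction := by
  refine DispAction.ext_comparison rfl ?_ ?_ <;> rintro Γ Θ - ⟨A, rfl⟩ <;>
    obtain ⟨e, he, h⟩ := T.exists_isSub_d₁_single Θ A
  · exact heq_of_eq he.eq
  · exact he.heq_of_comp ((congrArg (· ≫ e) (T.comparison_action Θ (single A))).trans h)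

/-- The telescope `(Φ^D, x : A[evens], x' : A^d)` is the tail of `(Θ ∣ Φ, x : A)^D`, by interleaving
of the last type. -/
theorem isTail_snocTel (Θ : Tel (M.L.obj Γ)) (Φ : Tel Θ.ext) (A : MTy Φ.ext) :
    T.IsTail Θ (Φ.snoc A) ((T.decTy Θ Φ).append (T.telescope.snocTel Θ Φ (single A)))
      ((T.displ (Θ.append Φ) (single A)).lift (T.telescope.snocBase Θ Φ (single A)) ≫
        T.inter (Θ.append Φ) (single A)) := by
  obtain ⟨e, he, h⟩ := T.exists_isSub_single (Θ.append Φ) A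
  have hb : IsSub (T.joinTail Θ Φ) ((single A).sub (T.telescope.depEvens Θ Φ))
      ((single A).sub (T.evens (Θ.append Φ))) (T.telescope.snocBase Θ Φ (single A)) :=
    (isSub_lift (single A) _).of_comp (isSub_lift (single A) _) (into_proj ..) rfl (into_lift ..)
  have hd := ((isSub_lift (T.displ (Θ.append Φ) (single A))
    (T.telescope.snocBase Θ Φ (single A))).comp he).congr (Category.comp_id _).symm rfl
  have := (T.isTail_decTy Θ Φ).snoc (hb.append hd)
  refine IsSub.congr this rfl ?_
  rw [← h]
  exact (Category.assoc _ _ _).symm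

theorem dec_snocTel (Θ : Tel (M.L.obj Γ)) (Φ : Tel Θ.ext) (A : MTy Φ.ext) :
    T.decTy Θ (Φ.append (single A)) =
      (T.decTy Θ Φ).append (T.telescope.snocTel Θ Φ (single A)) :=
  (T.isTail_decTy Θ (Φ.snoc A)).unique (T.isTail_snocTel Θ Φ A)

theorem snocSnd_inter (Θ : Tel (M.L.obj Γ)) (Φ : Tel Θ.ext) (A : MTy Φ.ext) :
    T.telescope.snocSnd (T.dec_snocTel Θ Φ A) ≫ T.inter (Θ.append Φ) (single A) =
      T.joinTail Θ (Φ.append (single A)) := by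
  have h : ∀ {Ψ Ψ' : Tel (T.D Θ).ext} {e : Ψ'.ext ⟶ (T.D (Θ.append (Φ.snoc A))).ext}
      (h : Ψ = Ψ'), T.IsTail Θ (Φ.snoc A) Ψ' e →
        T.IsTail Θ (Φ.snoc A) Ψ (eqToHom (congrArg Tel.ext h) ≫ e) := by
    rintro Ψ _ e rfl h
    rwa [eqToHom_refl, Category.id_comp]
  refine (Category.assoc _ _ _).trans ?_
  exact (h (T.dec_snocTel Θ Φ A) (T.isTail_snocTel Θ Φ A)).unique_hom
    (T.isTail_decTy Θ (Φ.snoc A))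

/-- Two ways to extract the last displayed entry from `(Θ ∣ Φ, x : A)^D`: from the dependent
décalage and from the display of the concatenation. -/
theorem splitTail_snocSnd (Θ : Tel (M.L.obj Γ)) (Φ : Tel Θ.ext) (A : MTy Φ.ext) :
    T.splitTail Θ (Φ.append (single A)) ≫ T.telescope.snocSnd (T.dec_snocTel Θ Φ A) =
      T.compar Θ (Φ.append (single A)) ≫
        T.pseudo.sigmaSnd (T.displ_append Θ Φ (single A)) := by
  have h : T.map (.assoc Θ Φ (single A)) = 𝟙 _ := T.map_eq_eqToHom rfl _ rfl rfl
  rw [← cancel_mono (T.inter (Θ.append Φ) (single A))]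
  refine (Category.assoc _ _ _).trans ?_
  refine (congrArg (_ ≫ ·) (T.snocSnd_inter Θ Φ A)).trans ?_
  refine (T.splitTail_joinTail Θ (Φ.append (single A))).trans ?_
  rw [Category.assoc, sigmaSnd_inter, compar_inter_assoc, h]

theorem decTm_snoc (Θ : Tel (M.L.obj Γ)) (Φ : Tel Θ.ext) (A : MTy Φ.ext) (s : Φ.Sec)
    (t : ((single A).sub s.hom).Sec) :
    (T.decTm Θ (Φ.append (single A)) (Sec.pair s t)).hom ≫
        T.telescope.snocSnd (T.dec_snocTel Θ Φ A) =
      T.displTm Θ ((single A).sub s.hom) t ≫ liftTo (T.displ_map (Sec.toHom Θ s) (single A)) := by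
  rw [← displTm_pair_snd, decTm_hom, displTm, Category.assoc, Category.assoc]
  exact congrArg (_ ≫ ·) (T.splitTail_snocSnd Θ Φ A)

theorem evens_snoc (Θ : Tel (M.L.obj Γ)) (Φ : Tel Θ.ext) (A : MTy Φ.ext) :
    T.telescope.depEvens Θ (Φ.append (single A)) =
      T.telescope.snocFst (T.dec_snocTel Θ Φ A) ≫
        (single A).lift (T.telescope.depEvens Θ Φ) := by
  have h : T.telescope.snocBase Θ Φ (single A) ≫ (single A).lift (T.evens (Θ.append Φ)) =
      (single A).lift (T.telescope.depEvens Θ Φ) := into_lift ..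
  have h' : (T.displ (Θ.append Φ) (single A)).lift (T.telescope.snocBase Θ Φ (single A)) ≫
      T.inter (Θ.append Φ) (single A) ≫ T.evens ((Θ.append Φ).append (single A)) =
      ((T.displ (Θ.append Φ) (single A)).sub (T.telescope.snocBase Θ Φ (single A))).proj ≫
        (single A).lift (T.telescope.depEvens Θ Φ) := by
    rw [T.inter_evens, lift_proj_assoc, h]
  refine (congrArg (· ≫ T.evens (Θ.append (Φ.append (single A))))
    (T.snocSnd_inter Θ Φ A)).symm.trans ?_
  refine (Category.assoc _ _ _).trans ((Category.assoc _ _ _).trans ?_)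
  exact (congrArg (_ ≫ ·) h').trans (Category.assoc _ _ _).symm

theorem odds_snoc (Θ : Tel (M.L.obj Γ)) (Φ : Tel Θ.ext) (A : MTy Φ.ext) :
    (T.evOd Θ (Φ.append (single A))).hom.hom ≫
        T.pseudo.sigmaSnd (T.displ_append Θ Φ (single A)) =
      T.telescope.snocSnd (T.dec_snocTel Θ Φ A) := by
  refine (Category.assoc _ _ _).trans ?_
  refine (congrArg (_ ≫ ·) (T.splitTail_snocSnd Θ Φ A)).symm.trans ?_
  refine (Category.assoc _ _ _).symm.trans ?_
  exact (congrArg (· ≫ _) (T.joinTail_splitTail Θ (Φ.append (single A)))).trans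
    (Category.id_comp _)

/-- The complete display generated by a type display. -/
noncomputable def complete : CompleteDisplay M where
  toTelescopeDisplay := T.telescope
  isTypeDisplay := by
    change T.action.restrict.IsTypeDisplay
    rw [restrict_action]
    exact T.isTypeDisplay
  dec_snoc Θ Φ A := T.dec_snocTel Θ Φ A
  decTm_snoc Θ Φ A s t := T.decTm_snoc Θ Φ A s t
  evens_snoc Θ Φ A := T.evens_snoc Θ Φ A
  odds_snoc Θ Φ A := T.odds_snoc Θ Φ A

theorem toDispAction_injective {T T' : TypeDisplay M} (h : T.toDispAction = T'.toDispAction) :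
    T = T' := by
  cases T
  cases T'
  cases h
  rfl

theorem toTypeDisplay_complete : T.complete.toTypeDisplay = T :=
  toDispAction_injective T.restrict_action

end TypeDisplay

/-! ### Redundancy in the data of a display -/

namespace DepDecalage

variable {F : DecFunctor M} (G : DepDecalage F) {Γ : M.Ctx .sm}

theorem exists_isSub_decTy {Θ' Θ : Tel (M.L.obj Γ)} (f : Θ' ⟶ Θ) {A' : Tel Θ'.ext}
    {A : Tel Θ.ext} {l : A'.ext ⟶ A.ext} (hl : IsSub f.hom A' A l) {t' : A'.Sec} {t : A.Sec}
    (ht : t'.hom ≫ l = f.hom ≫ t.hom) :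
    ∃ q, IsSub ((F.dec Γ).map f).hom (G.decTy Θ' A') (G.decTy Θ A) q ∧
      (G.decTm Θ' A' t').hom ≫ q = ((F.dec Γ).map f).hom ≫ (G.decTm Θ A t).hom := by
  cases hl
  refine ⟨_, isSub_liftTo (G.decTy_map f A), ?_⟩
  rw [Sec.eq_sub_of_comp_lift ht]
  exact G.decTm_map f A t

/-- Décalage of partial substitutions is determined by the underlying functor, as `t` is the
substitution of the variable along its own section. -/
theorem decTm_eq (Θ : Tel (M.L.obj Γ)) (A : Tel Θ.ext) (t : A.Sec) :
    (G.decTm Θ A t).hom = ((F.dec Γ).map (Sec.toHom Θ t)).hom ≫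
      eqToHom (congrArg Tel.ext (G.dec_append Θ A)) := by
  obtain ⟨l, hl, h⟩ := (isSub_lift A A.proj).exists_factor (IsSub.id A) t.w.symm
  obtain ⟨q, hq, e⟩ := G.exists_isSub_decTy (Sec.toHom Θ t) hl (t' := t) (t := Sec.var A) (by
    refine into_ext _ _ ?_ ?_
    · rw [Category.assoc, hl.w, ← Category.assoc, t.w, Category.assoc, (Sec.var A).w,
        Category.id_comp]
      exact (Category.comp_id _).symm
    · rw [Category.assoc, h, Category.assoc, Sec.var, into_lift])
  have ht : ((F.dec Γ).map (Sec.toHom Θ t)).hom ≫ ((F.dec Γ).map (wkHom Θ A)).hom = 𝟙 _ := by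
    have : Sec.toHom Θ t ≫ wkHom Θ A = 𝟙 Θ := hom_ext t.w
    rw [← comp_hom, ← CategoryTheory.Functor.map_comp, this, CategoryTheory.Functor.map_id, id_hom]
  have hq' : q ≫ liftTo (G.decTy_map (wkHom Θ A) A) = 𝟙 _ :=
    (((hq.comp (isSub_liftTo (G.decTy_map (wkHom Θ A) A))).congr ht.symm rfl).eqToHom_eq
      rfl).symm
  have := congrArg (· ≫ liftTo (G.decTy_map (wkHom Θ A) A)) e
  refine ((Category.assoc _ _ _).trans ((congrArg (_ ≫ ·) hq').trans
    (Category.comp_id _))).symm.trans (this.trans ((Category.assoc _ _ _).trans ?_))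
  exact congrArg (_ ≫ ·) (G.comparison_eq Θ A)

/-- An internal functor extends in at most one way to a strict morphism of CwFs. -/
instance : Subsingleton (DepDecalage F) := by
  refine ⟨fun G G' => ?_⟩
  have hG := @G.decTm_eq
  have hG' := @G'.decTm_eq
  obtain ⟨decTy, _, _, decTm, _, _, h, _⟩ := G
  obtain ⟨decTy', _, _, decTm', _, _, h', _⟩ := G'
  obtain rfl : @decTy = @decTy' := by
    funext Γ Θ A
    exact append_left_cancel ((h Θ A).symm.trans (h' Θ A))
  obtain rfl : @decTm = @decTm' := by
    funext Γ Θ A t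
    exact Sec.ext ((hG Θ A t).trans (hG' Θ A t).symm)
  rfl

end DepDecalage

/-- A telescope display is determined by its action on contexts, types and terms. -/
theorem TelescopeDisplay.toDispAction_injective {E E' : TelescopeDisplay M}
    (h : E.toDispAction = E'.toDispAction) : E = E' := by
  have hE := @E.evOd_comparison
  have hE' := @E'.evOd_comparison
  obtain ⟨⟨F, _⟩, _, _, _, _, G, i, _⟩ := E
  obtain ⟨⟨F', _⟩, _, _, _, _, G', i', _⟩ := E'
  cases h
  obtain rfl := Subsingleton.elim G G'
  obtain rfl : @i = @i' := by
    funext Γ Θ Φ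
    refine Iso.ext (hom_ext ?_)
    exact (cancel_epi (eqToHom (congrArg Tel.ext (G.dec_append Θ Φ)))).1
      ((hE Θ Φ).trans (hE' Θ Φ).symm)
  rfl

theorem CompleteDisplay.toTelescopeDisplay_injective {E E' : CompleteDisplay M}
    (h : E.toTelescopeDisplay = E'.toTelescopeDisplay) : E = E' := by
  cases E
  cases E'
  cases h
  rfl

/-! ### Uniqueness -/

namespace Tel

theorem hom_ext_of_eq_nil {q : Mode} {Γ X : M.Ctx q} {Ψ : Tel Γ} (h : Ψ = nil Γ) {a b : X ⟶ Ψ.ext}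
    (hab : a ≫ Ψ.proj = b ≫ Ψ.proj) : a = b := by
  subst h
  exact (Category.comp_id a).symm.trans (hab.trans (Category.comp_id b))

end Tel

/-- A telescope `Δ` that is composed from `Δ₁` and `Δ₂` as the display of `(Υ ∣ Φ)` is composed from
the displays of the parts agrees with that display when `Δ₁` and `Δ₂` agree with the parts. The
hypotheses on `j` say that it interleaves as `interleave₁` does. -/
theorem PseudoDisplay.exists_isSub_disp_append (F : PseudoDisplay M) {Γ : M.Ctx .sm}
    {Θ : Tel (M.L.obj Γ)} {Υ : Tel Θ.ext} {Φ : Tel Υ.ext}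
    (h : F.d Θ (Υ.append Φ) = F.sigma Θ Υ Φ)
    {Δ₁ : Tel (Υ.sub (F.evens Θ)).ext} {k₁ : Δ₁.ext ⟶ (F.d Θ Υ).ext}
    (hk₁ : IsSub (𝟙 _) Δ₁ (F.d Θ Υ) k₁)
    {Δ₂ : Tel (Φ.sub (F.evens (Θ.append Υ))).ext} {k₂ : Δ₂.ext ⟶ (F.d (Θ.append Υ) Φ).ext}
    (hk₂ : IsSub (𝟙 _) Δ₂ (F.d (Θ.append Υ) Φ) k₂)
    {j : (Δ₁.sub (F.restrict₁ Θ Υ Φ)).ext ⟶ (Φ.sub (F.evens (Θ.append Υ))).ext}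
    (hj₁ : j ≫ (Φ.sub (F.evens (Θ.append Υ))).proj =
      Δ₁.lift (F.restrict₁ Θ Υ Φ) ≫ k₁ ≫ F.interleave Θ Υ)
    (hj₂ : j ≫ Φ.lift (F.evens (Θ.append Υ)) =
      (Δ₁.sub (F.restrict₁ Θ Υ Φ)).proj ≫ (Υ.append Φ).lift (F.evens Θ))
    {Δ : Tel ((Υ.append Φ).sub (F.evens Θ)).ext}
    (hΔ : Δ = (Δ₁.sub (F.restrict₁ Θ Υ Φ)).append (Δ₂.sub j)) :
    ∃ k, IsSub (𝟙 _) Δ (F.d Θ (Υ.append Φ)) k ∧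
      k ≫ F.sigmaSnd h = (eqToHom (congrArg Tel.ext hΔ) ≫ Δ₂.lift j) ≫ k₂ := by
  subst hΔ
  obtain ⟨x, hx, ex⟩ : ∃ x, IsSub (𝟙 _) (Δ₁.sub (F.restrict₁ Θ Υ Φ))
      ((F.d Θ Υ).sub (F.restrict₁ Θ Υ Φ)) x ∧
      x ≫ (F.d Θ Υ).lift (F.restrict₁ Θ Υ Φ) = Δ₁.lift (F.restrict₁ Θ Υ Φ) ≫ k₁ :=
    (isSub_lift (F.d Θ Υ) _).exists_factor ((isSub_lift Δ₁ _).comp hk₁)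
      ((Category.comp_id _).trans (Category.id_comp _).symm)
  have hj : j = x ≫ F.interleave₁ Θ Υ Φ := by
    refine into_ext _ _ ?_ ?_
    · rw [Category.assoc, PseudoDisplay.interleave₁, into_proj, ← Category.assoc, ex, hj₁,
        Category.assoc]
    · rw [Category.assoc, PseudoDisplay.interleave₁, into_lift, ← Category.assoc, hx.w, hj₂,
        Category.comp_id]
  obtain ⟨y, hy, ey⟩ : ∃ y, IsSub x (Δ₂.sub j)
      ((F.d (Θ.append Υ) Φ).sub (F.interleave₁ Θ Υ Φ)) y ∧
      y ≫ (F.d (Θ.append Υ) Φ).lift (F.interleave₁ Θ Υ Φ) = Δ₂.lift j ≫ k₂ :=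
    (isSub_lift _ _).exists_factor ((isSub_lift _ j).comp hk₂) ((Category.comp_id j).trans hj)
  have hs : IsSub (𝟙 _) ((Δ₁.sub (F.restrict₁ Θ Υ Φ)).append (Δ₂.sub j)) (F.sigma Θ Υ Φ) y :=
    hx.append hy
  refine ⟨y ≫ eqToHom (congrArg Tel.ext h).symm,
    (hs.comp (isSub_eqToHom h.symm)).congr (Category.comp_id _).symm rfl, ?_⟩
  have he : eqToHom (congrArg Tel.ext h).symm ≫ F.sigmaSnd h =
      (F.d (Θ.append Υ) Φ).lift (F.interleave₁ Θ Υ Φ) :=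
    (Category.assoc _ _ _).symm.trans
      ((congrArg (· ≫ (F.d (Θ.append Υ) Φ).lift (F.interleave₁ Θ Υ Φ)) (eqToHom_trans _ _)).trans
        (Category.id_comp _))
  refine (Category.assoc _ _ _).trans ((congrArg (y ≫ ·) he).trans (ey.trans ?_))
  exact (congrArg (· ≫ k₂) (Category.id_comp _)).symm

namespace CompleteDisplay

variable (E : CompleteDisplay M) {Γ : M.Ctx .sm}

/-- The comparison map `(Θ ∣ Φ)^D ⟶ (Θ^D ∣ Φ[evens] ∣ Φ^d)`. -/
noncomputable abbrev compar (Θ : Tel (M.L.obj Γ)) (Φ : Tel Θ.ext) :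
    (E.D (Θ.append Φ)).ext ⟶ (E.d Θ Φ).ext := E.comparison Θ Φ (TelClass.mem_all Φ)

theorem compar_interleave (Θ : Tel (M.L.obj Γ)) (Φ : Tel Θ.ext) :
    E.compar Θ Φ ≫ E.interleave Θ Φ = 𝟙 _ :=
  have := E.isIso_comparison Θ Φ
  IsIso.hom_inv_id _

/-- At a single type the comparison map is strict, hence canonical. -/
theorem isSub_compar_single (Θ : Tel (M.L.obj Γ)) (A : MTy Θ.ext) :
    IsSub (𝟙 Γ) (E.D (Θ.append (single A)))
      ((E.D Θ).append (((single A).sub (E.evens Θ)).append (E.d Θ (single A))))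
      (E.compar Θ (single A)) := by
  obtain ⟨h, e⟩ := E.isTypeDisplay.strict Γ Θ (single A) (TelClass.len1_single A)
  have h' : E.D (Θ.append (single A)) =
      (E.D Θ).append (((single A).sub (E.evens Θ)).append (E.d Θ (single A))) :=
    h.trans (append_assoc _ _ _)
  exact (isSub_eqToHom h').congr rfl e

/-- By the rule for `[s, t, t']^od`, the comparison map of `(Φ, x : A)` has that of `A` as its
second component. Both are compositions of canonical maps over the identity. -/
theorem compar_sigmaSnd (Θ : Tel (M.L.obj Γ)) (Φ : Tel Θ.ext) (A : MTy Φ.ext) :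
    E.compar Θ (Φ.append (single A)) ≫ E.sigmaSnd (E.disp_append Θ Φ (single A)) =
      E.compar (Θ.append Φ) (single A) := by
  have hb : IsSub (E.joinD Θ Φ) ((single A).sub (E.depEvens Θ Φ))
      ((single A).sub (E.evens (Θ.append Φ))) (E.snocBase Θ Φ (single A)) :=
    (isSub_lift (single A) _).of_comp (isSub_lift (single A) _) (into_proj ..) rfl (into_lift ..)
  have hj : IsSub (𝟙 Γ) ((E.D Θ).append (E.DD Θ Φ)) (E.D (Θ.append Φ)) (E.joinD Θ Φ) :=
    isSub_eqToHom (E.depDec.dec_append Θ Φ).symm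
  have h₁ : IsSub (𝟙 Γ) (((E.D Θ).append (E.DD Θ Φ)).append (E.snocTel Θ Φ (single A)))
      ((E.D (Θ.append Φ)).append (((single A).sub (E.evens (Θ.append Φ))).append
        (E.d (Θ.append Φ) (single A))))
      ((E.d (Θ.append Φ) (single A)).lift (E.snocBase Θ Φ (single A))) :=
    hj.append (hb.append (isSub_lift _ _))
  have h₂ : IsSub (𝟙 Γ) ((E.D Θ).append ((E.DD Θ Φ).append (E.snocTel Θ Φ (single A))))
      (((E.D Θ).append (E.DD Θ Φ)).append (E.snocTel Θ Φ (single A))) (𝟙 _) :=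
    isSub_eqToHom (append_assoc _ _ _).symm
  have h₃ : IsSub (𝟙 Γ) (E.D (Θ.append (Φ.append (single A))))
      ((E.D Θ).append ((E.DD Θ Φ).append (E.snocTel Θ Φ (single A))))
      (eqToHom (congrArg Tel.ext (E.depDec.dec_append Θ (Φ.append (single A)))) ≫
        eqToHom (congrArg (fun Ψ => ((E.D Θ).append Ψ).ext) (E.dec_snoc Θ Φ A))) :=
    (isSub_eqToHom ((E.depDec.dec_append Θ (Φ.append (single A))).trans
      (congrArg (E.D Θ).append (E.dec_snoc Θ Φ A)))).congr rfl (eqToHom_trans _ _)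
  have h₄ := ((h₃.comp h₂).comp h₁).congr (σ' := 𝟙 Γ) (by simp) rfl
  have h₅ := (h₄.liftTo_eq h₄.eq_sub).symm.trans
    ((E.isSub_compar_single (Θ.append Φ) A).liftTo_eq h₄.eq_sub)
  refine Eq.trans ?_ h₅
  refine (congrArg (· ≫ E.sigmaSnd (E.disp_append Θ Φ (single A)))
    (E.evOd_comparison Θ (Φ.append (single A)))).symm.trans ?_
  refine (Category.assoc _ _ _).trans ?_
  refine (congrArg (_ ≫ ·) (E.odds_snoc Θ Φ A)).trans ?_
  refine (Category.assoc _ _ _).symm.trans ?_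
  exact congrArg (· ≫ (E.d (Θ.append Φ) (single A)).lift (E.snocBase Θ Φ (single A)))
    (Category.comp_id _).symm

theorem isIso_sigmaSnd (Θ : Tel (M.L.obj Γ)) (Φ : Tel Θ.ext) (A : MTy Φ.ext) :
    IsIso (E.sigmaSnd (E.disp_append Θ Φ (single A))) :=
  @IsIso.of_isIso_fac_left _ _ _ _ _ _ _ _ (E.isIso_comparison Θ (Φ.append (single A)))
    (E.isIso_comparison (Θ.append Φ) (single A)) (E.compar_sigmaSnd Θ Φ A)

/-- The display of a telescope and its comparison map are determined by the underlying type
display. -/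
theorem exists_isSub_d (Θ : Tel (M.L.obj Γ)) (Φ : Tel Θ.ext) :
    ∃ k, IsSub (𝟙 (Φ.sub (E.evens Θ)).ext) (E.toTypeDisplay.displ Θ Φ) (E.d Θ Φ) k ∧
      E.toTypeDisplay.compar Θ Φ ≫ k = E.compar Θ Φ := by
  let T := E.toTypeDisplay
  induction Φ using snoc_induction with
  | nil =>
    have h : nil ((nil Θ.ext).sub (E.evens Θ)).ext = E.d Θ (nil Θ.ext) := (E.disp_nil Θ).symm
    have hk := isSub_eqToHom h
    refine ⟨eqToHom (congrArg Tel.ext h), hk, hom_ext_of_eq_nil h.symm ?_⟩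
    refine (Category.assoc _ _ _).trans ((congrArg (_ ≫ ·) hk.w).trans ?_)
    have h₁ := T.compar_proj Θ (nil Θ.ext)
    have h₂ := E.comparison_proj (nil Θ.ext) (TelClass.mem_all _) (Θ := Θ)
    exact h₁.trans (h₂.symm.trans (congrArg (_ ≫ ·) (Category.comp_id _)))
  | snoc Υ A ih =>
    obtain ⟨k₁, hk₁, e₁⟩ := ih
    obtain ⟨k₂, hk₂, e₂⟩ := T.exists_isSub_d₁_single (Θ.append Υ) A
    have hi : k₁ ≫ E.interleave Θ Υ = T.inter Θ Υ := by
      refine (Category.id_comp _).symm.trans ?_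
      refine (congrArg (· ≫ k₁ ≫ E.interleave Θ Υ) (T.inter_compar Θ Υ)).symm.trans ?_
      refine (Category.assoc _ _ _).trans ?_
      refine (congrArg (_ ≫ ·) ((Category.assoc _ _ _).symm.trans
        ((congrArg (· ≫ E.interleave Θ Υ) e₁).trans (E.compar_interleave Θ Υ)))).trans ?_
      exact Category.comp_id _
    obtain ⟨k, hk, e⟩ := E.exists_isSub_disp_append (E.disp_append Θ Υ (single A)) hk₁ hk₂
      (j := T.pseudo.interleave₁ Θ Υ (single A))
      ((into_proj ..).trans (congrArg (_ ≫ ·) ((T.interleave_pseudo Θ Υ).trans hi.symm)))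
      (into_lift ..) (T.displ_append Θ Υ (single A))
    refine ⟨k, hk, ?_⟩
    -- the second component is invertible, so the comparison maps may be compared there
    have := E.isIso_sigmaSnd Θ Υ A
    have h : T.map (.assoc Θ Υ (single A)) = 𝟙 _ := T.map_eq_eqToHom rfl _ rfl rfl
    have h' : T.compar Θ (Υ.append (single A)) ≫
        T.pseudo.sigmaSnd (T.displ_append Θ Υ (single A)) =
        T.compar (Θ.append Υ) (single A) := by
      rw [T.compar_sigmaSnd, h]
      exact Category.id_comp _
    refine (cancel_mono (E.sigmaSnd (E.disp_append Θ Υ (single A)))).1 ?_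
    refine (Category.assoc _ _ _).trans ((congrArg (_ ≫ ·) e).trans ?_)
    refine (Category.assoc _ _ _).symm.trans ((congrArg (· ≫ k₂) h').trans ?_)
    exact e₂.trans (E.compar_sigmaSnd Θ Υ A).symm

/-- Every complete display is generated by its underlying type display. -/
theorem complete_toTypeDisplay : E.toTypeDisplay.complete = E := by
  refine toTelescopeDisplay_injective (TelescopeDisplay.toDispAction_injective ?_)
  refine DispAction.ext_comparison rfl ?_ ?_ <;> rintro Γ Θ Φ -
  · obtain ⟨k, hk, -⟩ := E.exists_isSub_d Θ Φ
    exact heq_of_eq hk.eq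
  · obtain ⟨k, hk, e⟩ := E.exists_isSub_d Θ Φ
    exact (heq_of_eq (E.toTypeDisplay.comparison_action Θ Φ)).trans (hk.heq_of_comp e)

end CompleteDisplay

end DTT

theorem mainTheorem7 (M : DTT.DTTNaturalModel.{u, v, w}) (T : DTT.TypeDisplay M) :
    ∃! E : DTT.CompleteDisplay M, E.toTypeDisplay = T := by
  refine ⟨T.complete, T.toTypeDisplay_complete, ?_⟩
  rintro E rfl
  exact E.complete_toTypeDisplay.symm
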